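/- Let $A=(a_{ij})_{i,j\in I}$, $I$ finite, be the Cartan matrix of a simple complex Lie algebra $\mathfrak g$ of simply laced type (more generally, any symmetric integer matrix with $a_{ii}=2$ and $a_{ij}\in\{0,-1\}$ for $i\ne j$), and let $Q=\bigoplus_i\mathbb Z\alpha_i$ with the form $(\alpha_i|\alpha_j)=a_{ij}$. Let $q\in\mathbb C^\times$ be not a root of unity, fix $q^{1/2}$, and put $[k]=\frac{q^k-q^{-k}}{q-q^{-1}}$. *Fock space.* Let $V=S(\tilde{\mathfrak h}^-)$ be the polynomial algebra over $\mathbb C$ in variables $a_i(-n)$, $i\in I$, $n>0$ odd. Let $a_i(-n)$ act on it by multiplication and $a_i(n)$ as the derivation with $a_i(n)\cdot a_j(-m)=\delta_{nm}\frac{[a_{ij}n]}{2n}[n]$. Let $1\to\mathbb Z_2\to\hat Q\to Q\to 1$ be a central extension with $aba^{-1}b^{-1}=(-1)^{(\alpha|\beta)}$ for preimages $a,b$ of $\alpha,\beta$. Let $a_i\in\hat Q$ be a preimage of $\alpha_i$, and let $T$ be any complex $\hat Q$-module on which $a_ia_j=(-1)^{(\alpha_i|\alpha_j)}a_ja_i$.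 Put $V_Q=V\otimes T$. Let $:\ :$ denote normal ordering ($a_i(n)$ with $n>0$ to the right of $a_j(-m)$ with $m>0$, the order of the elements of $\hat Q$ being kept), and let $\delta(x)=\sum_{n\in\mathbb Z}x^n$. On $V_Q$ define $$X_i^\pm(z)=\exp\Big(\pm\sum_{n>0\text{ odd}}\tfrac{2q^{\mp n/2}}{[n]}a_i(-n)z^n\Big)\exp\Big(\mp\sum_{n>0\text{ odd}}\tfrac{2q^{\mp n/2}}{[n]}a_i(n)z^{-n}\Big)a_i^{\pm1}=\sum_{n\in\mathbb Z}X_i^\pm(n)z^{-n},$$ $$\Phi_i(z)=\exp\Big(2(q^{-1}-q)\sum_{n>0\text{ odd}}a_i(-n)z^n\Big),\qquad \Psi_i(z)=\exp\Big(2(q-q^{-1})\sum_{n>0\text{ odd}}a_i(n)z^{-n}\Big),$$ and let $G_{ij}(x)$ be the Taylor series at $x=0$ of $\frac{q^{a_{ij}}x-1}{q^{a_{ij}}x+1}\cdot\frac{x+q^{a_{ij}}}{x-q^{a_{ij}}}$. *Theorem.* On $V_Q$ one has, for odd $m,n$, $[a_i(m),a_j(n)]=\delta_{m,-n}\frac{[a_{ij}m]}{2m}\frac{q^m-q^{-m}}{q-q^{-1}}$;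 moreover $\Phi_i(q^{-1/2}z)={:}X_i^+(q^{-1}z)X_i^-(z){:}$ and $\Psi_i(q^{1/2}z)={:}X_i^+(qz)X_i^-(z){:}$. Furthermore, as identities of formal series with coefficients in $\operatorname{End}(V_Q)$ (upper signs together, lower signs together): 1. $\Phi_i(z)\Psi_j(w)=\Psi_j(w)\Phi_i(z)\,G_{ij}(q^{-1}z/w)/G_{ij}(qz/w)$. 2. $[\Phi_i(z),\Phi_j(w)]=[\Psi_i(z),\Psi_j(w)]=0$. 3. $\Phi_i(z)X_j^\pm(w)\Phi_i(z)^{-1}=X_j^\pm(w)\,G_{ij}(q^{\mp1/2}z/w)^{\pm1}$. 4. $\Psi_i(z)X_j^\pm(w)\Psi_i(z)^{-1}=X_j^\pm(w)\,G_{ij}(q^{\mp1/2}w/z)^{\mp1}$. 5. If $(\alpha_i|\alpha_j)=0$: $[X_i^\pm(z),X_j^\pm(w)]=[X_i^+(z),X_j^-(w)]=0$. 6. If $(\alpha_i|\alpha_j)=-1$: $[X_i^+(z),X_j^-(w)]=2\,{:}X_i^+(z)X_j^-(-z){:}\,\delta(-\frac wz)$. 7. $[X_i^+(z),X_i^-(w)]=\frac{2(q+q^{-1})}{q-q^{-1}}\Big(\Psi_i(q^{-1/2}z)\,\delta(\tfrac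 wzq)-\Phi_i(q^{1/2}z)\,\delta(\tfrac wzq^{-1})\Big)$. 8. If $(\alpha_i|\alpha_j)=-1$: $(z-q^{\mp1}w)(z+q^{\pm1}w)X_i^\pm(z)X_j^\pm(w)=(q^{\mp1}z-w)(q^{\pm1}z+w)X_j^\pm(w)X_i^\pm(z)$. 9. $(z-q^{\pm2}w)(z+q^{\mp2}w)X_i^\pm(z)X_i^\pm(w)=(q^{\pm2}z-w)(q^{\mp2}z+w)X_i^\pm(w)X_i^\pm(z)+2(q+q^{-1})^2z^2\,\delta(-\tfrac wz)\,a_i^{\pm2}$. Let $U_q(\tilde{\mathfrak g})$ be the associative $\mathbb C$-algebra generated by $a_{im}$ ($m$ odd), $x^\pm_{in}$ ($n\in\mathbb Z$), a central element $c$ and a central invertible element $\gamma^{1/2}$ (written $q^{c/2}$), with $x_i^\pm(z)=\sum_n x^\pm_{in}z^{-n}$ and with $\phi_i(z),\psi_i(z)$ given by the same exponentials in the $a_{im}$ as $\Phi_i,\Psi_i$, subject to: relations 2, 5 and 8 for $\phi,\psi,x^\pm$; relation 1 with $G_{ij}(\gamma^{-1}z/w)/G_{ij}(\gamma z/w)$;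 relations 3 and 4 with $\gamma^{\mp1/2}$ for $q^{\mp1/2}$; $(z+w)[x_i^+(z),x_j^-(w)]=0$ if $(\alpha_i|\alpha_j)=-1$; relation 7 with right side $\frac{2(q+q^{-1})}{q-q^{-1}}\big(\psi_i(\gamma^{-1/2}z)\delta(\frac wz\gamma)-\phi_i(\gamma^{1/2}z)\delta(\frac wz\gamma^{-1})\big)$; and relation 9 with last term $2(q+q^{-1})^2z^2\,\delta(-\frac wz)\,c$. If $a_i^2$ acts on $T$ as the identity for every $i$, then $V_Q$ is a level-one representation of $U_q(\tilde{\mathfrak g})$: there is an algebra homomorphism $U_q(\tilde{\mathfrak g})\to\operatorname{End}(V_Q)$ with $c\mapsto1$, $\gamma^{\pm1/2}\mapsto q^{\pm1/2}$, $a_{im}\mapsto a_i(m)$ and $x^\pm_{in}\mapsto X_i^\pm(n)$. -/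

import Mathlib

open scoped TensorProduct

noncomputable section

namespace TwistedCurrent

/-! ### Formal series with coefficients in an algebra -/

/-- Formal series `a(z) = ∑_{m ∈ ℤ} a m • z ^ m`, infinite in both directions. -/
abbrev FD (B : Type*) := ℤ → B

/-- Formal series `F(z, w) = ∑_{m, n ∈ ℤ} F m n • z ^ m • w ^ n`. -/
abbrev FD₂ (B : Type*) := ℤ → ℤ → B

section Series

variable {B : Type*} [Ring B] [Algebra ℂ B]

/-- A power series read as a formal series in `z`. -/
def inZ (f : PowerSeries B) : FD B := fun m => if 0 ≤ m then PowerSeries.coeff m.toNat f else 0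

/-- A power series read as a formal series in `z⁻¹`. -/
def inZInv (f : PowerSeries B) : FD B := fun m => inZ f (-m)

/-- The one-term series `b z ^ k`. -/
def mono (k : ℤ) (b : B) : FD B := fun m => if m = k then b else 0

/-- The series `a(t z)`, where `p k` is the `k`-th power of the scalar (or central element) `t`. -/
def scale {R : Type*} [SMul R B] (p : ℤ → R) (a : FD B) : FD B := fun m => p m • a m

/-- The product `a(z) δ(t w / z)`, where `δ(x) = ∑_{n ∈ ℤ} x ^ n` and `p k` is the `k`-th power of
`t`: the coefficient at `z ^ m w ^ n` is `t ^ n • a (m + n)`. -/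
def mulDelta {R : Type*} [SMul R B] (p : ℤ → R) (a : FD B) : FD₂ B :=
  fun m n => p n • a (m + n)

/-- The product `a(z) b(w)`. -/
def prodZW (a b : FD B) : FD₂ B := fun m n => a m * b n

/-- The product `b(w) a(z)`. -/
def prodWZ (b a : FD B) : FD₂ B := fun m n => b n * a m

/-- The commutator `[a(z), b(w)]`. -/
def commZW (a b : FD B) : FD₂ B := prodZW a b - prodWZ b a

/-- A series in `w` alone. -/
def inW (b : FD B) : FD₂ B := fun m n => if m = 0 then b n else 0

/-- The product `(c z + d w) F(z, w)`. -/
def lin (c d : ℂ) (F : FD₂ B) : FD₂ B := fun m n => c • F (m - 1) n + d • F m (n - 1)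

/-- The product `F(z, w) g(z / w)`; used only where the sums are finite. -/
def mulZoverW (F : FD₂ B) (g : PowerSeries B) : FD₂ B :=
  fun m n => ∑ᶠ k : ℕ, F (m - k) (n + k) * PowerSeries.coeff k g

/-- The product `F(z, w) g(w / z)`; used only where the sums are finite. -/
def mulWoverZ (F : FD₂ B) (g : PowerSeries B) : FD₂ B :=
  fun m n => ∑ᶠ k : ℕ, F (m + k) (n - k) * PowerSeries.coeff k g

/-- The conjugate `U b(w) U⁻¹`, where `U = U(z)` is a power series in `z`. -/
def conjZ (U : PowerSeries B) (b : FD B) : FD₂ B :=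
  fun m n => inZ (U * PowerSeries.C (b n) * Ring.inverse U) m

/-- The conjugate `U b(w) U⁻¹`, where `U = U(z)` is a power series in `z⁻¹`. -/
def conjZInv (U : PowerSeries B) (b : FD B) : FD₂ B :=
  fun m n => inZInv (U * PowerSeries.C (b n) * Ring.inverse U) m

/-- The power series `∑_{n > 0, n odd} b n • x ^ n`. -/
def oddSeries (b : {n : ℕ // Odd n} → B) : PowerSeries B :=
  PowerSeries.mk fun n => if h : Odd n then b ⟨n, h⟩ else 0

/-- The exponential `∑_j f ^ j / j!` of a power series `f` without constant term (for such `f` the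
terms with `j > k` do not contribute to the `k`-th coefficient). -/
def expSeries (f : PowerSeries B) : PowerSeries B :=
  PowerSeries.mk fun k =>
    ∑ j ∈ Finset.range (k + 1), ((j.factorial : ℂ)⁻¹) • PowerSeries.coeff k (f ^ j)

end Series

/-- The `q`-integer `[k] = (q ^ k - q ^ (-k)) / (q - q⁻¹)`. -/
def qint (q : ℂ) (k : ℤ) : ℂ := (q ^ k - q ^ (-k)) / (q - q⁻¹)

/-- The Taylor series at `x = 0` of
`((q ^ a x - 1) / (q ^ a x + 1)) * ((x + q ^ a) / (x - q ^ a))`; the inverse is the one of power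
series, and its argument has the constant term `-q ^ a ≠ 0`. -/
def G (q : ℂ) (a : ℤ) : PowerSeries ℂ :=
  ((PowerSeries.C (q ^ a) * PowerSeries.X - 1) * (PowerSeries.X + PowerSeries.C (q ^ a))) *
    ((PowerSeries.C (q ^ a) * PowerSeries.X + 1) *
      (PowerSeries.X - PowerSeries.C (q ^ a)))⁻¹

/-- The series `G ^ ε` for a sign `ε`. -/
def Gpow (q : ℂ) (a : ℤ) (ε : ℤˣ) : PowerSeries ℂ := if ε = 1 then G q a else (G q a)⁻¹

/-! ### The algebra `U_q(g̃)` -/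

/-- The generators: the central element `c`, the central element `γ ^ (1/2) = q ^ (c/2)` and its
inverse, `a_i(m)` for odd `m`, and `x_i^ε(n)` for a sign `ε` and an integer `n`. -/
inductive Gen (ι : Type*)
  | c : Gen ι
  | gammaHalf : Gen ι
  | gammaHalfInv : Gen ι
  | a (i : ι) (m : {m : ℤ // Odd m}) : Gen ι
  | x (ε : ℤˣ) (i : ι) (n : ℤ) : Gen ι

/-- For odd `n : ℕ`, the odd integer `n`. -/
def posOdd (n : {n : ℕ // Odd n}) : {m : ℤ // Odd m} :=
  ⟨(n.1 : ℤ), by exact_mod_cast n.2⟩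

/-- For odd `n : ℕ`, the odd integer `-n`. -/
def negOdd (n : {n : ℕ // Odd n}) : {m : ℤ // Odd m} :=
  ⟨-(n.1 : ℤ), Odd.neg (by exact_mod_cast n.2)⟩

section Algebra

variable {ι : Type*}

/-- The free algebra on the generators. -/
abbrev Free (ι : Type*) := FreeAlgebra ℂ (Gen ι)

/-- A generator in the free algebra. -/
abbrev gen (g : Gen ι) : Free ι := FreeAlgebra.ι ℂ g

/-- The half-integral powers `γ ^ (k/2) = q ^ (k c/2)`. -/
def gammaHalfPow (k : ℤ) : Free ι :=
  if 0 ≤ k then gen Gen.gammaHalf ^ k.toNat else gen Gen.gammaHalfInv ^ (-k).toNat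

/-- `x_i^ε(z) = ∑_n x_i^ε(n) z ^ (-n)`. -/
def xSer (ε : ℤˣ) (i : ι) : FD (Free ι) := fun m => gen (Gen.x ε i (-m))

/-- `φ_i(z) = exp (2 (q⁻¹ - q) ∑_{n > 0 odd} a_i(-n) z ^ n)`, a power series in `z`. -/
def phiSer (q : ℂ) (i : ι) : PowerSeries (Free ι) :=
  expSeries (oddSeries fun n => (2 * (q⁻¹ - q)) • gen (Gen.a i (negOdd n)))

/-- `ψ_i(z) = exp (2 (q - q⁻¹) ∑_{n > 0 odd} a_i(n) z ^ (-n))`, a power series in `z⁻¹`. -/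
def psiSer (q : ℂ) (i : ι) : PowerSeries (Free ι) :=
  expSeries (oddSeries fun n => (2 * (q - q⁻¹)) • gen (Gen.a i (posOdd n)))

/-- The series `g(γ ^ (k/2) x)`. -/
def scaleGamma (g : PowerSeries ℂ) (k : ℤ) : PowerSeries (Free ι) :=
  PowerSeries.mk fun n => PowerSeries.coeff n g • gammaHalfPow (k * n)

/-- The defining relations of `U_q(g̃)`: every identity of formal series stands for the identities
of all its coefficients. -/
inductive Rel (q : ℂ) (A : Matrix ι ι ℤ) : Free ι → Free ι → Prop
  /-- `c` is central -/
  | c_central (y : Free ι) : Rel q A (gen Gen.c * y) (y * gen Gen.c)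
  /-- `γ ^ (1/2)` is central -/
  | gamma_central (y : Free ι) : Rel q A (gen Gen.gammaHalf * y) (y * gen Gen.gammaHalf)
  | gamma_mul_inv : Rel q A (gen Gen.gammaHalf * gen Gen.gammaHalfInv) 1
  | gamma_inv_mul : Rel q A (gen Gen.gammaHalfInv * gen Gen.gammaHalf) 1
  /-- `[φ_i(z), φ_j(w)] = 0` -/
  | phi_phi (i j : ι) (m n : ℤ) :
      Rel q A (commZW (inZ (phiSer q i)) (inZ (phiSer q j)) m n) 0
  /-- `[ψ_i(z), ψ_j(w)] = 0` -/
  | psi_psi (i j : ι) (m n : ℤ) :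
      Rel q A (commZW (inZInv (psiSer q i)) (inZInv (psiSer q j)) m n) 0
  /-- `φ_i(z) ψ_j(w) = ψ_j(w) φ_i(z) G_{ij}(γ⁻¹ z/w) / G_{ij}(γ z/w)` -/
  | phi_psi (i j : ι) (m n : ℤ) :
      Rel q A (prodZW (inZ (phiSer q i)) (inZInv (psiSer q j)) m n)
        (mulZoverW (prodWZ (inZInv (psiSer q j)) (inZ (phiSer q i)))
          (scaleGamma (G q (A i j)) (-2) * scaleGamma (G q (A i j))⁻¹ 2) m n)
  /-- `φ_i(z) x_j^±(w) φ_i(z)⁻¹ = x_j^±(w) G_{ij}(γ^{∓1/2} z/w)^{±1}` -/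
  | phi_x (ε : ℤˣ) (i j : ι) (m n : ℤ) :
      Rel q A (conjZ (phiSer q i) (xSer ε j) m n)
        (mulZoverW (inW (xSer ε j)) (scaleGamma (Gpow q (A i j) ε) (-(ε : ℤ))) m n)
  /-- `ψ_i(z) x_j^±(w) ψ_i(z)⁻¹ = x_j^±(w) G_{ij}(γ^{∓1/2} w/z)^{∓1}` -/
  | psi_x (ε : ℤˣ) (i j : ι) (m n : ℤ) :
      Rel q A (conjZInv (psiSer q i) (xSer ε j) m n)
        (mulWoverZ (inW (xSer ε j)) (scaleGamma (Gpow q (A i j) (-ε)) (-(ε : ℤ))) m n)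
  /-- `[x_i^±(z), x_j^±(w)] = 0` if `(α_i|α_j) = 0` -/
  | x_x_zero (ε : ℤˣ) (i j : ι) (h : A i j = 0) (m n : ℤ) :
      Rel q A (commZW (xSer ε i) (xSer ε j) m n) 0
  /-- `[x_i^+(z), x_j^-(w)] = 0` if `(α_i|α_j) = 0` -/
  | xp_xm_zero (i j : ι) (h : A i j = 0) (m n : ℤ) :
      Rel q A (commZW (xSer 1 i) (xSer (-1) j) m n) 0
  /-- `(z + w) [x_i^+(z), x_j^-(w)] = 0` if `(α_i|α_j) = -1` -/
  | xp_xm_neg (i j : ι) (h : A i j = -1) (m n : ℤ) :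
      Rel q A (lin 1 1 (commZW (xSer 1 i) (xSer (-1) j)) m n) 0
  /-- `[x_i^+(z), x_i^-(w)]
  = 2(q+q⁻¹)/(q-q⁻¹) (ψ_i(γ^{-1/2} z) δ(γ w/z) - φ_i(γ^{1/2} z) δ(γ⁻¹ w/z))` -/
  | xp_xm (i : ι) (m n : ℤ) :
      Rel q A (commZW (xSer 1 i) (xSer (-1) i) m n)
        ((2 * (q + q⁻¹) / (q - q⁻¹)) •
          (mulDelta (fun k => (gammaHalfPow (2 * k) : Free ι))
              (scale (fun k => (gammaHalfPow (-k) : Free ι)) (inZInv (psiSer q i))) m n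
            - mulDelta (fun k => (gammaHalfPow (-2 * k) : Free ι))
              (scale (fun k => (gammaHalfPow k : Free ι)) (inZ (phiSer q i))) m n))
  /-- `(z - q^{∓1}w)(z + q^{±1}w) x_i^±(z) x_j^±(w)
  = (q^{∓1}z - w)(q^{±1}z + w) x_j^±(w) x_i^±(z)` if `(α_i|α_j) = -1` -/
  | x_x_neg (ε : ℤˣ) (i j : ι) (h : A i j = -1) (m n : ℤ) :
      Rel q A
        (lin 1 (-q ^ (-(ε : ℤ))) (lin 1 (q ^ (ε : ℤ)) (prodZW (xSer ε i) (xSer ε j))) m n)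
        (lin (q ^ (-(ε : ℤ))) (-1) (lin (q ^ (ε : ℤ)) 1 (prodWZ (xSer ε j) (xSer ε i))) m n)
  /-- `(z - q^{±2}w)(z + q^{∓2}w) x_i^±(z) x_i^±(w)
  = (q^{±2}z - w)(q^{∓2}z + w) x_i^±(w) x_i^±(z) + 2(q+q⁻¹)² c z² δ(-w/z)` -/
  | x_x_same (ε : ℤˣ) (i : ι) (m n : ℤ) :
      Rel q A
        (lin 1 (-q ^ (2 * (ε : ℤ))) (lin 1 (q ^ (-2 * (ε : ℤ)))
          (prodZW (xSer ε i) (xSer ε i))) m n)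
        (lin (q ^ (2 * (ε : ℤ))) (-1) (lin (q ^ (-2 * (ε : ℤ))) 1
            (prodWZ (xSer ε i) (xSer ε i))) m n
          + mulDelta (fun k => (-1 : ℂ) ^ k)
              (mono 2 ((2 * (q + q⁻¹) ^ 2) • gen Gen.c)) m n)

/-- The twisted quantum current algebra `U_q(g̃)` attached to the matrix `A`. -/
abbrev Uq (q : ℂ) (A : Matrix ι ι ℤ) := RingQuot (Rel q A)

/-- A generator in `U_q(g̃)`. -/
def Uq.of (q : ℂ) (A : Matrix ι ι ℤ) (g : Gen ι) : Uq q A :=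
  RingQuot.mkAlgHom ℂ (Rel q A) (gen g)

end Algebra

/-! ### The Fock space -/

section Fock

variable {ι : Type*}

/-- `S(h̃⁻)`: the polynomials in the variables `a_i(-n)`, `n > 0` odd. -/
abbrev Fock (ι : Type*) := MvPolynomial (ι × {n : ℕ // Odd n}) ℂ

open Classical in
/-- The operator `a_i(m)` on `S(h̃⁻)` for odd `m`, with `γ = q`. For `m < 0` it is multiplication
by the variable `a_i(m)`. For `m > 0` it is the derivation that sends the variable `a_j(-n)` to
`[a_i(m), a_j(-n)] = δ_{m,n} ([(α_i|α_j) m] / (2m)) (q ^ m - q ^ (-m)) / (q - q⁻¹)`. -/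
def heisS (q : ℂ) (A : Matrix ι ι ℤ) (i : ι) (m : {m : ℤ // Odd m}) : Module.End ℂ (Fock ι) :=
  if m.1 < 0 then
    LinearMap.mulLeft ℂ (MvPolynomial.X (i, ⟨m.1.natAbs, Int.natAbs_odd.mpr m.2⟩))
  else
    (MvPolynomial.mkDerivation ℂ fun p : ι × {n : ℕ // Odd n} =>
      if (p.2.1 : ℤ) = m.1 then
        MvPolynomial.C (qint q (A i p.1 * m.1) / (2 * (m.1 : ℂ)) * qint q m.1)
      else 0 : Derivation ℂ (Fock ι) (Fock ι)).toLinearMap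

open Classical in
/-- The pointwise sum `v ↦ ∑ k, f k v` of a family of operators such that every vector is killed by
all but finitely many of them (and `0` for any other family). -/
def locSum {κ W : Type*} [AddCommGroup W] [Module ℂ W] (f : κ → Module.End ℂ W) :
    Module.End ℂ W :=
  if h : ∀ v, (Function.support fun k => f k v).Finite then
    { toFun := fun v => ∑ᶠ k, f k v
      map_add' := fun v w => by
        simp only [map_add]
        exact finsum_add_distrib (h v) (h w)
      map_smul' := fun c v => by
        simp only [map_smul, RingHom.id_apply]
        exact (smul_finsum' c (h v)).symm }
  else 0

/-- The one-variable series `F(t z, u z)`, with coefficients summed pointwise. -/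
def diag {W : Type*} [AddCommGroup W] [Module ℂ W] (t u : ℂ) (F : FD₂ (Module.End ℂ W)) :
    FD (Module.End ℂ W) :=
  fun p => locSum fun m : ℤ => (t ^ m * u ^ (p - m)) • F m (p - m)

variable {H : Type*} [Group H] {T : Type*} [AddCommGroup T] [Module ℂ T]

/-- The operator `a_i(m)` on `V_Q = S(h̃⁻) ⊗ T`. -/
def heis (q : ℂ) (A : Matrix ι ι ℤ) (T : Type*) [AddCommGroup T] [Module ℂ T]
    (i : ι) (m : {m : ℤ // Odd m}) : Module.End ℂ (Fock ι ⊗[ℂ] T) :=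
  LinearMap.rTensor T (heisS q A i m)

/-- The operator on `V_Q = S(h̃⁻) ⊗ T` given by the element `g` acting on `T`. -/
def actT (ι : Type*) (ρ : Representation ℂ H T) (g : H) : Module.End ℂ (Fock ι ⊗[ℂ] T) :=
  LinearMap.lTensor (Fock ι) (ρ g)

/-- `E_-^ε(α_i, z) = exp (ε ∑_{n > 0 odd} (2 q ^ (-ε n/2) / [n]) a_i(-n) z ^ n)`, where
`s = q ^ (1/2)`; a power series in `z`. -/
def Eminus (q s : ℂ) (A : Matrix ι ι ℤ) (T : Type*) [AddCommGroup T] [Module ℂ T]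
    (ε : ℤˣ) (i : ι) : PowerSeries (Module.End ℂ (Fock ι ⊗[ℂ] T)) :=
  expSeries (oddSeries fun n =>
    (((ε : ℤ) : ℂ) * (2 * s ^ (-(ε : ℤ) * (n.1 : ℤ)) / qint q n.1)) • heis q A T i (negOdd n))

/-- `E_+^ε(α_i, z) = exp (-ε ∑_{n > 0 odd} (2 q ^ (-ε n/2) / [n]) a_i(n) z ^ (-n))`, where
`s = q ^ (1/2)`; a power series in `z⁻¹`. -/
def Eplus (q s : ℂ) (A : Matrix ι ι ℤ) (T : Type*) [AddCommGroup T] [Module ℂ T]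
    (ε : ℤˣ) (i : ι) : PowerSeries (Module.End ℂ (Fock ι ⊗[ℂ] T)) :=
  expSeries (oddSeries fun n =>
    (-((ε : ℤ) : ℂ) * (2 * s ^ (-(ε : ℤ) * (n.1 : ℤ)) / qint q n.1)) • heis q A T i (posOdd n))

/-- The twisted vertex operator `X_i^ε(z) = E_-^ε(α_i, z) E_+^ε(α_i, z) a_i^ε`, where `e i` is the
preimage `a_i` of `α_i`. The coefficient at `z ^ m` is `X_i^ε(-m)`. -/
def vertex (q s : ℂ) (A : Matrix ι ι ℤ) (ρ : Representation ℂ H T) (e : ι → H)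
    (ε : ℤˣ) (i : ι) : FD (Module.End ℂ (Fock ι ⊗[ℂ] T)) :=
  fun m => locSum fun k : ℤ =>
    inZ (Eminus q s A T ε i) k * inZInv (Eplus q s A T ε i) (m - k) * actT ι ρ (e i ^ (ε : ℤ))

/-- The normal ordered product `:X_i^ε(z) X_j^ε'(w):`, equal to
`E_-^ε(α_i, z) E_-^ε'(α_j, w) E_+^ε(α_i, z) E_+^ε'(α_j, w) a_i^ε a_j^ε'`. -/
def normalOrd (q s : ℂ) (A : Matrix ι ι ℤ) (ρ : Representation ℂ H T) (e : ι → H)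
    (ε : ℤˣ) (i : ι) (ε' : ℤˣ) (j : ι) : FD₂ (Module.End ℂ (Fock ι ⊗[ℂ] T)) :=
  fun m n => locSum fun k : ℤ × ℤ =>
    inZ (Eminus q s A T ε i) k.1 * inZ (Eminus q s A T ε' j) k.2 *
      inZInv (Eplus q s A T ε i) (m - k.1) * inZInv (Eplus q s A T ε' j) (n - k.2) *
      actT ι ρ (e i ^ (ε : ℤ)) * actT ι ρ (e j ^ (ε' : ℤ))

/-- `Φ_i(z) = exp (2 (q⁻¹ - q) ∑_{n > 0 odd} a_i(-n) z ^ n)`, a power series in `z`. -/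
def Phi (q : ℂ) (A : Matrix ι ι ℤ) (T : Type*) [AddCommGroup T] [Module ℂ T] (i : ι) :
    PowerSeries (Module.End ℂ (Fock ι ⊗[ℂ] T)) :=
  expSeries (oddSeries fun n => (2 * (q⁻¹ - q)) • heis q A T i (negOdd n))

/-- `Ψ_i(z) = exp (2 (q - q⁻¹) ∑_{n > 0 odd} a_i(n) z ^ (-n))`, a power series in `z⁻¹`. -/
def Psi (q : ℂ) (A : Matrix ι ι ℤ) (T : Type*) [AddCommGroup T] [Module ℂ T] (i : ι) :
    PowerSeries (Module.End ℂ (Fock ι ⊗[ℂ] T)) :=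
  expSeries (oddSeries fun n => (2 * (q - q⁻¹)) • heis q A T i (posOdd n))

/-- A series with complex coefficients as a series of scalar operators. -/
def scalarOp (ι T : Type*) [AddCommGroup T] [Module ℂ T] (g : PowerSeries ℂ) :
    PowerSeries (Module.End ℂ (Fock ι ⊗[ℂ] T)) :=
  PowerSeries.map (algebraMap ℂ (Module.End ℂ (Fock ι ⊗[ℂ] T))) g

end Fock

/-- The symmetric bilinear form `(α|β)` on the lattice `⊕ ℤ α_i` with `(α_i|α_j) = A i j`. -/
def form {ι : Type*} [Fintype ι] (A : Matrix ι ι ℤ) (α β : ι → ℤ) : ℤ :=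
  ∑ i, ∑ j, α i * A i j * β j

end TwistedCurrent

end

/-! Every operator series in the theorem is built from exponentials of Heisenberg operators and
elements of the group acting on `T`, and two such exponentials commute up to a scalar series. If the
commutators [r_n, p_m] are scalars δ_{nm} c_n, then exp r(z) exp p(w) = exp p(w) exp r(z) f(w/z)
with f = exp c (`IsExp.braid`): both sides solve the same first order equation in z. The c_n that
occur are sums of terms 2uⁿ/n over odd n, and each such sequence exponentiates to (1 + ux)/(1 - ux),
the series `ell u`. Hence every exchange factor is a product of series `ell u`; `G` itself is a
product of two of them. This gives the relations that involve Φ or Ψ on the left.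

For vertex operators, X(z) Y(w) = f(w/z) :X(z) Y(w): (`vert_mul_vert`). The opposite order gives the
same normal ordered product, up to the sign (-1)^(A i j) coming from the group, with factor f(z/w).
Each relation between two vertex operators therefore compares the expansions at 0 and at ∞ of one
rational function of x = w/z, and these differ by a delta function at every simple pole. A delta
function specializes the normal ordered product to a line w = z/u (`AntidiagFinite.conv_zpow`). For
X_i^+ and X_i^- there are two poles, x = q and x = q⁻¹; on each of the two lines either the creation
or the annihilation exponents cancel, leaving Ψ or Φ. For equal signs the quadratic prefactors
remove all poles, except x = -1 when i = j; there everything of odd degree cancels and only a_i^{±2}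
is left.

The infinite sums make sense because every vector is killed by almost all coefficients of an
annihilation exponential (`IsHeisenberg.locNil`). The level-one representation follows by checking
the defining relations on the free algebra (`VertexData.freeAct_rel`). -/

noncomputable section

namespace TwistedCurrent

/-! ### Exponentials of power series via the Euler operator -/

section Euler

variable {B : Type*} [Ring B] [Algebra ℂ B]

open PowerSeries Finset

/-- The Euler operator `x d/dx` on power series. -/
def euler (f : PowerSeries B) : PowerSeries B := PowerSeries.mk fun n => (n : ℂ) • coeff n f

@[simp] lemma coeff_euler (f : PowerSeries B) (n : ℕ) :
    coeff n (euler f) = (n : ℂ) • coeff n f := by simp [euler]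

lemma euler_add (f g : PowerSeries B) : euler (f + g) = euler f + euler g := by
  ext n; simp

lemma euler_sub (f g : PowerSeries B) : euler (f - g) = euler f - euler g := by
  ext n; simp [smul_sub]

lemma euler_smul (c : ℂ) (f : PowerSeries B) : euler (c • f) = c • euler f := by
  ext n; simp [smul_smul, mul_comm]

lemma euler_mul (f g : PowerSeries B) : euler (f * g) = euler f * g + f * euler g := by
  ext n
  simp only [coeff_euler, coeff_mul, map_add, Finset.smul_sum, ← Finset.sum_add_distrib]
  refine Finset.sum_congr rfl fun p hp => ?_
  rw [← HasAntidiagonal.mem_antidiagonal.mp hp]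
  push_cast
  rw [add_smul, smul_mul_assoc, mul_smul_comm]

lemma euler_C (b : B) : euler (C b) = 0 := by
  ext n
  rw [coeff_euler, coeff_C]
  split_ifs with h <;> simp [h]

lemma euler_one : euler (1 : PowerSeries B) = 0 := by
  simpa using euler_C (1 : B)

lemma euler_pow {f : PowerSeries B} (hf : Commute f (euler f)) (j : ℕ) :
    euler (f ^ (j + 1)) = ((j : ℂ) + 1) • (euler f * f ^ j) := by
  induction j with
  | zero => simp
  | succ j ih =>
    have h : f * (euler f * f ^ j) = euler f * f ^ (j + 1) := by
      rw [← mul_assoc, hf.eq, mul_assoc, ← pow_succ']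
    rw [pow_succ' f (j + 1), euler_mul, ih, mul_smul_comm, h]
    push_cast
    simp only [add_smul, one_smul]
    abel

/-- A solution of `x dY/dx = p Y`, with `p` and `Y` without constant term, is zero. -/
lemma eq_zero_of_euler_eq {p Y : PowerSeries B} (hp : coeff 0 p = 0) (h : euler Y = p * Y)
    (h0 : coeff 0 Y = 0) : Y = 0 := by
  ext n
  induction n using Nat.strong_induction_on with
  | _ n ih =>
    rcases Nat.eq_zero_or_pos n with rfl | hn
    · simpa using h0
    have h1 := congrArg (coeff n) h
    rw [coeff_euler, coeff_mul, Finset.sum_eq_zero] at h1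
    · simpa [hn.ne'] using h1
    · rintro ⟨a, b⟩ hab
      rw [HasAntidiagonal.mem_antidiagonal] at hab
      rcases Nat.eq_zero_or_pos a with rfl | ha
      · rw [hp, zero_mul]
      · rw [ih b (by simp only at hab; omega), map_zero, mul_zero]

/-- `F = exp f`, characterized by `F 0 = 1` and the differential equation. -/
def IsExp (f F : PowerSeries B) : Prop := coeff 0 F = 1 ∧ euler F = euler f * F

lemma coeff_zero_euler (f : PowerSeries B) : coeff 0 (euler f) = 0 := by simp

lemma IsExp.unique {f F F' : PowerSeries B} (h : IsExp f F) (h' : IsExp f F') : F = F' := by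
  rw [← sub_eq_zero]
  refine eq_zero_of_euler_eq (coeff_zero_euler f) ?_ ?_
  · rw [euler_sub, h.2, h'.2, mul_sub]
  · rw [map_sub, h.1, h'.1, sub_self]

lemma isExp_zero : IsExp (0 : PowerSeries B) 1 := by
  refine ⟨by simp, ?_⟩
  rw [euler_one, mul_one]
  ext n; simp

lemma coeff_pow_eq_zero {B : Type*} [Ring B] {f : PowerSeries B} (hf : coeff 0 f = 0)
    {j k : ℕ} (h : k < j) :
    coeff k (f ^ j) = 0 := by
  induction j generalizing k with
  | zero => omega
  | succ j ih =>
    rw [pow_succ', coeff_mul]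
    refine Finset.sum_eq_zero ?_
    rintro ⟨a, b⟩ hab
    rw [HasAntidiagonal.mem_antidiagonal] at hab
    rcases Nat.eq_zero_or_pos a with rfl | ha
    · rw [hf, zero_mul]
    · rw [ih (by simp only at hab; omega), mul_zero]

/-- Powers beyond the degree do not contribute, so the k-dependent truncation in `expSeries` may be
replaced by any longer one. This allows the Euler operator to be applied to a fixed polynomial in f.
-/
lemma coeff_expSeries {f : PowerSeries B} (hf : coeff 0 f = 0) {k M : ℕ} (h : k < M) :
    coeff k (expSeries f) =
      coeff k (∑ j ∈ range M, ((j.factorial : ℂ)⁻¹) • f ^ j) := by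
  rw [expSeries, coeff_mk, map_sum]
  simp only [coeff_smul]
  refine Finset.sum_subset (fun x => by simp only [mem_range]; omega) fun j _ hj => ?_
  rw [mem_range] at hj
  rw [coeff_pow_eq_zero hf (by omega), smul_zero]

lemma isExp_expSeries {f : PowerSeries B} (hf : coeff 0 f = 0) (hc : Commute f (euler f)) :
    IsExp f (expSeries f) := by
  refine ⟨by simp [expSeries], ?_⟩
  ext k
  rw [coeff_euler, coeff_expSeries hf (show k < k + 1 + 1 by omega), ← coeff_euler, coeff_mul]
  -- The left sum has one more term because the Euler operator turns f^(j+1)/(j+1)! into (euler f)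
  -- f^j/j!.
  have h1 : euler (∑ j ∈ range (k + 1 + 1), ((j.factorial : ℂ)⁻¹) • f ^ j) =
      euler f * ∑ j ∈ range (k + 1), ((j.factorial : ℂ)⁻¹) • f ^ j := by
    have h2 : ∀ (s : Finset ℕ) (g : ℕ → PowerSeries B),
        euler (∑ j ∈ s, g j) = ∑ j ∈ s, euler (g j) := by
      intro s g
      ext n; simp [Finset.smul_sum]
    rw [h2, Finset.sum_range_succ', Finset.mul_sum]
    simp only [euler_smul, euler_pow hc, pow_zero, euler_one, smul_zero, add_zero]
    refine Finset.sum_congr rfl fun j _ => ?_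
    rw [smul_smul, mul_smul_comm, Nat.factorial_succ]
    congr 1
    push_cast
    have : ((j : ℂ) + 1) ≠ 0 := by exact_mod_cast Nat.succ_ne_zero j
    field_simp
  rw [h1, coeff_mul]
  refine Finset.sum_congr rfl ?_
  rintro ⟨a, b⟩ hab
  rw [HasAntidiagonal.mem_antidiagonal] at hab
  rw [coeff_expSeries hf (show b < k + 1 by simp only at hab; omega)]

lemma IsExp.mul {f g F H : PowerSeries B} (hF : IsExp f F) (hG : IsExp g H)
    (hc : Commute (euler g) F) : IsExp (f + g) (F * H) := by
  refine ⟨?_, ?_⟩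
  · have := hF.1; have := hG.1
    simp_all
  · rw [euler_mul, hF.2, hG.2, euler_add, add_mul, mul_assoc, ← mul_assoc F, ← hc.eq, mul_assoc]

/-- If `[b, p(w)] = c w ^ n` with a scalar `c` then `[b, exp p(w)] = c w ^ n exp p(w)`. -/
lemma IsExp.commutator {p P : PowerSeries B} (hP : IsExp p P) {b : B} {c : ℂ} {n : ℕ}
    (hn : n ≠ 0) (h : C b * p - p * C b = c • X ^ n) :
    C b * P - P * C b = c • (X ^ n * P) := by
  have h' : C b * euler p - euler p * C b = ((n : ℂ) * c) • X ^ n := by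
    have := congrArg euler h
    rw [euler_sub, euler_mul, euler_mul, euler_C, euler_smul] at this
    rw [mul_comm (n : ℂ), ← smul_smul]
    have hX : euler (X ^ n : PowerSeries B) = (n : ℂ) • X ^ n := by
      ext k
      rw [coeff_euler, coeff_smul, coeff_X_pow]
      split_ifs with hk <;> simp [hk]
    rw [hX] at this
    simpa using this
  -- Y = [b, P] - c xⁿ P satisfies euler Y = (euler p) Y: the term n c xⁿ P produced by [b, euler p]
  -- cancels against euler (xⁿ).
  rw [← sub_eq_zero]
  refine eq_zero_of_euler_eq (coeff_zero_euler p) ?_ ?_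
  · have hX : euler (X ^ n : PowerSeries B) = (n : ℂ) • X ^ n := by
      ext k
      rw [coeff_euler, coeff_smul, coeff_X_pow]
      split_ifs with hk <;> simp [hk]
    rw [euler_sub, euler_sub, euler_smul, euler_mul, euler_mul, euler_mul, euler_C, hP.2, hX]
    have h2 : C b * (euler p * P) = euler p * C b * P + ((n : ℂ) * c) • (X ^ n * P) := by
      rw [← mul_assoc, ← sub_eq_iff_eq_add', ← sub_mul, h', smul_mul_assoc]
    have h3 : (X : PowerSeries B) ^ n * (euler p * P) = euler p * (X ^ n * P) := by
      rw [← mul_assoc, ← mul_assoc, (commute_X_pow (euler p) n).eq]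
    rw [h2, h3]
    simp only [zero_mul, mul_zero, zero_add, add_zero, smul_add, smul_mul_assoc, smul_smul,
      mul_sub, mul_smul_comm, mul_assoc, mul_comm (n : ℂ) c]
    abel
  · have h0 := hP.1
    simp only [map_sub, coeff_smul, coeff_zero_eq_constantCoeff_apply, map_mul] at h0 ⊢
    simp [h0, hn]

/-- Exponentials of two families of operators whose commutators are the scalars
`[r n, p m] = δ_{n,m} c n`: in coefficients, `R(z) P(w) = P(w) R(z) f(w/z)` with `f = exp c`. -/
lemma IsExp.braid {r p R P : PowerSeries B} {c f : PowerSeries ℂ}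
    (hR : IsExp r R) (hP : IsExp p P) (hf : IsExp c f)
    (h : ∀ n m, n ≠ 0 → coeff n r * coeff m p - coeff m p * coeff n r =
      if n = m then algebraMap ℂ B (coeff n c) else 0) (k l : ℕ) :
    coeff k R * coeff l P = ∑ x ∈ antidiagonal k,
      coeff x.2 f • (if x.2 ≤ l then coeff (l - x.2) P * coeff x.1 R else 0) := by
  -- The outer variable plays the role of z⁻¹ and the inner one of w, so F is f(w/z). The Euler
  -- operator acts on the outer variable, for which P(w) is a constant.
  let F : PowerSeries (PowerSeries B) := PowerSeries.mk fun t => coeff t f • X ^ t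
  let c' : PowerSeries (PowerSeries B) := PowerSeries.mk fun t => coeff t c • X ^ t
  have hF : IsExp c' F := by
    refine ⟨?_, ?_⟩
    · simp only [F, coeff_mk, hf.1]; simp
    · ext1 n
      have := congrArg (coeff n) hf.2
      rw [coeff_euler, coeff_mul] at this
      rw [coeff_euler, coeff_mul, coeff_mk, smul_smul, ← smul_eq_mul, this, Finset.sum_smul]
      refine Finset.sum_congr rfl fun x hx => ?_
      rw [coeff_euler, coeff_euler, coeff_mk, coeff_mk, ← HasAntidiagonal.mem_antidiagonal.mp hx, pow_add]
      simp only [smul_mul_assoc, mul_smul_comm, smul_smul, smul_eq_mul]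
      congr 1; ring
  have hcomm : ∀ Y : PowerSeries (PowerSeries B), Commute (euler c') Y := by
    intro Y
    ext1 n
    rw [coeff_mul, coeff_mul, ← Finset.Nat.sum_antidiagonal_swap]
    refine Finset.sum_congr rfl fun x _ => ?_
    simp only [Prod.fst_swap, Prod.snd_swap, coeff_euler, c', coeff_mk, smul_mul_assoc,
      mul_smul_comm, (commute_X_pow (coeff x.1 Y) x.2).eq]
  let R' : PowerSeries (PowerSeries B) := PowerSeries.map (C (R := B)) R
  let r' : PowerSeries (PowerSeries B) := PowerSeries.map (C (R := B)) r
  have hCs : ∀ (a : ℂ) (b : B), C (a • b) = a • (C b : PowerSeries B) := by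
    intro a b
    ext n
    rw [coeff_smul, coeff_C, coeff_C]
    split_ifs <;> simp
  have hR' : IsExp r' R' := by
    have heul : ∀ g : PowerSeries B, euler (PowerSeries.map (C (R := B)) g) =
        PowerSeries.map (C (R := B)) (euler g) := by
      intro g
      ext1 n
      rw [coeff_euler, coeff_map, coeff_map, coeff_euler, hCs]
    refine ⟨?_, ?_⟩
    · rw [coeff_map, hR.1, map_one]
    · simp only [R', r']
      rw [heul, heul, hR.2, map_mul]
  -- Each coefficient of r has a single scalar term as its commutator with p, so its commutator with
  -- P is known. Degree 0 disappears under the Euler operator, which is why `h` is needed only for n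
  -- ≠ 0.
  have key : euler r' * C P - C P * euler r' = C P * euler c' := by
    ext1 n
    rw [map_sub, coeff_mul_C, coeff_C_mul, coeff_C_mul, coeff_euler, coeff_euler, coeff_map,
      coeff_mk]
    rcases eq_or_ne n 0 with rfl | hn
    · simp
    rw [smul_mul_assoc, mul_smul_comm, ← smul_sub, hP.commutator (c := coeff n c) hn,
      mul_smul_comm, mul_smul_comm, (commute_X_pow P n).eq]
    ext m
    rw [map_sub, coeff_C_mul, coeff_mul_C, h n m hn, coeff_smul, coeff_X_pow]
    simp only [eq_comm (a := m)]
    split_ifs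
    · rw [Algebra.algebraMap_eq_smul_one]
    · simp
  -- By `key`, moving euler r' to the left past P absorbs the term euler c' that comes from
  -- differentiating F. Both sides then solve euler Y = (euler r') Y with the same constant term.
  have main : R' * C P = C P * R' * F := by
    rw [← sub_eq_zero]
    refine eq_zero_of_euler_eq (coeff_zero_euler r') ?_ ?_
    · rw [euler_sub, euler_mul, euler_mul, euler_mul, euler_C, hR'.2, hF.2]
      have h1 : euler r' * (C P * R' * F) = C P * (euler r' * R') * F + C P * R' * (euler c' * F) := by
        have h0 : R' * (euler c' * F) = euler c' * (R' * F) := by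
          rw [← mul_assoc, ← (hcomm R').eq, mul_assoc]
        rw [mul_assoc (C P) R' (euler c' * F), h0, ← mul_assoc (C P) (euler c'), ← key]
        simp only [sub_mul, mul_assoc]
        abel
      rw [mul_sub, h1]
      simp only [zero_mul, zero_add, mul_zero, add_zero, mul_assoc]
    · have h1 := hR'.1
      have h2 := hF.1
      rw [coeff_zero_eq_constantCoeff_apply] at h1 h2
      simp [h1, h2]
  have := congrArg (coeff l) (congrArg (coeff k) main)
  rw [coeff_mul_C, coeff_map, coeff_C_mul, coeff_mul, map_sum] at this
  rw [this]
  refine Finset.sum_congr rfl fun x _ => ?_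
  rw [coeff_C_mul, coeff_map, coeff_mk, mul_smul_comm, coeff_smul, coeff_mul_X_pow', coeff_mul_C]

end Euler

/-! ### The scalar series `(1 + u x) / (1 - u x)` -/

section Scalar

open PowerSeries

/-- The geometric series `1 / (1 - u x)`. -/
def geom (u : ℂ) : PowerSeries ℂ := PowerSeries.mk fun n => u ^ n

lemma geom_mul (u : ℂ) : geom u * (1 - C u * X) = 1 := by
  ext n
  rw [mul_sub, mul_one, ← mul_assoc, map_sub]
  rcases n with _ | n
  · simp [geom]
  · rw [coeff_succ_mul_X, coeff_mul_C, geom, coeff_mk, coeff_mk, coeff_one]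
    simp [pow_succ]

/-- The series `(1 + u x) / (1 - u x)`. -/
def ell (u : ℂ) : PowerSeries ℂ := 2 * geom u - 1

lemma coeff_ell (u : ℂ) (n : ℕ) : coeff n (ell u) = if n = 0 then 1 else 2 * u ^ n := by
  rw [ell, two_mul, map_sub, map_add, geom, coeff_mk, coeff_one]
  split_ifs with h
  · subst h; norm_num
  · ring

lemma ell_mul (u : ℂ) : ell u * (1 - C u * X) = 1 + C u * X := by
  rw [ell, sub_mul, mul_assoc, geom_mul]; ring

lemma one_add_mul_X_ne_zero (u : ℂ) : (1 + C u * X : PowerSeries ℂ) ≠ 0 := by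
  intro h
  simpa using congrArg constantCoeff h

lemma one_sub_mul_X_ne_zero (u : ℂ) : (1 - C u * X : PowerSeries ℂ) ≠ 0 := by
  intro h
  simpa using congrArg constantCoeff h

lemma ell_mul_ell_neg (u : ℂ) : ell u * ell (-u) = 1 := by
  refine mul_right_cancel₀ (one_sub_mul_X_ne_zero u) (mul_right_cancel₀ (one_add_mul_X_ne_zero u) ?_)
  have h := ell_mul (-u)
  rw [map_neg, neg_mul, sub_neg_eq_add, ← sub_eq_add_neg] at h
  calc ell u * ell (-u) * (1 - C u * X) * (1 + C u * X)
      = (ell u * (1 - C u * X)) * (ell (-u) * (1 + C u * X)) := by ring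
    _ = _ := by rw [ell_mul, h]; ring

lemma constantCoeff_ell (u : ℂ) : constantCoeff (ell u) = 1 := by
  rw [← coeff_zero_eq_constantCoeff_apply, coeff_ell, if_pos rfl]

lemma inv_ell (u : ℂ) : (ell u)⁻¹ = ell (-u) := by
  symm
  rw [PowerSeries.eq_inv_iff_mul_eq_one (by rw [constantCoeff_ell]; exact one_ne_zero), mul_comm,
    ell_mul_ell_neg]

lemma rescale_ell (b u : ℂ) : rescale b (ell u) = ell (b * u) := by
  ext n
  rw [coeff_rescale, coeff_ell, coeff_ell]
  split_ifs with h
  · simp [h]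
  · rw [mul_pow]; ring

/-- The logarithm of `ell u`. -/
def logEll (u : ℂ) : PowerSeries ℂ := oddSeries fun n => 2 * u ^ n.1 / n.1

lemma coeff_oddSeries {B : Type*} [Ring B] [Algebra ℂ B] (b : {n : ℕ // Odd n} → B) (n : ℕ) :
    coeff n (oddSeries b) = if h : Odd n then b ⟨n, h⟩ else 0 := coeff_mk _ _

lemma coeff_euler_logEll (u : ℂ) (n : ℕ) :
    coeff n (euler (logEll u)) = if Odd n then 2 * u ^ n else 0 := by
  rw [coeff_euler, logEll, coeff_oddSeries]
  split_ifs with h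
  · have : (n : ℂ) ≠ 0 := by exact_mod_cast h.pos.ne'
    simp only [smul_eq_mul]
    field_simp
  · simp

/-- The logarithmic derivative of (1 + ux)/(1 - ux) is 2ux/(1 - u²x²), whose expansion has only odd
powers. Multiplying by (1 - ux)² clears the denominators. -/
lemma isExp_ell (u : ℂ) : IsExp (logEll u) (ell u) := by
  refine ⟨by simpa using constantCoeff_ell u, ?_⟩
  refine mul_right_cancel₀ (one_sub_mul_X_ne_zero u) (mul_right_cancel₀ (one_sub_mul_X_ne_zero u) ?_)
  have h1 : euler (logEll u) * (1 - C (u ^ 2) * X ^ 2) = 2 * (C u * X) := by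
    ext n
    rw [mul_sub, mul_one, ← mul_assoc, map_sub, coeff_mul_X_pow', coeff_mul_C, two_mul, map_add,
      coeff_C_mul, coeff_X, coeff_euler_logEll, coeff_euler_logEll]
    rcases n with _ | _ | n
    · simp
    · simp; ring
    · rcases Nat.even_or_odd n with hn | hn
      · have h1 : ¬ Odd n := Nat.not_odd_iff_even.mpr hn
        have h2 : ¬ Odd (n + 1 + 1) := by simpa [Nat.odd_add_one] using hn
        simp [h1, h2]
      · have h2 : Odd (n + 1 + 1) := by simpa [Nat.odd_add_one] using hn
        simp [hn, h2]
        ring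
  have hX : euler (C u * X : PowerSeries ℂ) = C u * X := by
    ext n
    rw [coeff_euler, coeff_C_mul, coeff_X]
    split_ifs with h <;> simp [h]
  have h2 := congrArg euler (ell_mul u)
  rw [euler_mul, euler_sub, euler_add, euler_one, hX, zero_sub, zero_add] at h2
  have h3 := ell_mul u
  rw [map_pow] at h1
  linear_combination (1 - C u * X) * h2 - h1 + (C u * X) * h3 -
    euler (logEll u) * (1 - C u * X) * h3

/-- Partial fractions: for u ≠ v the poles are simple, and the product is 1 plus a multiple of the
difference of two geometric series. -/
lemma coeff_ell_mul_ell {u v : ℂ} (h : u ≠ v) (n : ℕ) :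
    coeff n (ell u * ell v) =
      if n = 0 then 1 else 2 * (u + v) / (u - v) * (u ^ n - v ^ n) := by
  have huv : u - v ≠ 0 := sub_ne_zero.mpr h
  have key : ell u * ell v = 1 + C (2 * (u + v) / (u - v)) * (geom u - geom v) := by
    refine mul_right_cancel₀ (one_sub_mul_X_ne_zero u)
      (mul_right_cancel₀ (one_sub_mul_X_ne_zero v) ?_)
    have h1 := ell_mul u
    have h2 := ell_mul v
    have h3 := geom_mul u
    have h4 := geom_mul v
    have h5 : C (2 * (u + v) / (u - v)) * (C u - C v) = 2 * (C u + C v : PowerSeries ℂ) := by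
      rw [← map_sub, ← map_mul, div_mul_cancel₀ _ huv, map_mul, map_add]
      rfl
    linear_combination (ell v * (1 - C v * X)) * h1 + (1 + C u * X) * h2 -
      C (2 * (u + v) / (u - v)) * (1 - C v * X) * h3 +
      C (2 * (u + v) / (u - v)) * (1 - C u * X) * h4 - X * h5
  rw [key, map_add, coeff_one, coeff_C_mul, map_sub, geom, geom, coeff_mk, coeff_mk]
  split_ifs with hn
  · simp [hn]
  · simp

/-- With c = q^a, the factors of `G` are (cx - 1)/(cx + 1) = -`ell (-c)` and (x + c)/(x - c) = -`ell
c⁻¹`; the signs cancel. -/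
lemma G_eq {q : ℂ} (hq : q ≠ 0) (a : ℤ) : G q a = ell (q ^ (-a)) * ell (-q ^ a) := by
  have hc : q ^ a ≠ 0 := zpow_ne_zero a hq
  rw [G, zpow_neg]
  generalize q ^ a = c at hc
  symm
  rw [PowerSeries.eq_mul_inv_iff_mul_eq (by simpa using hc)]
  have h1 := ell_mul c⁻¹
  have h2 := ell_mul (-c)
  have h3 : (C c * C c⁻¹ : PowerSeries ℂ) = 1 := by
    rw [← map_mul, mul_inv_cancel₀ hc, map_one]
  rw [map_neg] at h2
  linear_combination (-C c * (ell (-c) * (1 + C c * X))) * h1 - C c * (1 + C c⁻¹ * X) * h2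
    - X * (ell (-c)) * (1 + C c * X) * (ell c⁻¹) * h3 + (- X + C c * X^2) * h3

/-- Inverting `ell u` negates u, so the exponent ε can be moved inside as a sign of the arguments.
-/
lemma Gpow_eq {q : ℂ} (hq : q ≠ 0) (a : ℤ) (ε : ℤˣ) :
    Gpow q a ε = ell (((ε : ℤ) : ℂ) * q ^ (-a)) * ell (-((ε : ℤ) : ℂ) * q ^ a) := by
  rcases Int.units_eq_one_or ε with rfl | rfl
  · rw [Gpow, if_pos rfl, G_eq hq]; simp
  · rw [Gpow, if_neg (by decide), G_eq hq, PowerSeries.mul_inv_rev, inv_ell, inv_ell]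
    simp [mul_comm]

end Scalar

/-! ### Locally finite sums of operators -/

/-! ### Power series with integer exponents -/

section IntIndexed

variable {B : Type*} [Ring B]

open PowerSeries

lemma inZ_of_neg (f : PowerSeries B) {k : ℤ} (h : k < 0) : inZ f k = 0 := by
  simp [inZ, not_le.mpr h]

lemma inZ_natCast (f : PowerSeries B) (n : ℕ) : inZ f n = coeff n f := by
  simp [inZ]

lemma inZ_ext {f g : PowerSeries B} (h : ∀ m, inZ f m = inZ g m) : f = g := by
  ext n
  simpa only [inZ_natCast] using h n

lemma inZInv_apply (f : PowerSeries B) (m : ℤ) : inZInv f m = inZ f (-m) := rfl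

lemma finsum_int_eq_finsum_nat {M : Type*} [AddCommMonoid M] {F : ℤ → M}
    (h : ∀ t < 0, F t = 0) : ∑ᶠ t, F t = ∑ᶠ k : ℕ, F k := by
  rw [← finsum_mem_range (f := F) (g := fun k : ℕ => (k : ℤ)) Nat.cast_injective, finsum_mem_def]
  congr 1
  symm
  rw [Set.indicator_eq_self]
  intro t ht
  have : 0 ≤ t := by
    by_contra h0
    exact ht (h t (not_le.mp h0))
  exact ⟨t.toNat, Int.toNat_of_nonneg this⟩

lemma finsum_nat_eq_sum_range {M : Type*} [AddCommMonoid M] {F : ℕ → M} {n : ℕ}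
    (h : ∀ t, n < t → F t = 0) : ∑ᶠ t, F t = ∑ t ∈ Finset.range (n + 1), F t := by
  refine finsum_eq_sum_of_support_subset _ fun t ht => ?_
  rw [Finset.coe_range, Set.mem_Iio]
  by_contra h0
  exact ht (h t (by omega))

lemma finsum_comm' {α β M : Type*} [AddCommMonoid M] (f : α → β → M)
    (h : (Function.support fun x : α × β => f x.1 x.2).Finite) :
    ∑ᶠ a, ∑ᶠ b, f a b = ∑ᶠ b, ∑ᶠ a, f a b := by
  rw [← finsum_curry (fun x : α × β => f x.1 x.2) h, ← finsum_comp_equiv (Equiv.prodComm β α),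
    finsum_curry]
  · rfl
  · exact h.preimage (Equiv.prodComm β α).injective.injOn

lemma finsum_shift {M : Type*} [AddCommMonoid M] (f : ℤ → M) (a : ℤ) :
    ∑ᶠ t, f (t + a) = ∑ᶠ t, f t := finsum_comp_equiv (Equiv.addRight a)

lemma inZ_mul (f g : PowerSeries B) (m : ℤ) :
    inZ (f * g) m = ∑ᶠ t : ℤ, inZ f t * inZ g (m - t) := by
  rw [finsum_int_eq_finsum_nat fun t ht => by rw [inZ_of_neg f ht, zero_mul]]
  rcases lt_or_ge m 0 with hm | hm
  · rw [inZ_of_neg _ hm, finsum_eq_zero_of_forall_eq_zero]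
    intro t
    rw [inZ_of_neg g (by omega), mul_zero]
  · obtain ⟨n, rfl⟩ := Int.eq_ofNat_of_zero_le hm
    rw [finsum_nat_eq_sum_range (n := n) fun t ht => by rw [inZ_of_neg g (by omega), mul_zero],
      inZ_natCast, coeff_mul,
      Finset.Nat.sum_antidiagonal_eq_sum_range_succ fun a b => coeff a f * coeff b g]
    refine Finset.sum_congr rfl fun t ht => ?_
    rw [Finset.mem_range] at ht
    rw [inZ_natCast, ← Nat.cast_sub (by omega), inZ_natCast]

variable [Algebra ℂ B]

/-- The exchange relation `R(z) P(w) = P(w) R(z) f(w/z)` for a power series `R` in `z⁻¹` and a power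
series `P` in `w`. -/
def Braid (R P : PowerSeries B) (f : PowerSeries ℂ) : Prop :=
  ∀ k l : ℤ, inZ R k * inZ P l = ∑ᶠ t : ℤ, inZ f t • (inZ P (l - t) * inZ R (k - t))

lemma IsExp.braid_int {r p R P : PowerSeries B} {c f : PowerSeries ℂ}
    (hR : IsExp r R) (hP : IsExp p P) (hf : IsExp c f)
    (h : ∀ n m, n ≠ 0 → coeff n r * coeff m p - coeff m p * coeff n r =
      if n = m then algebraMap ℂ B (coeff n c) else 0) : Braid R P f := by
  intro k l
  rw [finsum_int_eq_finsum_nat fun t ht => by rw [inZ_of_neg f ht, zero_smul]]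
  rcases lt_or_ge k 0 with hk | hk
  · rw [inZ_of_neg _ hk, zero_mul, finsum_eq_zero_of_forall_eq_zero]
    intro t
    rw [inZ_of_neg R (by omega), mul_zero, smul_zero]
  rcases lt_or_ge l 0 with hl | hl
  · rw [inZ_of_neg _ hl, mul_zero, finsum_eq_zero_of_forall_eq_zero]
    intro t
    rw [inZ_of_neg P (by omega), zero_mul, smul_zero]
  obtain ⟨k, rfl⟩ := Int.eq_ofNat_of_zero_le hk
  obtain ⟨l, rfl⟩ := Int.eq_ofNat_of_zero_le hl
  rw [finsum_nat_eq_sum_range (n := k) fun t ht => by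
      rw [inZ_of_neg R (by omega), mul_zero, smul_zero],
    inZ_natCast, inZ_natCast, hR.braid hP hf h, ← Finset.Nat.sum_antidiagonal_swap]
  simp only [Prod.fst_swap, Prod.snd_swap]
  rw [Finset.Nat.sum_antidiagonal_eq_sum_range_succ fun b a =>
      coeff b f • (if b ≤ l then coeff (l - b) P * coeff a R else 0)]
  refine Finset.sum_congr rfl fun t ht => ?_
  rw [Finset.mem_range] at ht
  rw [inZ_natCast, ← Nat.cast_sub (by omega : t ≤ k), inZ_natCast]
  split_ifs with htl
  · rw [← Nat.cast_sub htl, inZ_natCast]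
  · rw [inZ_of_neg P (by omega), zero_mul]

end IntIndexed

/-! ### Vertex operators, normal ordering and bi-infinite scalar series -/

section LocallyFinite

variable {W : Type*} [AddCommGroup W] [Module ℂ W]

open PowerSeries

lemma locSum_apply {κ : Type*} {f : κ → Module.End ℂ W}
    (h : ∀ v, (Function.support fun k => f k v).Finite) (v : W) :
    locSum f v = ∑ᶠ k, f k v := by
  rw [locSum, dif_pos h]
  rfl

lemma locSum_mul {κ : Type*} {f : κ → Module.End ℂ W}
    (h : ∀ v, (Function.support fun k => f k v).Finite) (g : Module.End ℂ W) :
    locSum (fun k => f k * g) = locSum f * g := by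
  ext v
  rw [locSum_apply, Module.End.mul_apply, locSum_apply h]
  · rfl
  · exact fun v => h (g v)

/-- The coefficients of `R` annihilate each vector from some index on. -/
def LocNil (R : PowerSeries (Module.End ℂ W)) : Prop :=
  ∀ v, ∃ N : ℤ, ∀ k, N < k → inZ R k v = 0

lemma LocNil.uniform {R : PowerSeries (Module.End ℂ W)} (hR : LocNil R) (s : ℤ → W) (a b : ℤ) :
    ∃ N : ℤ, ∀ t, a ≤ t → t ≤ b → ∀ k, N < k → inZ R k (s t) = 0 := by
  choose N hN using fun t => hR (s t)
  obtain ⟨M, hM⟩ := ((Finset.Icc a b).image N).exists_le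
  exact ⟨M, fun t h1 h2 k hk => hN t k (lt_of_le_of_lt
    (hM _ (Finset.mem_image_of_mem N (Finset.mem_Icc.mpr ⟨h1, h2⟩))) hk)⟩

/-- Only finitely many vectors R'_b v are nonzero, so one bound serves for R on all of them. -/
lemma LocNil.joint {R R' : PowerSeries (Module.End ℂ W)} (hR : LocNil R) (hR' : LocNil R') (v : W) :
    ∃ N : ℤ, ∀ a b, N < a ∨ N < b → inZ R a (inZ R' b v) = 0 := by
  obtain ⟨N', hN'⟩ := hR' v
  obtain ⟨N, hN⟩ := hR.uniform (fun b => inZ R' b v) 0 N'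
  refine ⟨max N N', fun a b h => ?_⟩
  rcases lt_or_ge b 0 with hb | hb
  · rw [inZ_of_neg _ hb]; simp
  rcases lt_or_ge N' b with hb' | hb'
  · rw [hN' b hb', map_zero]
  · exact hN b hb hb' a (by omega)

/-- The vertex operator `P(z) R(z)`, for a power series `P` in `z` and a power series `R` in
`z⁻¹`. -/
def vert (P R : PowerSeries (Module.End ℂ W)) : FD (Module.End ℂ W) :=
  fun m => locSum fun k : ℤ => inZ P k * inZInv R (m - k)

lemma vert_finite {P R : PowerSeries (Module.End ℂ W)} (hR : LocNil R) (m : ℤ) (v : W) :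
    (Function.support fun k : ℤ => (inZ P k * inZInv R (m - k)) v).Finite := by
  obtain ⟨N, hN⟩ := hR v
  refine (Set.finite_Icc 0 (N + m)).subset fun k hk => ?_
  rw [Function.mem_support, Module.End.mul_apply, inZInv_apply] at hk
  constructor
  · by_contra h
    exact hk (by rw [inZ_of_neg P (by omega)]; rfl)
  · by_contra h
    exact hk (by rw [hN _ (by omega), map_zero])

lemma vert_finite' {P R : PowerSeries (Module.End ℂ W)} (hR : LocNil R) (m : ℤ) (v : W) :
    Function.HasFiniteSupport fun k : ℤ => inZ P k (inZ R (k - m) v) := by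
  have h := vert_finite (P := P) hR m v
  simp only [Module.End.mul_apply, inZInv_apply, neg_sub] at h
  exact h

lemma vert_apply {P R : PowerSeries (Module.End ℂ W)} (hR : LocNil R) (m : ℤ) (v : W) :
    vert P R m v = ∑ᶠ k : ℤ, inZ P k (inZ R (k - m) v) := by
  rw [vert, locSum_apply (vert_finite hR m)]
  refine finsum_congr fun k => ?_
  rw [Module.End.mul_apply, inZInv_apply, neg_sub]

/-- The normal ordered product `P(z) P'(w) R(z) R'(w)`. -/
def nord (P R P' R' : PowerSeries (Module.End ℂ W)) : FD₂ (Module.End ℂ W) :=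
  fun m n => locSum fun k : ℤ × ℤ =>
    inZ P k.1 * inZ P' k.2 * inZInv R (m - k.1) * inZInv R' (n - k.2)

lemma nord_finite {P R P' R' : PowerSeries (Module.End ℂ W)} (hR : LocNil R) (hR' : LocNil R')
    (m n : ℤ) (v : W) :
    (Function.support fun k : ℤ × ℤ =>
      (inZ P k.1 * inZ P' k.2 * inZInv R (m - k.1) * inZInv R' (n - k.2)) v).Finite := by
  obtain ⟨N, hN⟩ := hR.joint hR' v
  refine (Set.finite_Icc ((0 : ℤ), (0 : ℤ)) (N + m, N + n)).subset fun k hk => ?_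
  simp only [Function.mem_support, Module.End.mul_apply, inZInv_apply] at hk
  rw [Set.mem_Icc, Prod.le_def, Prod.le_def]
  refine ⟨⟨?_, ?_⟩, ?_, ?_⟩ <;> by_contra h <;> simp only [not_le] at h <;> apply hk
  · rw [inZ_of_neg P h]; rfl
  · rw [inZ_of_neg P' h]; simp
  · rw [hN _ _ (Or.inl (by omega)), map_zero, map_zero]
  · rw [hN _ _ (Or.inr (by omega)), map_zero, map_zero]

lemma nord_finite' {P R P' R' : PowerSeries (Module.End ℂ W)} (hR : LocNil R) (hR' : LocNil R')
    (m n : ℤ) (v : W) : Function.HasFiniteSupport fun k : ℤ × ℤ =>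
      inZ P k.1 (inZ P' k.2 (inZ R (k.1 - m) (inZ R' (k.2 - n) v))) := by
  have h := nord_finite (P := P) (P' := P') hR hR' m n v
  simp only [Module.End.mul_apply, inZInv_apply, neg_sub] at h
  exact h

lemma nord_apply {P R P' R' : PowerSeries (Module.End ℂ W)} (hR : LocNil R) (hR' : LocNil R')
    (m n : ℤ) (v : W) :
    nord P R P' R' m n v =
      ∑ᶠ k : ℤ × ℤ, inZ P k.1 (inZ P' k.2 (inZ R (k.1 - m) (inZ R' (k.2 - n) v))) := by
  rw [nord, locSum_apply (nord_finite hR hR' m n)]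
  refine finsum_congr fun k => ?_
  simp only [Module.End.mul_apply, inZInv_apply, neg_sub]

lemma nord_swap {P R P' R' : PowerSeries (Module.End ℂ W)} (hR : LocNil R) (hR' : LocNil R')
    (hP : ∀ k l, Commute (inZ P k) (inZ P' l)) (hRR : ∀ k l, Commute (inZ R k) (inZ R' l))
    (m n : ℤ) : nord P' R' P R n m = nord P R P' R' m n := by
  ext v
  rw [nord_apply hR' hR, nord_apply hR hR', ← finsum_comp_equiv (Equiv.prodComm ℤ ℤ)]
  refine finsum_congr fun k => ?_
  simp only [Equiv.prodComm_apply, Prod.fst_swap, Prod.snd_swap, ← Module.End.mul_apply,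
    ← mul_assoc, (hP k.1 k.2).eq]
  simp only [mul_assoc, (hRR (k.1 - m) (k.2 - n)).eq]

/-- Along each antidiagonal, the coefficients of `F` annihilate each vector with finitely many
exceptions. -/
def AntidiagFinite (F : FD₂ (Module.End ℂ W)) : Prop :=
  ∀ p v, (Function.support fun m : ℤ => F m (p - m) v).Finite

/-- In total degree p the creation indices are nonnegative and both annihilation indices are at most
N, which confines m to [-N, p + N]. This is what lets a normal ordered product be multiplied by a
series infinite in both directions, and be restricted to a line. -/
lemma nord_antidiagFinite {P R P' R' : PowerSeries (Module.End ℂ W)} (hR : LocNil R)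
    (hR' : LocNil R') : AntidiagFinite (nord P R P' R') := by
  intro p v
  obtain ⟨N, hN⟩ := hR.joint hR' v
  refine (Set.finite_Icc (-N) (p + N)).subset fun m hm => ?_
  rw [Function.mem_support, nord_apply hR hR'] at hm
  by_contra h
  refine hm (finsum_eq_zero_of_forall_eq_zero fun k => ?_)
  rcases lt_or_ge k.1 0 with h1 | h1
  · rw [inZ_of_neg P h1]; rfl
  rcases lt_or_ge k.2 0 with h2 | h2
  · rw [inZ_of_neg P' h2]; simp
  rw [Set.mem_Icc, not_and_or] at h
  rw [hN _ _ (by omega), map_zero, map_zero]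

/-- The action of a formal series `∑ c t x ^ t`, infinite in both directions, in `x = w/z`. -/
def conv (c : ℤ → ℂ) (F : FD₂ (Module.End ℂ W)) : FD₂ (Module.End ℂ W) :=
  fun m n => locSum fun t : ℤ => c t • F (m + t) (n - t)

variable {F : FD₂ (Module.End ℂ W)}

lemma AntidiagFinite.conv_finite (hF : AntidiagFinite F) (c : ℤ → ℂ) (m n : ℤ) (v : W) :
    (Function.support fun t : ℤ => (c t • F (m + t) (n - t)) v).Finite := by
  refine ((hF (m + n) v).preimage (add_right_injective m).injOn).subset fun t ht => ?_
  rw [Function.mem_support, LinearMap.smul_apply] at ht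
  rw [Set.mem_preimage, Function.mem_support, show m + n - (m + t) = n - t by ring]
  exact fun h => ht (by rw [h, smul_zero])

lemma AntidiagFinite.conv_apply (hF : AntidiagFinite F) (c : ℤ → ℂ) (m n : ℤ) (v : W) :
    conv c F m n v = ∑ᶠ t : ℤ, c t • F (m + t) (n - t) v := by
  rw [conv, locSum_apply (hF.conv_finite c m n)]
  rfl

lemma AntidiagFinite.conv_add (hF : AntidiagFinite F) (c d : ℤ → ℂ) :
    conv (c + d) F = conv c F + conv d F := by
  funext m n
  ext v
  simp only [Pi.add_apply, LinearMap.add_apply, hF.conv_apply, add_smul]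
  exact finsum_add_distrib (hF.conv_finite c m n v) (hF.conv_finite d m n v)

lemma AntidiagFinite.conv_smul (hF : AntidiagFinite F) (a : ℂ) (c : ℤ → ℂ) :
    conv (a • c) F = a • conv c F := by
  funext m n
  ext v
  simp only [Pi.smul_apply, LinearMap.smul_apply, hF.conv_apply, smul_eq_mul, mul_smul]
  exact (smul_finsum' a (hF.conv_finite c m n v)).symm

lemma AntidiagFinite.conv_sub (hF : AntidiagFinite F) (c d : ℤ → ℂ) :
    conv (c - d) F = conv c F - conv d F := by
  have h := hF.conv_add c ((-1 : ℂ) • d)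
  rw [hF.conv_smul] at h
  rwa [neg_one_smul, neg_one_smul, ← sub_eq_add_neg, ← sub_eq_add_neg] at h

/-- With x = w/z one has az + bw = w(a x⁻¹ + b). The factor w accounts for the shift n - 1 and x⁻¹
for the index t + 1. -/
lemma AntidiagFinite.lin_conv (hF : AntidiagFinite F) (a b : ℂ) (c : ℤ → ℂ) (m n : ℤ) :
    lin a b (conv c F) m n = conv (fun t => a * c (t + 1) + b * c t) F m (n - 1) := by
  have h1 : conv c F (m - 1) n = conv (fun t => c (t + 1)) F m (n - 1) := by
    ext v
    rw [hF.conv_apply, hF.conv_apply, ← finsum_shift _ 1]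
    refine finsum_congr fun t => ?_
    rw [show m - 1 + (t + 1) = m + t by ring, show n - (t + 1) = n - 1 - t by ring]
  have h2 : (fun t => a * c (t + 1) + b * c t) = a • (fun t => c (t + 1)) + b • c := rfl
  rw [h2, hF.conv_add, hF.conv_smul, hF.conv_smul, lin, h1]
  rfl

lemma AntidiagFinite.lin_lin_conv (hF : AntidiagFinite F) (a b a' b' : ℂ) (c : ℤ → ℂ) (m n : ℤ) :
    lin a b (lin a' b' (conv c F)) m n =
      conv (fun t => a * (a' * c (t + 2) + b' * c (t + 1)) + b * (a' * c (t + 1) + b' * c t)) F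
        m (n - 2) := by
  have h : ∀ m n, lin a' b' (conv c F) m n =
      conv (fun t => a' * c (t + 1) + b' * c t) F m (n - 1) := hF.lin_conv a' b' c
  have h2 := hF.lin_conv a b (fun t => a' * c (t + 1) + b' * c t) m (n - 1)
  rw [lin] at h2 ⊢
  rw [h, h, h2, show n - 1 - 1 = n - 2 by ring]
  simp only [add_assoc, one_add_one_eq_two]

lemma AntidiagFinite.diag_finite (hF : AntidiagFinite F) (t u : ℂ) (p : ℤ) (v : W) :
    (Function.support fun m : ℤ => ((t ^ m * u ^ (p - m)) • F m (p - m)) v).Finite := by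
  refine (hF p v).subset fun m hm => ?_
  rw [Function.mem_support, LinearMap.smul_apply] at hm
  exact fun h => hm (by rw [show F m (p - m) v = 0 from h, smul_zero])

lemma AntidiagFinite.diag_apply (hF : AntidiagFinite F) (t u : ℂ) (p : ℤ) (v : W) :
    diag t u F p v = ∑ᶠ m : ℤ, (t ^ m * u ^ (p - m)) • F m (p - m) v := by
  rw [diag, locSum_apply (hF.diag_finite t u p)]
  rfl

/-- The principle F(z, w) δ(uw/z) = F(z, u⁻¹z) δ(uw/z), legitimate because each antidiagonal sum is
finite on every vector. -/
lemma AntidiagFinite.conv_zpow (hF : AntidiagFinite F) {u : ℂ} (hu : u ≠ 0) :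
    conv (fun t => u ^ t) F = mulDelta (fun k => u ^ k) (diag 1 u⁻¹ F) := by
  funext m n
  ext v
  rw [hF.conv_apply, mulDelta, LinearMap.smul_apply, hF.diag_apply,
    smul_finsum' (u ^ n) (f := fun k : ℤ => ((1 : ℂ) ^ k * u⁻¹ ^ (m + n - k)) • F k (m + n - k) v)
      (hF.diag_finite 1 u⁻¹ (m + n) v), ← finsum_shift _ (-m)]
  refine finsum_congr fun t => ?_
  rw [smul_smul, show m + (t + -m) = t by ring, show n - (t + -m) = m + n - t by ring, one_zpow,
    one_mul, inv_zpow, ← zpow_neg, ← zpow_add₀ hu, show n + -(m + n - t) = t + -m by ring]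

end LocallyFinite

/-! ### Products, specializations and exchange of vertex operators -/

section LocallyFinite

variable {W : Type*} [AddCommGroup W] [Module ℂ W]

open PowerSeries

lemma finsum_end_apply {κ : Type*} {f : κ → Module.End ℂ W} (h : (Function.support f).Finite)
    (v : W) : (∑ᶠ k, f k) v = ∑ᶠ k, f k v :=
  map_finsum (LinearMap.applyₗ (R := ℂ) (M₂ := W) v) h

lemma Braid.apply {R P : PowerSeries (Module.End ℂ W)} {f : PowerSeries ℂ} (h : Braid R P f)
    (k l : ℤ) (v : W) :
    inZ R k (inZ P l v) = ∑ᶠ t : ℤ, inZ f t • inZ P (l - t) (inZ R (k - t) v) := by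
  rw [← Module.End.mul_apply, h k l, finsum_end_apply]
  · rfl
  · refine (Set.finite_Icc 0 l).subset fun t ht => ?_
    rw [Function.mem_support] at ht
    rw [Set.mem_Icc]
    refine ⟨?_, ?_⟩ <;> by_contra h <;> apply ht
    · rw [inZ_of_neg f (by omega), zero_smul]
    · rw [inZ_of_neg P (by omega), zero_mul, smul_zero]

/-- Only R and P' are in the wrong order for normal ordering; exchanging them costs f(w/z). Both
sides are then evaluations of one finite sum over three indices. -/
lemma vert_mul_vert {P R P' R' : PowerSeries (Module.End ℂ W)} {f : PowerSeries ℂ}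
    (hR : LocNil R) (hR' : LocNil R') (hb : Braid R P' f) (m n : ℤ) :
    vert P R m * vert P' R' n = conv (inZ f) (nord P R P' R') m n := by
  ext v
  obtain ⟨N, hN⟩ := hR.joint hR' v
  let g : ℤ × ℤ × ℤ → W := fun x => inZ f x.2.2 •
    inZ P x.2.1 (inZ P' (x.1 - x.2.2) (inZ R (x.2.1 - m - x.2.2) (inZ R' (x.1 - n) v)))
  have hg : (Function.support g).Finite := by
    refine (Set.finite_Icc ((0 : ℤ), (0 : ℤ), (0 : ℤ))
      (N + n, N + m + (N + n), N + n)).subset fun x hx => ?_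
    rw [Function.mem_support] at hx
    have h1 : 0 ≤ x.2.2 := by
      by_contra h; exact hx (by simp only [g]; rw [inZ_of_neg f (by omega), zero_smul])
    have h2 : 0 ≤ x.2.1 := by
      by_contra h
      exact hx (by simp only [g]; rw [inZ_of_neg P (by omega), LinearMap.zero_apply, smul_zero])
    have h3 : x.2.2 ≤ x.1 := by
      by_contra h
      exact hx (by
        simp only [g]; rw [inZ_of_neg P' (by omega), LinearMap.zero_apply, map_zero, smul_zero])
    have h4 : x.2.1 - m - x.2.2 ≤ N ∧ x.1 - n ≤ N := by
      by_contra h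
      exact hx (by simp only [g]; rw [hN _ _ (by omega), map_zero, map_zero, smul_zero])
    simp only [Set.mem_Icc, Prod.le_def]
    omega
  -- From (t, k₁, k₂), with t the power of w/z, to the indices of `g`: before the exchange the index
  -- of P' is k₂ + t.
  let e : ℤ × ℤ × ℤ ≃ ℤ × ℤ × ℤ :=
    { toFun := fun x => (x.2.2 + x.1, x.2.1, x.1)
      invFun := fun x => (x.2.2, x.2.1, x.1 - x.2.2)
      left_inv := fun x => by simp
      right_inv := fun x => by simp }
  have hl : ∑ᶠ x, g x = (vert P R m * vert P' R' n) v := by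
    rw [finsum_curry₃ g hg, Module.End.mul_apply, vert_apply hR', map_finsum _
      (vert_finite' (P := P') hR' n v)]
    refine finsum_congr fun l => ?_
    rw [vert_apply hR]
    refine finsum_congr fun k => ?_
    rw [hb.apply, map_finsum]
    · refine finsum_congr fun t => ?_
      rw [map_smul]
    · refine (Set.finite_Icc 0 l).subset fun t ht => ?_
      rw [Function.mem_support] at ht
      rw [Set.mem_Icc]
      refine ⟨?_, ?_⟩ <;> by_contra h <;> apply ht
      · rw [inZ_of_neg f (by omega), zero_smul]
      · rw [inZ_of_neg P' (by omega), LinearMap.zero_apply, smul_zero]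
  rw [← hl, (nord_antidiagFinite hR hR').conv_apply, ← finsum_comp_equiv e, finsum_curry]
  · refine finsum_congr fun t => ?_
    rw [nord_apply hR hR', smul_finsum']
    · refine finsum_congr fun k => ?_
      simp only [g, e, Equiv.coe_fn_mk, add_sub_cancel_right, sub_add_eq_sub_sub, sub_sub_eq_add_sub]
    · exact nord_finite' (P := P) (P' := P') hR hR' (m + t) (n - t) v
  · exact hg.preimage e.injective.injOn

/-- On the line (tz, uz) the creation parts merge into A(z) = P(tz)P'(uz) and the annihilation parts
into S. The latter are series in the inverse variable, hence the scalars t⁻¹ and u⁻¹. -/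
lemma diag_nord {P R P' R' A S : PowerSeries (Module.End ℂ W)} {t u : ℂ} (ht : t ≠ 0) (hu : u ≠ 0)
    (hR : LocNil R) (hR' : LocNil R')
    (hA : ∀ K, inZ A K = ∑ᶠ k : ℤ, (t ^ k * u ^ (K - k)) • (inZ P k * inZ P' (K - k)))
    (hS : ∀ K, inZ S K = ∑ᶠ k : ℤ, (t⁻¹ ^ k * u⁻¹ ^ (K - k)) • (inZ R k * inZ R' (K - k))) :
    LocNil S ∧ diag t u (nord P R P' R') = vert A S := by
  have hS' : ∀ K v, inZ S K v =
      ∑ᶠ k : ℤ, (t⁻¹ ^ k * u⁻¹ ^ (K - k)) • inZ R k (inZ R' (K - k) v) := by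
    intro K v
    rw [hS, finsum_end_apply]
    · rfl
    · refine (Set.finite_Icc 0 K).subset fun k hk => ?_
      rw [Function.mem_support] at hk
      rw [Set.mem_Icc]
      refine ⟨?_, ?_⟩ <;> by_contra h <;> apply hk
      · rw [inZ_of_neg R (by omega), zero_mul, smul_zero]
      · rw [inZ_of_neg R' (by omega), mul_zero, smul_zero]
  have hA' : ∀ K v, inZ A K v =
      ∑ᶠ k : ℤ, (t ^ k * u ^ (K - k)) • inZ P k (inZ P' (K - k) v) := by
    intro K v
    rw [hA, finsum_end_apply]
    · rfl
    · refine (Set.finite_Icc 0 K).subset fun k hk => ?_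
      rw [Function.mem_support] at hk
      rw [Set.mem_Icc]
      refine ⟨?_, ?_⟩ <;> by_contra h <;> apply hk
      · rw [inZ_of_neg P (by omega), zero_mul, smul_zero]
      · rw [inZ_of_neg P' (by omega), mul_zero, smul_zero]
  have hSn : LocNil S := by
    intro v
    obtain ⟨N, hN⟩ := hR.joint hR' v
    refine ⟨N + N, fun K hK => ?_⟩
    rw [hS', finsum_eq_zero_of_forall_eq_zero]
    intro k
    rw [hN _ _ (by omega), smul_zero]
  refine ⟨hSn, ?_⟩
  funext p
  ext v
  obtain ⟨N, hN⟩ := hR.joint hR' v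
  let g : ℤ × ℤ × ℤ → W := fun x => (t ^ (x.2.1 - x.2.2) * u ^ (p - (x.2.1 - x.2.2))) •
    inZ P x.2.1 (inZ P' (x.1 - x.2.1) (inZ R x.2.2 (inZ R' (x.1 - p - x.2.2) v)))
  have hg : (Function.support g).Finite := by
    refine (Set.finite_Icc ((0 : ℤ), (0 : ℤ), (0 : ℤ))
      (N + N + p, N + N + p, N)).subset fun x hx => ?_
    rw [Function.mem_support] at hx
    have h1 : 0 ≤ x.2.2 := by
      by_contra h
      exact hx (by
        simp only [g]
        rw [inZ_of_neg R (by omega), LinearMap.zero_apply, map_zero, map_zero, smul_zero])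
    have h2 : 0 ≤ x.2.1 := by
      by_contra h
      exact hx (by simp only [g]; rw [inZ_of_neg P (by omega), LinearMap.zero_apply, smul_zero])
    have h3 : x.2.1 ≤ x.1 := by
      by_contra h
      exact hx (by
        simp only [g]; rw [inZ_of_neg P' (by omega), LinearMap.zero_apply, map_zero, smul_zero])
    have h4 : x.2.2 ≤ N ∧ x.1 - p - x.2.2 ≤ N := by
      by_contra h
      exact hx (by simp only [g]; rw [hN _ _ (by omega), map_zero, map_zero, smul_zero])
    simp only [Set.mem_Icc, Prod.le_def]
    omega
  -- From (x, k₁, k₂), with x the exponent of the first variable, to the degree k₁ + k₂ of A, the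
  -- index k₁ of P and the index k₁ - x of R.
  let e : ℤ × ℤ × ℤ ≃ ℤ × ℤ × ℤ :=
    { toFun := fun x => (x.2.1 + x.2.2, x.2.1, x.2.1 - x.1)
      invFun := fun x => (x.2.1 - x.2.2, x.2.1, x.1 - x.2.1)
      left_inv := fun x => by simp
      right_inv := fun x => by simp }
  have hr : ∑ᶠ x, g x = vert A S p v := by
    rw [finsum_curry₃ g hg, vert_apply hSn]
    refine finsum_congr fun K => ?_
    rw [hA']
    refine finsum_congr fun k => ?_
    rw [hS', map_finsum, map_finsum, smul_finsum']
    · refine finsum_congr fun a => ?_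
      rw [map_smul, map_smul, smul_smul]
      simp only [g]
      congr 1
      rw [inv_zpow, inv_zpow, ← zpow_neg, ← zpow_neg, mul_mul_mul_comm, ← zpow_add₀ ht,
        ← zpow_add₀ hu]
      congr 2
      ring
    all_goals
      refine (Set.finite_Icc 0 N).subset fun a ha => ?_
      rw [Function.mem_support] at ha
      rw [Set.mem_Icc]
      refine ⟨?_, ?_⟩ <;> by_contra h <;> apply ha
      · rw [inZ_of_neg R (by omega)]; simp
      · rw [hN _ _ (Or.inl (by omega))]; simp
  rw [← hr, (nord_antidiagFinite hR hR').diag_apply, ← finsum_comp_equiv e, finsum_curry]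
  · refine finsum_congr fun x => ?_
    rw [nord_apply hR hR', smul_finsum']
    · refine finsum_congr fun k => ?_
      simp only [g, e, Equiv.coe_fn_mk, add_sub_cancel_left, sub_sub_cancel]
      rw [show k.1 + k.2 - p - (k.1 - x) = k.2 - (p - x) by ring]
    · exact nord_finite' (P := P) (P' := P') hR hR' x (p - x) v
  · exact hg.preimage e.injective.injOn

/-- A power series in `z` that commutes with `P` and exchanges with `R` exchanges with `P R`. -/
lemma mul_vert_of_commute_left {P R U : PowerSeries (Module.End ℂ W)} {g : PowerSeries ℂ}
    (hR : LocNil R) (hc : ∀ k l, Commute (inZ U k) (inZ P l)) (hb : Braid U R g) (m n : ℤ) :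
    inZ U m * vert P R n = ∑ᶠ t : ℤ, inZ g t • (vert P R (n + t) * inZ U (m - t)) := by
  ext v
  -- Once U has passed to the right, R acts only on the vectors U_t v with 0 ≤ t ≤ m; one bound for
  -- all of them makes the double sum finite.
  obtain ⟨N, hN⟩ := hR.uniform (fun t => inZ U t v) 0 m
  rw [finsum_end_apply, Module.End.mul_apply, vert_apply hR, map_finsum]
  · have h1 : ∀ k : ℤ, inZ U m (inZ P k (inZ R (k - n) v)) =
        ∑ᶠ t : ℤ, inZ g t • inZ P k (inZ R (k - n - t) (inZ U (m - t) v)) := by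
      intro k
      rw [← Module.End.mul_apply, (hc m k).eq, Module.End.mul_apply, hb.apply, map_finsum]
      · simp only [map_smul]
      · refine (Set.finite_Icc 0 m).subset fun t ht => ?_
        rw [Function.mem_support] at ht
        rw [Set.mem_Icc]
        refine ⟨?_, ?_⟩ <;> by_contra h <;> apply ht
        · rw [inZ_of_neg g (by omega), zero_smul]
        · rw [inZ_of_neg U (by omega), LinearMap.zero_apply, map_zero, smul_zero]
    rw [finsum_congr h1, finsum_comm']
    · refine finsum_congr fun t => ?_
      rw [LinearMap.smul_apply, Module.End.mul_apply, vert_apply hR, smul_finsum']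
      · simp only [sub_sub]
      · exact vert_finite' (P := P) hR (n + t) (inZ U (m - t) v)
    · refine (Set.finite_Icc ((0 : ℤ), (0 : ℤ)) (N + n + m, m)).subset fun x hx => ?_
      rw [Function.mem_support] at hx
      have h1 : 0 ≤ x.2 := by
        by_contra h; exact hx (by rw [inZ_of_neg g (by omega), zero_smul])
      have h2 : 0 ≤ x.1 := by
        by_contra h
        exact hx (by rw [inZ_of_neg P (by omega), LinearMap.zero_apply, smul_zero])
      have h3 : x.2 ≤ m := by
        by_contra h
        exact hx (by
          rw [inZ_of_neg U (by omega), LinearMap.zero_apply, map_zero, map_zero, smul_zero])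
      have h4 : x.1 - n - x.2 ≤ N := by
        by_contra h
        exact hx (by rw [hN (m - x.2) (by omega) (by omega) _ (by omega), map_zero, smul_zero])
      simp only [Set.mem_Icc, Prod.le_def]
      omega
  · exact vert_finite' (P := P) hR n v
  · refine (Set.finite_Icc 0 m).subset fun t ht => ?_
    rw [Function.mem_support] at ht
    rw [Set.mem_Icc]
    refine ⟨?_, ?_⟩ <;> by_contra h <;> apply ht
    · rw [inZ_of_neg g (by omega), zero_smul]
    · rw [inZ_of_neg U (by omega), mul_zero, smul_zero]

/-- A power series in `z⁻¹` that commutes with `R` and exchanges with `P` exchanges with `P R`. -/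
lemma mul_vert_of_commute_right {P R U : PowerSeries (Module.End ℂ W)} {g : PowerSeries ℂ}
    (hR : LocNil R) (hc : ∀ k l, Commute (inZ U k) (inZ R l)) (hb : Braid U P g) (m n : ℤ) :
    inZ U m * vert P R n = ∑ᶠ t : ℤ, inZ g t • (vert P R (n - t) * inZ U (m - t)) := by
  ext v
  obtain ⟨N, hN⟩ := hR.uniform (fun t => inZ U t v) 0 m
  rw [finsum_end_apply, Module.End.mul_apply, vert_apply hR, map_finsum]
  · have h1 : ∀ k : ℤ, inZ U m (inZ P k (inZ R (k - n) v)) =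
        ∑ᶠ t : ℤ, inZ g t • inZ P (k - t) (inZ R (k - n) (inZ U (m - t) v)) := by
      intro k
      rw [hb.apply]
      refine finsum_congr fun t => ?_
      rw [← Module.End.mul_apply (inZ U _), (hc (m - t) (k - n)).eq, Module.End.mul_apply]
    rw [finsum_congr h1, finsum_comm']
    · refine finsum_congr fun t => ?_
      rw [LinearMap.smul_apply, Module.End.mul_apply, vert_apply hR, smul_finsum',
        ← finsum_shift _ t]
      · refine finsum_congr fun k => ?_
        rw [add_sub_cancel_right, sub_sub_eq_add_sub]
      · exact vert_finite' (P := P) hR (n - t) (inZ U (m - t) v)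
    · refine (Set.finite_Icc ((0 : ℤ), (0 : ℤ)) (N + n, m)).subset fun x hx => ?_
      rw [Function.mem_support] at hx
      have h1 : 0 ≤ x.2 := by
        by_contra h; exact hx (by rw [inZ_of_neg g (by omega), zero_smul])
      have h2 : x.2 ≤ x.1 := by
        by_contra h
        exact hx (by rw [inZ_of_neg P (by omega), LinearMap.zero_apply, smul_zero])
      have h3 : x.2 ≤ m := by
        by_contra h
        exact hx (by
          rw [inZ_of_neg U (by omega), LinearMap.zero_apply, map_zero, map_zero, smul_zero])
      have h4 : x.1 - n ≤ N := by
        by_contra h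
        exact hx (by rw [hN (m - x.2) (by omega) (by omega) _ (by omega), map_zero, smul_zero])
      simp only [Set.mem_Icc, Prod.le_def]
      omega
  · exact vert_finite' (P := P) hR n v
  · refine (Set.finite_Icc 0 m).subset fun t ht => ?_
    rw [Function.mem_support] at ht
    rw [Set.mem_Icc]
    refine ⟨?_, ?_⟩ <;> by_contra h <;> apply ht
    · rw [inZ_of_neg g (by omega), zero_smul]
    · rw [inZ_of_neg U (by omega), mul_zero, smul_zero]

end LocallyFinite

/-! ### Commuting coefficients and rescaled variables -/

section Scaling

variable {B : Type*} [Ring B]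

open PowerSeries

lemma commute_of_coeff {f g : PowerSeries B} (h : ∀ n m, Commute (coeff n f) (coeff m g)) :
    Commute f g := by
  ext n
  rw [coeff_mul, coeff_mul, ← Finset.Nat.sum_antidiagonal_swap]
  refine Finset.sum_congr rfl fun x _ => ?_
  rw [Prod.fst_swap, Prod.snd_swap, (h x.2 x.1).eq]

lemma commute_inZ {P : PowerSeries B} {b : B} (h : ∀ n, Commute b (coeff n P)) (k : ℤ) :
    Commute b (inZ P k) := by
  rw [inZ]
  split_ifs
  · exact h _
  · exact Commute.zero_right _

lemma inZ_one (k : ℤ) : inZ (1 : PowerSeries B) k = if k = 0 then 1 else 0 := by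
  rcases lt_or_ge k 0 with hk | hk
  · rw [inZ_of_neg _ hk, if_neg hk.ne]
  · obtain ⟨n, rfl⟩ := Int.eq_ofNat_of_zero_le hk
    rw [inZ_natCast, coeff_one]
    simp

variable [Algebra ℂ B]

lemma isExp_expSeries_of_commute {f : PowerSeries B} (hf : coeff 0 f = 0)
    (hc : ∀ n m, Commute (coeff n f) (coeff m f)) : IsExp f (expSeries f) := by
  refine isExp_expSeries hf (commute_of_coeff fun n m => ?_)
  rw [coeff_euler]
  exact (hc n m).smul_right _

/-- An element that commutes with all coefficients of `p` commutes with those of `exp p`. -/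
lemma IsExp.commute_coeff {p P : PowerSeries B} (hP : IsExp p P) {b : B}
    (h : ∀ n, Commute b (coeff n p)) (n : ℕ) : Commute b (coeff n P) := by
  have h1 := hP.commutator (b := b) (c := 0) one_ne_zero (by
    rw [zero_smul, sub_eq_zero]
    ext m
    rw [coeff_C_mul, coeff_mul_C, (h m).eq])
  rw [zero_smul, sub_eq_zero] at h1
  have h2 := congrArg (coeff n) h1
  rwa [coeff_C_mul, coeff_mul_C] at h2

/-- The power series `f(t z)`. -/
def scalePS (t : ℂ) (f : PowerSeries B) : PowerSeries B :=
  PowerSeries.mk fun n => t ^ n • coeff n f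

lemma coeff_scalePS (t : ℂ) (f : PowerSeries B) (n : ℕ) :
    coeff n (scalePS t f) = t ^ n • coeff n f := coeff_mk _ _

lemma inZ_scalePS (t : ℂ) (f : PowerSeries B) (k : ℤ) :
    inZ (scalePS t f) k = t ^ k • inZ f k := by
  rcases lt_or_ge k 0 with hk | hk
  · rw [inZ_of_neg _ hk, inZ_of_neg _ hk, smul_zero]
  · obtain ⟨n, rfl⟩ := Int.eq_ofNat_of_zero_le hk
    rw [inZ_natCast, inZ_natCast, coeff_scalePS, zpow_natCast]

lemma IsExp.scalePS {f F : PowerSeries B} (h : IsExp f F) (t : ℂ) :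
    IsExp (scalePS t f) (scalePS t F) := by
  refine ⟨by simp [coeff_scalePS, h.1], ?_⟩
  ext n
  have := congrArg (coeff n) h.2
  rw [coeff_euler, coeff_mul] at this
  rw [coeff_euler, coeff_scalePS, smul_comm, this, coeff_mul, Finset.smul_sum]
  refine Finset.sum_congr rfl fun x hx => ?_
  rw [coeff_euler, coeff_euler, coeff_scalePS, coeff_scalePS,
    ← Finset.HasAntidiagonal.mem_antidiagonal.mp hx, pow_add]
  simp only [smul_mul_assoc, mul_smul_comm, smul_smul]
  congr 1; ring

lemma IsExp.inZ_scaled_mul {f g h F H K : PowerSeries B} (hF : IsExp f F) (hH : IsExp g H)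
    (hK : IsExp h K) (t u : ℂ) (hh : h = TwistedCurrent.scalePS t f + TwistedCurrent.scalePS u g)
    (hc : ∀ n m, Commute (coeff n g) (coeff m f)) (k : ℤ) :
    inZ K k = ∑ᶠ l : ℤ, (t ^ l * u ^ (k - l)) • (inZ F l * inZ H (k - l)) := by
  have h1 : K = TwistedCurrent.scalePS t F * TwistedCurrent.scalePS u H := by
    refine hK.unique ?_
    rw [hh]
    refine (hF.scalePS t).mul (hH.scalePS u) (commute_of_coeff fun n m => ?_)
    rw [coeff_euler, coeff_scalePS, coeff_scalePS]
    exact (((hF.commute_coeff (hc n) m).smul_left _).smul_left _).smul_right _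
  rw [h1, inZ_mul]
  refine finsum_congr fun l => ?_
  rw [inZ_scalePS, inZ_scalePS, smul_mul_assoc, mul_smul_comm, smul_smul]

/-- With exchange factor 1 only the term t = 0 survives. Thus commuting exponentials are the case c
= 0 of the general exchange. -/
lemma Braid.commute {R P : PowerSeries B} (h : Braid R P 1) (k l : ℤ) :
    Commute (inZ R k) (inZ P l) := by
  rw [commute_iff_eq]
  have := h k l
  rw [finsum_eq_single _ 0 fun t ht => by rw [inZ_one, if_neg ht, zero_smul], inZ_one] at this
  simpa using this

end Scaling

/-! ### Exponentials of Heisenberg operators -/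

section Heisenberg

open PowerSeries

lemma qint_neg (q : ℂ) (k : ℤ) : qint q (-k) = -qint q k := by
  rw [qint, qint, neg_neg, ← neg_div, neg_sub]

lemma posOdd_or_negOdd (m : {m : ℤ // Odd m}) : (∃ n, m = posOdd n) ∨ ∃ n, m = negOdd n := by
  obtain ⟨m, hm⟩ := m
  rcases le_or_gt 0 m with h | h
  · obtain ⟨n, rfl⟩ := Int.eq_ofNat_of_zero_le h
    exact Or.inl ⟨⟨n, by exact_mod_cast hm⟩, rfl⟩
  · obtain ⟨n, hn⟩ := Int.eq_ofNat_of_zero_le (neg_nonneg.mpr h.le)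
    refine Or.inr ⟨⟨n, ?_⟩, ?_⟩
    · have := hm.neg
      rw [hn] at this
      exact_mod_cast this
    · exact Subtype.ext (by simp only [negOdd]; omega)

/-- The operators `h i m` on `W` satisfy the relations of the Heisenberg algebra at `γ = q`, and
`W` is generated by vacuum vectors. -/
structure IsHeisenberg {ι W : Type*} [AddCommGroup W] [Module ℂ W] (q : ℂ) (A : Matrix ι ι ℤ)
    (h : ι → {m : ℤ // Odd m} → Module.End ℂ W) : Prop where
  pos_pos : ∀ i j n m, Commute (h i (posOdd n)) (h j (posOdd m))
  neg_neg : ∀ i j n m, Commute (h i (negOdd n)) (h j (negOdd m))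
  pos_neg : ∀ i j n m, h i (posOdd n) * h j (negOdd m) - h j (negOdd m) * h i (posOdd n) =
    if n = m then (qint q (A i j * n.1) / (2 * (n.1 : ℂ)) * qint q n.1) • 1 else 0
  generated : ∀ p : W → Prop, (∀ v, (∀ i n, h i (posOdd n) v = 0) → p v) →
    (∀ v w, p v → p w → p (v + w)) → (∀ j n v, p v → p (h j (negOdd n) v)) → ∀ v, p v

variable {ι W : Type*} [AddCommGroup W] [Module ℂ W] {q : ℂ} {A : Matrix ι ι ℤ}
  {h : ι → {m : ℤ // Odd m} → Module.End ℂ W} (hh : IsHeisenberg q A h)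

include hh in
lemma IsHeisenberg.commutator (hA : A.IsSymm) (i j : ι) (m n : {m : ℤ // Odd m}) :
    h i m * h j n - h j n * h i m =
      if m.1 = -n.1 then (qint q (A i j * m.1) / (2 * (m.1 : ℂ)) * qint q m.1) • 1 else 0 := by
  have hne : ∀ a b : {n : ℕ // Odd n}, (a.1 : ℤ) ≠ -(b.1 : ℤ) := fun a b h => by
    have := a.2.pos
    omega
  rcases posOdd_or_negOdd m with ⟨m, rfl⟩ | ⟨m, rfl⟩ <;>
    rcases posOdd_or_negOdd n with ⟨n, rfl⟩ | ⟨n, rfl⟩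
  · rw [(hh.pos_pos i j m n).eq, sub_self, if_neg (by exact hne m n)]
  · rw [hh.pos_neg]
    simp only [posOdd, negOdd, _root_.neg_neg, Nat.cast_inj, Subtype.ext_iff, Int.cast_natCast]
  · rw [← neg_sub, hh.pos_neg, ← (hA.apply i j : A j i = A i j)]
    simp only [posOdd, negOdd, neg_inj, Nat.cast_inj, Subtype.ext_iff, Int.cast_neg,
      Int.cast_natCast, mul_neg, qint_neg, eq_comm (a := m.1)]
    split_ifs with h
    · rw [h, ← neg_smul]
      congr 1
      ring
    · exact neg_zero
  · rw [(hh.neg_neg i j m n).eq, sub_self, if_neg]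
    simp only [negOdd]
    exact fun h => hne n m (by omega)

/-- The series `∑ b n a_i(-n) z ^ n`. -/
def creSeries (h : ι → {m : ℤ // Odd m} → Module.End ℂ W) (b : {n : ℕ // Odd n} → ℂ) (i : ι) :
    PowerSeries (Module.End ℂ W) :=
  oddSeries fun n => b n • h i (negOdd n)

/-- The series `∑ b n a_i(n) z ^ (-n)`. -/
def annSeries (h : ι → {m : ℤ // Odd m} → Module.End ℂ W) (b : {n : ℕ // Odd n} → ℂ) (i : ι) :
    PowerSeries (Module.End ℂ W) :=
  oddSeries fun n => b n • h i (posOdd n)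

variable (b b' : {n : ℕ // Odd n} → ℂ) (i j : ι)

include hh

lemma IsHeisenberg.commute_cre (n m : ℕ) :
    Commute (coeff n (creSeries h b i)) (coeff m (creSeries h b' j)) := by
  rw [creSeries, creSeries, coeff_oddSeries, coeff_oddSeries]
  split_ifs
  · exact ((hh.neg_neg i j _ _).smul_left _).smul_right _
  all_goals simp

lemma IsHeisenberg.commute_ann (n m : ℕ) :
    Commute (coeff n (annSeries h b i)) (coeff m (annSeries h b' j)) := by
  rw [annSeries, annSeries, coeff_oddSeries, coeff_oddSeries]
  split_ifs
  · exact ((hh.pos_pos i j _ _).smul_left _).smul_right _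
  all_goals simp

omit hh in
lemma coeff_zero_oddSeries {B : Type*} [Ring B] [Algebra ℂ B] (b : {n : ℕ // Odd n} → B) :
    coeff 0 (oddSeries b) = 0 := by
  rw [coeff_oddSeries, dif_neg (by decide)]

lemma IsHeisenberg.isExp_cre : IsExp (creSeries h b i) (expSeries (creSeries h b i)) :=
  isExp_expSeries_of_commute (coeff_zero_oddSeries _) (hh.commute_cre b b i i)

lemma IsHeisenberg.isExp_ann : IsExp (annSeries h b i) (expSeries (annSeries h b i)) :=
  isExp_expSeries_of_commute (coeff_zero_oddSeries _) (hh.commute_ann b b i i)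

lemma IsHeisenberg.ann_cre_commutator (n m : ℕ) :
    coeff n (annSeries h b i) * coeff m (creSeries h b' j) -
      coeff m (creSeries h b' j) * coeff n (annSeries h b i) =
      if n = m then algebraMap ℂ _ (if h : Odd n then
        b ⟨n, h⟩ * b' ⟨n, h⟩ * (qint q (A i j * n) / (2 * (n : ℂ)) * qint q n) else 0) else 0 := by
  rw [annSeries, creSeries, coeff_oddSeries, coeff_oddSeries]
  by_cases hn : Odd n
  · by_cases hm : Odd m
    · rw [dif_pos hn, dif_pos hm, dif_pos hn, smul_mul_smul_comm, smul_mul_smul_comm,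
        mul_comm (b' _), ← smul_sub, hh.pos_neg]
      simp only [Subtype.mk.injEq]
      split_ifs with hnm
      · subst hnm
        rw [smul_smul, Algebra.algebraMap_eq_smul_one]
      · exact smul_zero _
    · have : n ≠ m := fun h => hm (h ▸ hn)
      simp [hm, this]
  · simp [hn]

variable {b b' i j}

lemma IsHeisenberg.braid_ann_cre {c f : PowerSeries ℂ} (hf : IsExp c f)
    (hc : ∀ n (h : Odd n), coeff n c =
      b ⟨n, h⟩ * b' ⟨n, h⟩ * (qint q (A i j * n) / (2 * (n : ℂ)) * qint q n))
    (hc' : ∀ n, ¬ Odd n → coeff n c = 0) :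
    Braid (expSeries (annSeries h b i)) (expSeries (creSeries h b' j)) f := by
  refine (hh.isExp_ann b i).braid_int (hh.isExp_cre b' j) hf fun n m _ => ?_
  rw [hh.ann_cre_commutator]
  by_cases hn : Odd n
  · rw [dif_pos hn, hc n hn]
  · rw [dif_neg hn, hc' n hn]

/-- Reversing creation and annihilation negates the commutator, hence the logarithm of the factor,
and exchanges the indices of `A`. -/
lemma IsHeisenberg.braid_cre_ann {c f : PowerSeries ℂ} (hf : IsExp c f)
    (hc : ∀ n (h : Odd n), coeff n c =
      -(b ⟨n, h⟩ * b' ⟨n, h⟩ * (qint q (A j i * n) / (2 * (n : ℂ)) * qint q n)))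
    (hc' : ∀ n, ¬ Odd n → coeff n c = 0) :
    Braid (expSeries (creSeries h b i)) (expSeries (annSeries h b' j)) f := by
  refine (hh.isExp_cre b i).braid_int (hh.isExp_ann b' j) hf fun n m _ => ?_
  rw [← neg_sub, hh.ann_cre_commutator]
  by_cases hn : n = m
  · subst hn
    rw [if_pos rfl, if_pos rfl, ← map_neg]
    congr 1
    by_cases hn : Odd n
    · rw [dif_pos hn, hc n hn, mul_comm (b' _)]
    · rw [dif_neg hn, hc' n hn, neg_zero]
  · rw [if_neg hn, if_neg (Ne.symm hn), neg_zero]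

variable (b b' i j)

lemma IsHeisenberg.commute_exp_cre (k l : ℤ) : Commute (inZ (expSeries (creSeries h b i)) k)
    (inZ (expSeries (creSeries h b' j)) l) := by
  refine Braid.commute ((hh.isExp_cre b i).braid_int (hh.isExp_cre b' j) isExp_zero
    fun n m _ => ?_) k l
  rw [(hh.commute_cre b b' i j n m).eq, sub_self]
  simp

lemma IsHeisenberg.commute_exp_ann (k l : ℤ) : Commute (inZ (expSeries (annSeries h b i)) k)
    (inZ (expSeries (annSeries h b' j)) l) := by
  refine Braid.commute ((hh.isExp_ann b i).braid_int (hh.isExp_ann b' j) isExp_zero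
    fun n m _ => ?_) k l
  rw [(hh.commute_ann b b' i j n m).eq, sub_self]
  simp

lemma IsHeisenberg.commute_exp_cre_of {g : Module.End ℂ W} (hg : ∀ i m, Commute g (h i m))
    (k : ℤ) : Commute g (inZ (expSeries (creSeries h b i)) k) := by
  refine commute_inZ ((hh.isExp_cre b i).commute_coeff fun n => ?_) k
  rw [creSeries, coeff_oddSeries]
  split_ifs
  · exact (hg i _).smul_right _
  · exact Commute.zero_right _

lemma IsHeisenberg.commute_exp_ann_of {g : Module.End ℂ W} (hg : ∀ i m, Commute g (h i m))
    (k : ℤ) : Commute g (inZ (expSeries (annSeries h b i)) k) := by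
  refine commute_inZ ((hh.isExp_ann b i).commute_coeff fun n => ?_) k
  rw [annSeries, coeff_oddSeries]
  split_ifs
  · exact (hg i _).smul_right _
  · exact Commute.zero_right _

/-- The property holds on vacuum vectors, passes to sums, and survives each creation operator with a
larger bound; vacuum vectors generate W in this sense. -/
lemma IsHeisenberg.locNil : LocNil (expSeries (annSeries h b i)) := by
  set r := annSeries h b i with hr
  have hR : IsExp r (expSeries r) := hh.isExp_ann b i
  set R := expSeries r
  refine hh.generated (fun v => ∃ N : ℤ, ∀ k, N < k → inZ R k v = 0) ?_ ?_ ?_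
  · intro v hv
    -- In degree k, the equation euler R = (euler r) R applied to v yields k R_k v = 0: for 0 < y <
    -- k the vectors R_y v vanish by induction, and for y = 0 the operator r_k kills v.
    have hvac : ∀ k : ℕ, 0 < k → coeff k R v = 0 := by
      intro k
      induction k using Nat.strong_induction_on with
      | _ k ih =>
        intro hk
        have h1 := congrArg (coeff k) hR.2
        rw [coeff_euler, coeff_mul] at h1
        have h2 := LinearMap.congr_fun h1 v
        rw [LinearMap.smul_apply, LinearMap.sum_apply, Finset.sum_eq_zero] at h2
        · have : (k : ℂ) ≠ 0 := by exact_mod_cast hk.ne'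
          exact (smul_eq_zero.mp h2).resolve_left this
        · rintro ⟨x, y⟩ hxy
          rw [Finset.HasAntidiagonal.mem_antidiagonal] at hxy
          simp only at hxy
          rw [Module.End.mul_apply, coeff_euler]
          rcases Nat.eq_zero_or_pos y with rfl | hy
          · rw [hR.1, Module.End.one_apply, hr, annSeries, coeff_oddSeries]
            split_ifs
            · simp [hv]
            · simp
          rcases Nat.eq_zero_or_pos x with rfl | hx
          · simp
          · rw [ih y (by omega) hy, map_zero]
    refine ⟨0, fun k hk => ?_⟩
    obtain ⟨k, rfl⟩ := Int.eq_ofNat_of_zero_le hk.le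
    rw [inZ_natCast, hvac k (by omega)]
  · rintro v w ⟨N, hN⟩ ⟨M, hM⟩
    exact ⟨max N M, fun k hk => by rw [map_add, hN k (by omega), hM k (by omega), add_zero]⟩
  · rintro j n v ⟨N, hN⟩
    -- The creation operator meets a single term of r, so its commutator with R is c xⁿ R, and the
    -- bound grows by n. The maximum with 0 below ensures that k and k - n are natural numbers.
    obtain ⟨c, hc⟩ : ∃ c : ℂ, C (h j (negOdd n)) * r - r * C (h j (negOdd n)) = c • X ^ n.1 := by
      refine ⟨-(b n * (qint q (A i j * n.1) / (2 * (n.1 : ℂ)) * qint q n.1)), ?_⟩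
      ext1 m
      rw [map_sub, coeff_C_mul, coeff_mul_C, coeff_smul, coeff_X_pow, hr, annSeries,
        coeff_oddSeries]
      by_cases hm : Odd m
      · rw [dif_pos hm, smul_mul_assoc, mul_smul_comm, ← smul_sub, ← neg_sub, hh.pos_neg]
        simp only [Subtype.ext_iff]
        split_ifs with hmn
        · subst hmn
          rw [neg_smul, mul_smul (b n), smul_neg]
        · simp
      · have : m ≠ n.1 := fun h => hm (h ▸ n.2)
        simp [hm, this]
    have hcomm := hR.commutator n.2.pos.ne' hc
    refine ⟨max N 0 + n.1, fun k hk => ?_⟩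
    obtain ⟨k, rfl⟩ := Int.eq_ofNat_of_zero_le (show 0 ≤ k by omega)
    have h1 := LinearMap.congr_fun (congrArg (coeff k) hcomm) v
    rw [map_sub, coeff_C_mul, coeff_mul_C, coeff_smul, coeff_X_pow_mul',
      if_pos (show n.1 ≤ k by omega)] at h1
    have h2 := hN k (by omega)
    have h3 := hN (k - n.1 : ℕ) (by omega)
    rw [inZ_natCast] at h2 h3
    rw [inZ_natCast]
    simpa [h2, h3] using h1

end Heisenberg

/-! ### Expansions at 0 and at ∞ of the contraction functions -/

section Coefficients

open PowerSeries

lemma inZ_ell (u : ℂ) (t : ℤ) :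
    inZ (ell u) t = if t < 0 then 0 else if t = 0 then 1 else 2 * u ^ t := by
  split_ifs with h h'
  · exact inZ_of_neg _ h
  · subst h'
    exact (inZ_natCast _ 0).trans (by rw [coeff_ell, if_pos rfl])
  · obtain ⟨n, rfl⟩ := Int.eq_ofNat_of_zero_le (not_lt.mp h)
    rw [inZ_natCast, coeff_ell, if_neg (by exact_mod_cast h'), zpow_natCast]

lemma inZ_ell_mul_ell {u v : ℂ} (huv : u ≠ v) (t : ℤ) :
    inZ (ell u * ell v) t =
      if t < 0 then 0 else if t = 0 then 1 else 2 * (u + v) / (u - v) * (u ^ t - v ^ t) := by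
  split_ifs with h h'
  · exact inZ_of_neg _ h
  · subst h'
    exact (inZ_natCast _ 0).trans (by rw [coeff_ell_mul_ell huv, if_pos rfl])
  · obtain ⟨n, rfl⟩ := Int.eq_ofNat_of_zero_le (not_lt.mp h)
    rw [inZ_natCast, coeff_ell_mul_ell huv, if_neg (by exact_mod_cast h'), zpow_natCast,
      zpow_natCast]

/-- The difference of the expansions of `(1 - x) / (1 + x)` at `0` and at `∞`. -/
lemma inZ_ell_neg_one_add (t : ℤ) :
    inZ (ell (-1)) t + inZ (ell (-1)) (-t) = 2 * (-1 : ℂ) ^ t := by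
  have h : (-1 : ℂ) ^ (-t) = (-1) ^ t := by rw [zpow_neg, ← inv_zpow, inv_neg_one]
  rw [inZ_ell, inZ_ell, h]
  rcases lt_trichotomy t 0 with ht | rfl | ht
  · rw [if_pos ht, if_neg (by omega), if_neg (by omega), zero_add]
  · norm_num
  · rw [if_neg (by omega), if_neg (by omega), if_pos (by omega), add_zero]

/-- The rational function is invariant under x ↦ x⁻¹ and has simple poles at u and u⁻¹; the two
expansions differ by one delta function for each pole. -/
lemma inZ_ell_mul_ell_inv_sub {u : ℂ} (hu : u ≠ u⁻¹) (t : ℤ) :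
    inZ (ell u * ell u⁻¹) t - inZ (ell u * ell u⁻¹) (-t) =
      2 * (u + u⁻¹) / (u - u⁻¹) * (u ^ t - u⁻¹ ^ t) := by
  rw [inZ_ell_mul_ell hu, inZ_ell_mul_ell hu]
  rcases lt_trichotomy t 0 with ht | rfl | ht
  · rw [if_pos ht, if_neg (by omega), if_neg (by omega), zpow_neg, inv_zpow, inv_zpow, zpow_neg]
    rw [inv_inv]
    ring
  · norm_num
  · rw [if_neg (by omega), if_neg (by omega), if_pos (by omega), sub_zero]

/-- Both sides are the coefficient of x^(t+2) in the polynomial (1 + ux)(1 + u⁻¹x), since the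
quadratic prefactors cancel the poles. Only t = -2, -1, 0 contribute, whence the case split. -/
lemma quadratic_inZ_ell {u : ℂ} (hu : u ≠ 0) (t : ℤ) :
    1 * (1 * inZ (ell u) (t + 2) + u⁻¹ * inZ (ell u) (t + 1)) +
        -u * (1 * inZ (ell u) (t + 1) + u⁻¹ * inZ (ell u) t) =
      -(u * (u⁻¹ * inZ (ell u) (-(t + 2)) + 1 * inZ (ell u) (-(t + 1))) +
        -1 * (u⁻¹ * inZ (ell u) (-(t + 1)) + 1 * inZ (ell u) (-t))) := by
  simp only [inZ_ell]
  obtain h | rfl | rfl | rfl | h : t ≤ -3 ∨ t = -2 ∨ t = -1 ∨ t = 0 ∨ 1 ≤ t := by omega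
  · rw [if_pos (by omega), if_pos (by omega), if_pos (by omega), if_neg (by omega),
      if_neg (by omega), if_neg (by omega), if_neg (by omega), if_neg (by omega),
      if_neg (by omega), neg_add t 2, neg_add t 1, zpow_add₀ hu, zpow_add₀ hu]
    rw [show (-2 : ℤ) = -1 + -1 by norm_num, zpow_add₀ hu, zpow_neg_one]
    field_simp
    ring
  · norm_num
    field_simp
    ring
  · norm_num
    field_simp
    ring
  · norm_num
    field_simp
    ring
  · rw [if_neg (by omega), if_neg (by omega), if_neg (by omega), if_neg (by omega),
      if_neg (by omega), if_neg (by omega), if_pos (by omega), if_pos (by omega),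
      if_pos (by omega), zpow_add₀ hu, zpow_add₀ hu]
    rw [show (2 : ℤ) = 1 + 1 by norm_num, zpow_add₀ hu, zpow_one]
    field_simp
    ring

/-- The prefactors leave (1 - x)(1 - Ux)(1 - U⁻¹x)/(1 + x), expanded at 0 on the left and at ∞ in
the first part of the right. The simple pole at x = -1 contributes the delta function, with constant
the numerator at -1, namely 2(1 + U)(1 + U⁻¹). -/
lemma quadratic_inZ_ell_mul_ell {U : ℂ} (hU : U ≠ 0) (hU1 : U ≠ 1) (t : ℤ) :
    1 * (1 * inZ (ell (-1) * ell (-U)) (t + 2) + U * inZ (ell (-1) * ell (-U)) (t + 1)) +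
        -U⁻¹ * (1 * inZ (ell (-1) * ell (-U)) (t + 1) + U * inZ (ell (-1) * ell (-U)) t) =
      U⁻¹ * (U * inZ (ell (-1) * ell (-U)) (-(t + 2)) +
          1 * inZ (ell (-1) * ell (-U)) (-(t + 1))) +
        -1 * (U * inZ (ell (-1) * ell (-U)) (-(t + 1)) + 1 * inZ (ell (-1) * ell (-U)) (-t)) +
      2 * (U + 2 + U⁻¹) * (-1) ^ t := by
  have hne : (-1 : ℂ) ≠ -U := fun h => hU1 (neg_injective h).symm
  have hd : (-1 : ℂ) - -U ≠ 0 := sub_ne_zero.mpr hne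
  have hd' : (-1 : ℂ) + U ≠ 0 := by simpa using hd
  have hU' : -U ≠ 0 := neg_ne_zero.mpr hU
  have h1 : (-1 : ℂ) ≠ 0 := by norm_num
  simp only [inZ_ell_mul_ell hne]
  obtain h | rfl | rfl | rfl | h : t ≤ -3 ∨ t = -2 ∨ t = -1 ∨ t = 0 ∨ 1 ≤ t := by omega
  · have hneg : (-1 : ℂ) ^ t = (-1) ^ (-t) := by rw [zpow_neg, ← inv_zpow, inv_neg_one]
    rw [if_pos (by omega), if_pos (by omega), if_pos (by omega), if_neg (by omega),
      if_neg (by omega), if_neg (by omega), if_neg (by omega), if_neg (by omega),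
      if_neg (by omega), neg_add, neg_add, zpow_add₀ h1, zpow_add₀ h1, zpow_add₀ hU',
      zpow_add₀ hU', hneg]
    rw [show (-2 : ℤ) = -1 + -1 by norm_num, zpow_add₀ hU', zpow_add₀ h1, zpow_neg_one,
      zpow_neg_one]
    generalize (-1 : ℂ) ^ (-t) = x
    generalize (-U : ℂ) ^ (-t) = y
    field_simp
    ring
  · norm_num [zpow_neg]
    field_simp
    ring
  · norm_num [zpow_neg]
    field_simp
    ring
  · norm_num
    field_simp
    ring
  · rw [if_neg (by omega), if_neg (by omega), if_neg (by omega), if_neg (by omega),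
      if_neg (by omega), if_neg (by omega), if_pos (by omega), if_pos (by omega),
      if_pos (by omega), zpow_add₀ h1, zpow_add₀ h1, zpow_add₀ hU', zpow_add₀ hU']
    rw [show (2 : ℤ) = 1 + 1 by norm_num, zpow_add₀ hU', zpow_add₀ h1, zpow_one, zpow_one]
    generalize (-1 : ℂ) ^ t = x
    generalize (-U : ℂ) ^ t = y
    field_simp
    ring

end Coefficients

/-! ### From exchange relations to conjugation by power series -/

section Conjugation

variable {B : Type*} [Ring B] [Algebra ℂ B]

open PowerSeries

lemma isUnit_of_coeff_zero {B : Type*} [Ring B] {U : PowerSeries B} (h : coeff 0 U = 1) :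
    IsUnit U :=
  ⟨⟨U, invOfUnit U 1, mul_invOfUnit U 1 (by simpa using h), invOfUnit_mul U 1 (by simpa using h)⟩,
    rfl⟩

/-- The exchange relation in coefficients becomes an equation U b = Y U of power series, from which
U b U⁻¹ = Y is immediate. -/
lemma mul_C_eq {U : PowerSeries B} {g : PowerSeries ℂ} {b : ℤ → B} {b₀ : B}
    (h : ∀ m, inZ U m * b₀ = ∑ᶠ t : ℤ, inZ g t • (b t * inZ U (m - t))) :
    U * C b₀ = (PowerSeries.mk fun k => coeff k g • b k) * U := by
  refine inZ_ext fun m => ?_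
  rw [inZ_mul, inZ_mul, finsum_eq_single _ m]
  · have : inZ (C b₀) (m - m) = b₀ := by
      rw [sub_self]
      exact (inZ_natCast _ 0).trans (by simp)
    rw [this, h]
    refine finsum_congr fun t => ?_
    rcases lt_or_ge t 0 with ht | ht
    · rw [inZ_of_neg _ ht, inZ_of_neg _ ht, zero_smul, zero_mul]
    · obtain ⟨n, rfl⟩ := Int.eq_ofNat_of_zero_le ht
      rw [inZ_natCast, inZ_natCast, coeff_mk, smul_mul_assoc]
  · intro t ht
    have : inZ (C b₀) (m - t) = 0 := by
      rcases lt_or_ge (m - t) 0 with h0 | h0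
      · exact inZ_of_neg _ h0
      · obtain ⟨n, hn⟩ := Int.eq_ofNat_of_zero_le h0
        rw [hn, inZ_natCast, coeff_C, if_neg (by omega)]
    rw [this, mul_zero]

lemma conj_eq {B : Type*} [Ring B] {U Y : PowerSeries B} (hU : IsUnit U) {b₀ : B}
    (h : U * C b₀ = Y * U) :
    U * C b₀ * Ring.inverse U = Y := by
  rw [h, mul_assoc, Ring.mul_inverse_cancel U hU, mul_one]

lemma conjZ_eq {U : PowerSeries B} (hU : IsUnit U) {g : PowerSeries ℂ} {b : FD B}
    (h : ∀ m n, inZ U m * b n = ∑ᶠ t : ℤ, inZ g t • (b (n + t) * inZ U (m - t))) :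
    conjZ U b = mulZoverW (inW b) (PowerSeries.map (algebraMap ℂ B) g) := by
  funext m n
  rw [conjZ, conj_eq hU (mul_C_eq (b := fun t => b (n + t)) fun m => h m n), mulZoverW]
  rcases lt_or_ge m 0 with hm | hm
  · rw [inZ_of_neg _ hm, finsum_eq_zero_of_forall_eq_zero]
    intro k
    rw [inW, if_neg (by omega), zero_mul]
  · obtain ⟨k, rfl⟩ := Int.eq_ofNat_of_zero_le hm
    rw [finsum_eq_single _ k fun l hl => by rw [inW, if_neg (by omega), zero_mul], inZ_natCast,
      coeff_mk, inW, if_pos (by omega), coeff_map, ← Algebra.commutes, Algebra.smul_def]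

lemma conjZInv_eq {U : PowerSeries B} (hU : IsUnit U) {g : PowerSeries ℂ} {b : FD B}
    (h : ∀ m n, inZ U m * b n = ∑ᶠ t : ℤ, inZ g t • (b (n - t) * inZ U (m - t))) :
    conjZInv U b = mulWoverZ (inW b) (PowerSeries.map (algebraMap ℂ B) g) := by
  funext m n
  rw [conjZInv, conj_eq hU (mul_C_eq (b := fun t => b (n - t)) fun m => h m n), mulWoverZ,
    inZInv_apply]
  rcases lt_or_ge (-m) 0 with hm | hm
  · rw [inZ_of_neg _ hm, finsum_eq_zero_of_forall_eq_zero]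
    intro k
    rw [inW, if_neg (by omega), zero_mul]
  · obtain ⟨k, hk⟩ := Int.eq_ofNat_of_zero_le hm
    rw [hk, finsum_eq_single _ k fun l hl => by rw [inW, if_neg (by omega), zero_mul], inZ_natCast,
      coeff_mk, inW, if_pos (by omega), coeff_map, ← Algebra.commutes, Algebra.smul_def]

lemma Braid.prodZW_eq {R P : PowerSeries B} {g : PowerSeries ℂ} (h : Braid P R g) :
    prodZW (inZ P) (inZInv R) =
      mulZoverW (prodWZ (inZInv R) (inZ P)) (PowerSeries.map (algebraMap ℂ B) g) := by
  funext m n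
  rw [prodZW, inZInv_apply, h, mulZoverW, finsum_int_eq_finsum_nat fun t ht => by
    rw [inZ_of_neg _ ht, zero_smul]]
  refine finsum_congr fun k => ?_
  rw [inZ_natCast, coeff_map, ← Algebra.commutes, Algebra.smul_def, prodWZ, inZInv_apply, neg_add,
    ← sub_eq_add_neg]

lemma commZW_eq_zero {B : Type*} [Ring B] {a b : FD B} (h : ∀ m n, Commute (a m) (b n)) :
    commZW a b = 0 := by
  funext m n
  exact sub_eq_zero.mpr (h m n)

lemma lin_smul (a b c : ℂ) (F : FD₂ B) : lin a b (c • F) = c • lin a b F := by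
  funext m n
  simp only [lin, Pi.smul_apply, smul_add, smul_comm c]

end Conjugation

/-! ### Vertex operators over an abstract Heisenberg module and their contractions -/

section VertexOperators

variable {ι W : Type*} [AddCommGroup W] [Module ℂ W]

open PowerSeries

lemma AntidiagFinite.mul_right {F : FD₂ (Module.End ℂ W)} (hF : AntidiagFinite F)
    (g : Module.End ℂ W) : AntidiagFinite fun m n => F m n * g := fun p v => hF p (g v)

lemma conv_mul_right {F : FD₂ (Module.End ℂ W)} (hF : AntidiagFinite F) (c : ℤ → ℂ)
    (g : Module.End ℂ W) (m n : ℤ) :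
    conv c (fun m n => F m n * g) m n = conv c F m n * g := by
  ext v
  rw [(hF.mul_right g).conv_apply, Module.End.mul_apply, hF.conv_apply]
  rfl

lemma diag_mul_right {F : FD₂ (Module.End ℂ W)} (hF : AntidiagFinite F) (t u : ℂ)
    (g : Module.End ℂ W) (p : ℤ) :
    diag t u (fun m n => F m n * g) p = diag t u F p * g := by
  ext v
  rw [(hF.mul_right g).diag_apply, Module.End.mul_apply, hF.diag_apply]
  rfl

lemma vert_commute {P R : PowerSeries (Module.End ℂ W)} (hR : LocNil R) {g : Module.End ℂ W}
    (hP : ∀ k, Commute g (inZ P k)) (hgR : ∀ k, Commute g (inZ R k)) (m : ℤ) :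
    Commute g (vert P R m) := by
  refine LinearMap.ext fun v => ?_
  rw [Module.End.mul_apply, Module.End.mul_apply, vert_apply hR, vert_apply hR,
    map_finsum _ (vert_finite' hR m v)]
  refine finsum_congr fun k => ?_
  rw [← Module.End.mul_apply, (hP k).eq, Module.End.mul_apply, ← Module.End.mul_apply g,
    (hgR _).eq, Module.End.mul_apply]

lemma vert_one_left {R : PowerSeries (Module.End ℂ W)} (hR : LocNil R) :
    vert 1 R = inZInv R := by
  funext m
  ext v
  rw [vert_apply hR, finsum_eq_single _ 0 fun k hk => by rw [inZ_one, if_neg hk]; rfl, inZ_one,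
    if_pos rfl, zero_sub]
  rfl

lemma vert_one_right {P : PowerSeries (Module.End ℂ W)}
    (h1 : LocNil (1 : PowerSeries (Module.End ℂ W))) :
    vert P 1 = inZ P := by
  funext m
  ext v
  rw [vert_apply h1, finsum_eq_single _ m fun k hk => by
    rw [inZ_one, if_neg (sub_ne_zero.mpr hk), LinearMap.zero_apply, map_zero], inZ_one,
    if_pos (sub_self m)]
  rfl

/-- The coefficients of `E_-^ε`. -/
def coeffMinus (q s : ℂ) (ε : ℤˣ) (n : {n : ℕ // Odd n}) : ℂ :=
  ((ε : ℤ) : ℂ) * (2 * s ^ (-(ε : ℤ) * (n.1 : ℤ)) / qint q n.1)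

/-- The coefficients of `E_+^ε`. -/
def coeffPlus (q s : ℂ) (ε : ℤˣ) (n : {n : ℕ // Odd n}) : ℂ :=
  -((ε : ℤ) : ℂ) * (2 * s ^ (-(ε : ℤ) * (n.1 : ℤ)) / qint q n.1)

/-- The series `E_-^ε(α_i, z)` for an abstract Heisenberg module. -/
def expMinus (q s : ℂ) (h : ι → {m : ℤ // Odd m} → Module.End ℂ W) (ε : ℤˣ) (i : ι) :
    PowerSeries (Module.End ℂ W) := expSeries (creSeries h (coeffMinus q s ε) i)

/-- The series `E_+^ε(α_i, z)` for an abstract Heisenberg module. -/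
def expPlus (q s : ℂ) (h : ι → {m : ℤ // Odd m} → Module.End ℂ W) (ε : ℤˣ) (i : ι) :
    PowerSeries (Module.End ℂ W) := expSeries (annSeries h (coeffPlus q s ε) i)

/-- The vertex operator `X_i^ε(z)` for an abstract Heisenberg module with operators `τ ε i`. -/
def vertexOp (q s : ℂ) (h : ι → {m : ℤ // Odd m} → Module.End ℂ W)
    (τ : ℤˣ → ι → Module.End ℂ W) (ε : ℤˣ) (i : ι) : FD (Module.End ℂ W) :=
  fun m => vert (expMinus q s h ε i) (expPlus q s h ε i) m * τ ε i

/-- The normal ordered product `:X_i^ε(z) X_j^ε'(w):` for an abstract Heisenberg module. -/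
def normalOp (q s : ℂ) (h : ι → {m : ℤ // Odd m} → Module.End ℂ W)
    (τ : ℤˣ → ι → Module.End ℂ W) (ε : ℤˣ) (i : ι) (ε' : ℤˣ) (j : ι) : FD₂ (Module.End ℂ W) :=
  fun m n => nord (expMinus q s h ε i) (expPlus q s h ε i) (expMinus q s h ε' j)
    (expPlus q s h ε' j) m n * (τ ε i * τ ε' j)

/-- The series `Φ_i(z)` for an abstract Heisenberg module. -/
def phiOp (q : ℂ) (h : ι → {m : ℤ // Odd m} → Module.End ℂ W) (i : ι) :
    PowerSeries (Module.End ℂ W) := expSeries (creSeries h (fun _ => 2 * (q⁻¹ - q)) i)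

/-- The series `Ψ_i(z)` for an abstract Heisenberg module. -/
def psiOp (q : ℂ) (h : ι → {m : ℤ // Odd m} → Module.End ℂ W) (i : ι) :
    PowerSeries (Module.End ℂ W) := expSeries (annSeries h (fun _ => 2 * (q - q⁻¹)) i)

/-- The data of the construction: a generic `q = s ^ 2`, a Heisenberg module, and operators `τ ε i`
that commute with it and satisfy the relations of the twisted group algebra. -/
structure VertexData (q s : ℂ) (A : Matrix ι ι ℤ)
    (h : ι → {m : ℤ // Odd m} → Module.End ℂ W) (τ : ℤˣ → ι → Module.End ℂ W) : Prop where
  symm : A.IsSymm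
  ne_zero : q ≠ 0
  generic : ∀ n : ℕ, 0 < n → q ^ n ≠ 1
  sq : s ^ 2 = q
  heisenberg : IsHeisenberg q A h
  commute : ∀ ε i j m, Commute (τ ε i) (h j m)
  sign : ∀ ε i ε' j, τ ε i * τ ε' j = (-1 : ℂ) ^ (A i j) • (τ ε' j * τ ε i)
  mul_inv_one : ∀ i, τ 1 i * τ (-1) i = 1

variable {q s : ℂ} {A : Matrix ι ι ℤ} {h : ι → {m : ℤ // Odd m} → Module.End ℂ W}
  {τ : ℤˣ → ι → Module.End ℂ W} (d : VertexData q s A h τ)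

namespace VertexData

include d

lemma s_ne_zero : s ≠ 0 := by
  rintro rfl
  exact d.ne_zero (by rw [← d.sq]; norm_num)

lemma locNil (ε : ℤˣ) (i : ι) : LocNil (expPlus q s h ε i) := d.heisenberg.locNil _ _

lemma normal_antidiagFinite (ε : ℤˣ) (i : ι) (ε' : ℤˣ) (j : ι) :
    AntidiagFinite (normalOp q s h τ ε i ε' j) :=
  (nord_antidiagFinite (d.locNil ε i) (d.locNil ε' j)).mul_right _

lemma commute_vert (ε : ℤˣ) (i : ι) (ε' : ℤˣ) (j : ι) (m : ℤ) :
    Commute (τ ε i) (vert (expMinus q s h ε' j) (expPlus q s h ε' j) m) :=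
  vert_commute (d.locNil ε' j) (d.heisenberg.commute_exp_cre_of _ _ (d.commute ε i))
    (d.heisenberg.commute_exp_ann_of _ _ (d.commute ε i)) m

lemma vertex_mul_vertex {ε ε' : ℤˣ} {i j : ι} {f : PowerSeries ℂ}
    (hf : Braid (expPlus q s h ε i) (expMinus q s h ε' j) f) :
    prodZW (vertexOp q s h τ ε i) (vertexOp q s h τ ε' j) =
      conv (inZ f) (normalOp q s h τ ε i ε' j) := by
  funext m n
  unfold normalOp
  rw [conv_mul_right (nord_antidiagFinite (d.locNil ε i) (d.locNil ε' j)),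
    ← vert_mul_vert (d.locNil ε i) (d.locNil ε' j) hf, prodZW, vertexOp, vertexOp,
    mul_assoc, ← mul_assoc (τ ε i), (d.commute_vert ε i ε' j n).eq]
  simp only [mul_assoc]

lemma normal_swap (ε ε' : ℤˣ) (i j : ι) (m n : ℤ) :
    normalOp q s h τ ε' j ε i n m =
      (-1 : ℂ) ^ (A i j) • normalOp q s h τ ε i ε' j m n := by
  have hP : ∀ k l, Commute (inZ (expMinus q s h ε i) k) (inZ (expMinus q s h ε' j) l) :=
    d.heisenberg.commute_exp_cre _ _ _ _
  have hR : ∀ k l, Commute (inZ (expPlus q s h ε i) k) (inZ (expPlus q s h ε' j) l) :=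
    d.heisenberg.commute_exp_ann _ _ _ _
  rw [normalOp, nord_swap (d.locNil ε i) (d.locNil ε' j) hP hR, d.sign ε' j, d.symm.apply i j,
    mul_smul_comm]
  rfl

/-- Normal ordering hides the order of the factors except for the group sign, so the reversed
product is the same normal ordered series with x replaced by x⁻¹. Commutators thereby become
differences of scalar series. -/
lemma vertex_mul_vertex_swap {ε ε' : ℤˣ} {i j : ι} {f : PowerSeries ℂ}
    (hf : Braid (expPlus q s h ε' j) (expMinus q s h ε i) f) :
    prodWZ (vertexOp q s h τ ε' j) (vertexOp q s h τ ε i) =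
      (-1 : ℂ) ^ (A i j) • conv (fun t => inZ f (-t)) (normalOp q s h τ ε i ε' j) := by
  funext m n
  have h1 := congrFun (congrFun (d.vertex_mul_vertex hf) n) m
  rw [prodZW] at h1
  rw [prodWZ, h1, ← (d.normal_antidiagFinite ε i ε' j).conv_smul]
  ext v
  rw [(d.normal_antidiagFinite ε' j ε i).conv_apply,
    (d.normal_antidiagFinite ε i ε' j).conv_apply, ← finsum_comp_equiv (Equiv.neg ℤ)]
  refine finsum_congr fun t => ?_
  rw [Equiv.neg_apply, d.normal_swap, LinearMap.smul_apply, sub_neg_eq_add, smul_smul,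
    ← sub_eq_add_neg, Pi.smul_apply, smul_eq_mul, mul_comm (inZ f (-t))]

lemma q_sub_inv_ne_zero : q - q⁻¹ ≠ 0 := by
  intro h0
  refine d.generic 2 two_pos ?_
  have := d.ne_zero
  field_simp at h0
  linear_combination h0

lemma qint_ne_zero {n : ℕ} (hn : 0 < n) : qint q n ≠ 0 := by
  rw [qint, zpow_neg, zpow_natCast]
  refine div_ne_zero (fun h0 => d.generic (2 * n) (by omega) ?_) d.q_sub_inv_ne_zero
  have := pow_ne_zero n d.ne_zero
  rw [sub_eq_zero] at h0
  rw [two_mul, pow_add]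
  nth_rewrite 1 [h0]
  exact inv_mul_cancel₀ this

lemma s_zpow_two (ε : ℤˣ) : s ^ (2 * (ε : ℤ)) = q ^ (ε : ℤ) := by
  rw [← d.sq, ← zpow_natCast, ← zpow_mul]
  rfl

end VertexData

section Scalars

lemma sign_pow (ε : ℤˣ) {n : ℕ} (hn : Odd n) : (((ε : ℤ) : ℂ)) ^ n = ((ε : ℤ) : ℂ) := by
  rcases Int.units_eq_one_or ε with rfl | rfl
  · simp
  · simp [hn.neg_one_pow]

lemma coeff_logEll_odd (u : ℂ) {n : ℕ} (hn : Odd n) : coeff n (logEll u) = 2 * u ^ n / n := by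
  rw [logEll, coeff_oddSeries, dif_pos hn]

lemma coeff_logEll_not_odd (u : ℂ) {n : ℕ} (hn : ¬ Odd n) : coeff n (logEll u) = 0 := by
  rw [logEll, coeff_oddSeries, dif_neg hn]

lemma zpow_pow_eq (x : ℂ) (k : ℤ) (n : ℕ) : (x ^ k) ^ n = x ^ (k * (n : ℤ)) := by
  rw [← zpow_natCast, ← zpow_mul]

end Scalars

namespace VertexData

include d

/-- Since n is odd the signs survive the power, so they can be absorbed into the base u of `ell u`.
-/
lemma contraction_pow {ε ε' : ℤˣ} {n : ℕ} (hn : Odd n) :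
    (((ε : ℤ) : ℂ) * ((ε' : ℤ) : ℂ) * s ^ (-((ε : ℤ) + (ε' : ℤ)))) ^ n =
      ((ε : ℤ) : ℂ) * ((ε' : ℤ) : ℂ) * (s ^ (-(ε : ℤ) * (n : ℤ)) * s ^ (-(ε' : ℤ) * (n : ℤ))) := by
  rw [mul_pow, mul_pow, sign_pow ε hn, sign_pow ε' hn, zpow_pow_eq, ← zpow_add₀ d.s_ne_zero]
  congr 2
  ring

lemma braid_of_eq_zero {ε ε' : ℤˣ} {i j : ι} (hij : A i j = 0) :
    Braid (expPlus q s h ε i) (expMinus q s h ε' j) 1 := by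
  refine d.heisenberg.braid_ann_cre isExp_zero (fun n hn => ?_) fun n hn => by simp
  rw [hij]
  simp [qint]

/-- The contraction exponent is -2εε' s^(-(ε+ε')n) [A_ij n]/(n [n]); for A_ij = -1 the quotient of
q-integers is -1, and one factor `ell` remains. -/
lemma braid_of_eq_neg_one {ε ε' : ℤˣ} {i j : ι} (hij : A i j = -1) :
    Braid (expPlus q s h ε i) (expMinus q s h ε' j)
      (ell (((ε : ℤ) : ℂ) * ((ε' : ℤ) : ℂ) * s ^ (-((ε : ℤ) + (ε' : ℤ))))) := by
  refine d.heisenberg.braid_ann_cre (isExp_ell _) (fun n hn => ?_) fun n hn =>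
    coeff_logEll_not_odd _ hn
  have h1 := d.qint_ne_zero hn.pos
  have h2 : (n : ℂ) ≠ 0 := by exact_mod_cast hn.pos.ne'
  rw [hij, coeff_logEll_odd _ hn, d.contraction_pow hn, coeffPlus, coeffMinus, neg_one_mul,
    qint_neg]
  field_simp

lemma qint_two_mul (n : ℤ) : qint q (2 * n) = qint q n * (q ^ n + (q ^ n)⁻¹) := by
  have h1 := zpow_ne_zero n d.ne_zero
  rw [qint, qint, zpow_neg, zpow_neg, two_mul, zpow_add₀ d.ne_zero]
  have h2 := d.q_sub_inv_ne_zero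
  rw [div_mul_eq_mul_div, mul_inv]
  ring

/-- Here [2n]/[n] = qⁿ + q⁻ⁿ splits the exponent into two terms, one `ell` for each; the overall
minus sign moves into the base by oddness. -/
lemma braid_of_eq_two {ε ε' : ℤˣ} {i j : ι} (hij : A i j = 2) :
    Braid (expPlus q s h ε i) (expMinus q s h ε' j)
      (ell (-(((ε : ℤ) : ℂ) * ((ε' : ℤ) : ℂ) * s ^ (-((ε : ℤ) + (ε' : ℤ)))) * q) *
        ell (-(((ε : ℤ) : ℂ) * ((ε' : ℤ) : ℂ) * s ^ (-((ε : ℤ) + (ε' : ℤ)))) * q⁻¹)) := by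
  refine d.heisenberg.braid_ann_cre ((isExp_ell _).mul (isExp_ell _) (Commute.all _ _))
    (fun n hn => ?_) fun n hn => by
      rw [map_add, coeff_logEll_not_odd _ hn, coeff_logEll_not_odd _ hn, add_zero]
  have h1 := d.qint_ne_zero hn.pos
  have h2 : (n : ℂ) ≠ 0 := by exact_mod_cast hn.pos.ne'
  rw [hij, map_add, coeff_logEll_odd _ hn, coeff_logEll_odd _ hn, mul_pow _ q, mul_pow _ q⁻¹,
    hn.neg_pow, d.contraction_pow hn, coeffPlus, coeffMinus, d.qint_two_mul, zpow_natCast, inv_pow]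
  have h3 := pow_ne_zero n d.ne_zero
  field_simp
  ring

/-- With a = A_ij, the exponent is 2(q^(an) - q^(-an))(qⁿ - q⁻ⁿ)/n; its four terms are the
logarithms of the four factors `ell`. -/
lemma braid_phi_psi (i j : ι) : Braid (phiOp q h i) (psiOp q h j)
    (rescale q⁻¹ (G q (A i j)) * (rescale q (G q (A i j)))⁻¹) := by
  have hG : rescale q⁻¹ (G q (A i j)) * (rescale q (G q (A i j)))⁻¹ =
      ell (q⁻¹ * q ^ (-A i j)) * ell (q⁻¹ * -q ^ A i j) *
        (ell (-(q * -q ^ A i j)) * ell (-(q * q ^ (-A i j)))) := by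
    rw [G_eq d.ne_zero, map_mul, map_mul, PowerSeries.mul_inv_rev]
    simp only [rescale_ell, inv_ell]
  rw [hG]
  refine d.heisenberg.braid_cre_ann (((isExp_ell _).mul (isExp_ell _) (Commute.all _ _)).mul
    ((isExp_ell _).mul (isExp_ell _) (Commute.all _ _)) (Commute.all _ _))
    (fun n hn => ?_) fun n hn => by simp only [map_add, coeff_logEll_not_odd _ hn, add_zero]
  have h2 : (n : ℂ) ≠ 0 := by exact_mod_cast hn.pos.ne'
  have h3 := d.q_sub_inv_ne_zero
  have h4 := pow_ne_zero n d.ne_zero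
  have h5 := zpow_ne_zero (A i j * n) d.ne_zero
  have h6 : q⁻¹ - q ≠ 0 := by rwa [← neg_sub, neg_ne_zero]
  simp only [map_add, coeff_logEll_odd _ hn, mul_pow, hn.neg_pow, zpow_pow_eq, inv_pow,
    zpow_neg, d.symm.apply i j, qint, zpow_natCast]
  rw [show 2 * (q⁻¹ - q) = -(2 * (q - q⁻¹)) by ring]
  -- Keeping q - q⁻¹ atomic lets the denominators of the q-integers cancel before q⁻¹ is cleared.
  generalize q - q⁻¹ = D at *
  field_simp
  ring

lemma rescale_Gpow (ε ε' : ℤˣ) (a : ℤ) : rescale (s ^ (-(ε : ℤ))) (Gpow q a ε') =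
    ell (s ^ (-(ε : ℤ)) * (((ε' : ℤ) : ℂ) * q ^ (-a))) *
      ell (s ^ (-(ε : ℤ)) * (-((ε' : ℤ) : ℂ) * q ^ a)) := by
  rw [Gpow_eq d.ne_zero, map_mul, rescale_ell, rescale_ell]

lemma braid_phi_vertex (i j : ι) (ε : ℤˣ) : Braid (phiOp q h i) (expPlus q s h ε j)
    (rescale (s ^ (-(ε : ℤ))) (Gpow q (A i j) ε)) := by
  rw [d.rescale_Gpow]
  refine d.heisenberg.braid_cre_ann ((isExp_ell _).mul (isExp_ell _) (Commute.all _ _))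
    (fun n hn => ?_) fun n hn => by simp only [map_add, coeff_logEll_not_odd _ hn, add_zero]
  have h1 := d.qint_ne_zero hn.pos
  have h2 : (n : ℂ) ≠ 0 := by exact_mod_cast hn.pos.ne'
  have h3 := d.q_sub_inv_ne_zero
  have h5 := zpow_ne_zero (A i j * n) d.ne_zero
  simp only [map_add, coeff_logEll_odd _ hn, mul_pow, hn.neg_pow, zpow_pow_eq, sign_pow ε hn,
    neg_mul, d.symm.apply i j, coeffPlus]
  rw [show qint q (A i j * n) = (q ^ (A i j * n) - q ^ (-(A i j * n))) / (q - q⁻¹) from rfl,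
    show 2 * (q⁻¹ - q) = -(2 * (q - q⁻¹)) by ring]
  generalize q - q⁻¹ = D at *
  field_simp
  ring

lemma braid_psi_vertex (i j : ι) (ε : ℤˣ) : Braid (psiOp q h i) (expMinus q s h ε j)
    (rescale (s ^ (-(ε : ℤ))) (Gpow q (A i j) (-ε))) := by
  rw [d.rescale_Gpow]
  refine d.heisenberg.braid_ann_cre ((isExp_ell _).mul (isExp_ell _) (Commute.all _ _))
    (fun n hn => ?_) fun n hn => by simp only [map_add, coeff_logEll_not_odd _ hn, add_zero]
  have h1 := d.qint_ne_zero hn.pos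
  have h2 : (n : ℂ) ≠ 0 := by exact_mod_cast hn.pos.ne'
  have h3 := d.q_sub_inv_ne_zero
  have h5 := zpow_ne_zero (A i j * n) d.ne_zero
  simp only [map_add, coeff_logEll_odd _ hn, mul_pow, hn.neg_pow, zpow_pow_eq, sign_pow ε hn,
    neg_mul, coeffMinus, Units.val_neg, Int.cast_neg]
  rw [show qint q (A i j * n) = (q ^ (A i j * n) - q ^ (-(A i j * n))) / (q - q⁻¹) from rfl]
  generalize q - q⁻¹ = D at *
  field_simp
  ring

end VertexData

end VertexOperators

/-! ### Specialized normal ordered products and the relations between the series -/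

section Relations

variable {ι W : Type*} [AddCommGroup W] [Module ℂ W] {q s : ℂ} {A : Matrix ι ι ℤ}
  {h : ι → {m : ℤ // Odd m} → Module.End ℂ W} {τ : ℤˣ → ι → Module.End ℂ W}

open PowerSeries

namespace VertexData

variable (d : VertexData q s A h τ)

include d

lemma expSeries_cre_zero (i : ι) : expSeries (creSeries h 0 i) = 1 := by
  have h0 : creSeries h 0 i = 0 := by
    ext1 n
    rw [creSeries, coeff_oddSeries]
    simp
  have h1 := d.heisenberg.isExp_cre 0 i
  rw [h0] at h1 ⊢
  exact h1.unique isExp_zero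

lemma expSeries_ann_zero (i : ι) : expSeries (annSeries h 0 i) = 1 := by
  have h0 : annSeries h 0 i = 0 := by
    ext1 n
    rw [annSeries, coeff_oddSeries]
    simp
  have h1 := d.heisenberg.isExp_ann 0 i
  rw [h0] at h1 ⊢
  exact h1.unique isExp_zero

lemma expSeries_cre_scale (b : {n : ℕ // Odd n} → ℂ) (t : ℂ) (i : ι) :
    expSeries (creSeries h (fun n => t ^ n.1 * b n) i) =
      scalePS t (expSeries (creSeries h b i)) := by
  refine (d.heisenberg.isExp_cre _ i).unique ?_
  convert (d.heisenberg.isExp_cre b i).scalePS t using 1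
  ext1 n
  rw [coeff_scalePS, creSeries, creSeries, coeff_oddSeries, coeff_oddSeries]
  split_ifs
  · rw [smul_smul]
  · rw [smul_zero]

lemma expSeries_ann_scale (b : {n : ℕ // Odd n} → ℂ) (t : ℂ) (i : ι) :
    expSeries (annSeries h (fun n => t ^ n.1 * b n) i) =
      scalePS t (expSeries (annSeries h b i)) := by
  refine (d.heisenberg.isExp_ann _ i).unique ?_
  convert (d.heisenberg.isExp_ann b i).scalePS t using 1
  ext1 n
  rw [coeff_scalePS, annSeries, annSeries, coeff_oddSeries, coeff_oddSeries]
  split_ifs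
  · rw [smul_smul]
  · rw [smul_zero]

/-- For one index i, the specialized product is again a vertex operator, with exponents added. Which
of Φ, Ψ or 1 it is depends only on the sequences b and c. -/
lemma diag_normal {t u : ℂ} (ht : t ≠ 0) (hu : u ≠ 0) (ε ε' : ℤˣ) (i : ι)
    {b c : {n : ℕ // Odd n} → ℂ}
    (hb : ∀ n, b n = t ^ n.1 * coeffMinus q s ε n + u ^ n.1 * coeffMinus q s ε' n)
    (hc : ∀ n, c n = t⁻¹ ^ n.1 * coeffPlus q s ε n + u⁻¹ ^ n.1 * coeffPlus q s ε' n) :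
    LocNil (expSeries (annSeries h c i)) ∧ ∀ p, diag t u (normalOp q s h τ ε i ε' i) p =
      vert (expSeries (creSeries h b i)) (expSeries (annSeries h c i)) p * (τ ε i * τ ε' i) := by
  have h1 := diag_nord (A := expSeries (creSeries h b i)) (S := expSeries (annSeries h c i))
    (P := expMinus q s h ε i) (P' := expMinus q s h ε' i) ht hu (d.locNil ε i) (d.locNil ε' i) ?_ ?_
  · refine ⟨h1.1, fun p => ?_⟩
    rw [← h1.2, ← diag_mul_right (nord_antidiagFinite (d.locNil ε i) (d.locNil ε' i))]
    rfl
  · refine (d.heisenberg.isExp_cre _ i).inZ_scaled_mul (d.heisenberg.isExp_cre _ i)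
      (d.heisenberg.isExp_cre b i) t u ?_ (d.heisenberg.commute_cre _ _ _ _)
    ext1 n
    rw [map_add, coeff_scalePS, coeff_scalePS, creSeries, creSeries, creSeries, coeff_oddSeries,
      coeff_oddSeries, coeff_oddSeries]
    split_ifs
    · rw [hb, add_smul, smul_smul, smul_smul]
    · simp
  · refine (d.heisenberg.isExp_ann _ i).inZ_scaled_mul (d.heisenberg.isExp_ann _ i)
      (d.heisenberg.isExp_ann c i) t⁻¹ u⁻¹ ?_ (d.heisenberg.commute_ann _ _ _ _)
    ext1 n
    rw [map_add, coeff_scalePS, coeff_scalePS, annSeries, annSeries, annSeries, coeff_oddSeries,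
      coeff_oddSeries, coeff_oddSeries]
    split_ifs
    · rw [hc, add_smul, smul_smul, smul_smul]
    · simp

lemma diag_eq_phi {t u w : ℂ} (ht : t ≠ 0) (hu : u ≠ 0) (i : ι)
    (hb : ∀ n : {n : ℕ // Odd n}, w ^ n.1 * (2 * (q⁻¹ - q)) =
      t ^ n.1 * coeffMinus q s 1 n + u ^ n.1 * coeffMinus q s (-1) n)
    (hc : ∀ n : {n : ℕ // Odd n},
      0 = t⁻¹ ^ n.1 * coeffPlus q s 1 n + u⁻¹ ^ n.1 * coeffPlus q s (-1) n) :
    diag t u (normalOp q s h τ 1 i (-1) i) = scale (fun k => w ^ k) (inZ (phiOp q h i)) := by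
  obtain ⟨h1, h2⟩ := d.diag_normal (h := h) ht hu 1 (-1) i hb (c := 0) hc
  funext p
  rw [h2, d.mul_inv_one, mul_one]
  rw [d.expSeries_ann_zero] at h1 ⊢
  rw [vert_one_right h1, d.expSeries_cre_scale, inZ_scalePS]
  rfl

lemma diag_eq_psi {t u w : ℂ} (ht : t ≠ 0) (hu : u ≠ 0) (i : ι)
    (hb : ∀ n : {n : ℕ // Odd n},
      0 = t ^ n.1 * coeffMinus q s 1 n + u ^ n.1 * coeffMinus q s (-1) n)
    (hc : ∀ n : {n : ℕ // Odd n}, w⁻¹ ^ n.1 * (2 * (q - q⁻¹)) =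
      t⁻¹ ^ n.1 * coeffPlus q s 1 n + u⁻¹ ^ n.1 * coeffPlus q s (-1) n) :
    diag t u (normalOp q s h τ 1 i (-1) i) = scale (fun k => w ^ k) (inZInv (psiOp q h i)) := by
  obtain ⟨h1, h2⟩ := d.diag_normal (h := h) ht hu 1 (-1) i (b := 0) hb hc
  funext p
  rw [h2, d.mul_inv_one, mul_one, d.expSeries_cre_zero, vert_one_left h1, d.expSeries_ann_scale,
    inZInv_apply, inZ_scalePS, zpow_neg, inv_zpow, inv_inv]
  rfl

/-- At w = -z the odd modes of two equal vertex operators cancel completely, leaving only the group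
element. -/
lemma diag_eq_mono (ε : ℤˣ) (i : ι) :
    diag 1 (-1) (normalOp q s h τ ε i ε i) = mono 0 (τ ε i * τ ε i) := by
  have hb : ∀ n : {n : ℕ // Odd n}, (0 : ℂ) =
      1 ^ n.1 * coeffMinus q s ε n + (-1) ^ n.1 * coeffMinus q s ε n := fun n => by
    rw [n.2.neg_one_pow]; ring
  have hc : ∀ n : {n : ℕ // Odd n}, (0 : ℂ) =
      1⁻¹ ^ n.1 * coeffPlus q s ε n + (-1)⁻¹ ^ n.1 * coeffPlus q s ε n := fun n => by
    rw [inv_neg_one, inv_one, n.2.neg_one_pow]; ring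
  obtain ⟨h1, h2⟩ := d.diag_normal (h := h) one_ne_zero (neg_ne_zero.mpr one_ne_zero) ε ε i
    (b := 0) (c := 0) hb hc
  funext p
  rw [h2]
  rw [d.expSeries_ann_zero] at h1 ⊢
  rw [d.expSeries_cre_zero, vert_one_right h1, inZ_one, mono]
  split_ifs
  · rw [one_mul]
  · rw [zero_mul]

lemma qint_eq (n : ℕ) : qint q n = ((s ^ n) ^ 2 - ((s ^ n) ^ 2)⁻¹) / (q - q⁻¹) := by
  rw [qint, zpow_neg, zpow_natCast, ← d.sq, ← pow_mul, ← pow_mul, mul_comm 2 n]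

lemma q_pow (n : ℕ) : q ^ n = (s ^ n) ^ 2 := by
  rw [← d.sq, ← pow_mul, ← pow_mul, mul_comm 2 n]

/-- The four specializations of `:X_i^+(t z) X_i^-(u z):` follow from identities in `s ^ n`. -/
lemma coeff_eq (n : {n : ℕ // Odd n}) : s ^ n.1 ≠ 0 ∧ q - q⁻¹ ≠ 0 ∧
    (s ^ n.1) ^ 2 - ((s ^ n.1) ^ 2)⁻¹ ≠ 0 ∧
    coeffMinus q s 1 n = 2 * (s ^ n.1)⁻¹ * (q - q⁻¹) / ((s ^ n.1) ^ 2 - ((s ^ n.1) ^ 2)⁻¹) ∧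
    coeffMinus q s (-1) n = -(2 * s ^ n.1 * (q - q⁻¹)) / ((s ^ n.1) ^ 2 - ((s ^ n.1) ^ 2)⁻¹) ∧
    coeffPlus q s 1 n = -(2 * (s ^ n.1)⁻¹ * (q - q⁻¹)) / ((s ^ n.1) ^ 2 - ((s ^ n.1) ^ 2)⁻¹) ∧
    coeffPlus q s (-1) n = 2 * s ^ n.1 * (q - q⁻¹) / ((s ^ n.1) ^ 2 - ((s ^ n.1) ^ 2)⁻¹) := by
  have h0 := d.qint_ne_zero n.2.pos
  have h1 := d.q_sub_inv_ne_zero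
  have h2 := pow_ne_zero n.1 d.s_ne_zero
  rw [d.qint_eq] at h0
  have h3 : (s ^ n.1) ^ 2 - ((s ^ n.1) ^ 2)⁻¹ ≠ 0 := fun h => h0 (by rw [h, zero_div])
  refine ⟨h2, h1, h3, ?_, ?_, ?_, ?_⟩ <;>
  · simp only [coeffMinus, coeffPlus, d.qint_eq, Units.val_one, Units.val_neg, Int.cast_one,
      Int.cast_neg, neg_neg, one_mul, neg_mul, zpow_neg, zpow_natCast]
    generalize (s ^ n.1) ^ 2 - ((s ^ n.1) ^ 2)⁻¹ = N at *
    generalize q - q⁻¹ = D at *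
    field_simp

lemma phi_eq_diag (i : ι) : scale (fun k => s ^ (-k)) (inZ (phiOp q h i)) =
    diag q⁻¹ 1 (normalOp q s h τ 1 i (-1) i) := by
  have hD : q⁻¹ - q = -(q - q⁻¹) := by ring
  have hw : (fun k : ℤ => s ^ (-k)) = fun k => s⁻¹ ^ k := by
    funext k; rw [inv_zpow, zpow_neg]
  rw [hw, d.diag_eq_phi (w := s⁻¹) (inv_ne_zero d.ne_zero) one_ne_zero i]
  all_goals
    intro n
    obtain ⟨h1, -, h3, h4, h5, h6, h7⟩ := d.coeff_eq n
    simp only [h4, h5, h6, h7, hD, inv_pow, inv_inv, d.q_pow, one_pow, inv_one]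
    rw [mul_div_assoc', mul_div_assoc', ← add_div, eq_div_iff h3]
    generalize q - q⁻¹ = D
    field_simp
    try ring

lemma psi_eq_diag (i : ι) : scale (fun k => s ^ k) (inZInv (psiOp q h i)) =
    diag q 1 (normalOp q s h τ 1 i (-1) i) := by
  have hD : q⁻¹ - q = -(q - q⁻¹) := by ring
  rw [d.diag_eq_psi (w := s) d.ne_zero one_ne_zero i]
  all_goals
    intro n
    obtain ⟨h1, -, h3, h4, h5, h6, h7⟩ := d.coeff_eq n
    simp only [h4, h5, h6, h7, inv_pow, d.q_pow, one_pow, inv_one]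
    rw [mul_div_assoc', mul_div_assoc', ← add_div, eq_div_iff h3]
    generalize q - q⁻¹ = D
    field_simp
    try ring

lemma diag_one_inv (i : ι) : diag 1 q⁻¹ (normalOp q s h τ 1 i (-1) i) =
    scale (fun k => s ^ (-k)) (inZInv (psiOp q h i)) := by
  have hD : q⁻¹ - q = -(q - q⁻¹) := by ring
  have hw : (fun k : ℤ => s ^ (-k)) = fun k => s⁻¹ ^ k := by
    funext k; rw [inv_zpow, zpow_neg]
  rw [hw, d.diag_eq_psi (w := s⁻¹) one_ne_zero (inv_ne_zero d.ne_zero) i]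
  all_goals
    intro n
    obtain ⟨h1, -, h3, h4, h5, h6, h7⟩ := d.coeff_eq n
    simp only [h4, h5, h6, h7, inv_pow, inv_inv, d.q_pow, one_pow, inv_one]
    rw [mul_div_assoc', mul_div_assoc', ← add_div, eq_div_iff h3]
    generalize q - q⁻¹ = D
    field_simp
    try ring

lemma diag_one_self (i : ι) : diag 1 q (normalOp q s h τ 1 i (-1) i) =
    scale (fun k => s ^ k) (inZ (phiOp q h i)) := by
  have hD : q⁻¹ - q = -(q - q⁻¹) := by ring
  rw [d.diag_eq_phi (w := s) one_ne_zero d.ne_zero i]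
  all_goals
    intro n
    obtain ⟨h1, -, h3, h4, h5, h6, h7⟩ := d.coeff_eq n
    simp only [h4, h5, h6, h7, hD, inv_pow, d.q_pow, one_pow, inv_one]
    rw [mul_div_assoc', mul_div_assoc', ← add_div, eq_div_iff h3]
    generalize q - q⁻¹ = D
    field_simp
    try ring

lemma isUnit_phi (i : ι) : IsUnit (phiOp q h i) :=
  isUnit_of_coeff_zero (d.heisenberg.isExp_cre _ i).1

lemma isUnit_psi (i : ι) : IsUnit (psiOp q h i) :=
  isUnit_of_coeff_zero (d.heisenberg.isExp_ann _ i).1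

lemma commute_tau_phi (ε : ℤˣ) (j i : ι) (k : ℤ) : Commute (τ ε j) (inZ (phiOp q h i) k) :=
  d.heisenberg.commute_exp_cre_of _ _ (d.commute ε j) k

lemma commute_tau_psi (ε : ℤˣ) (j i : ι) (k : ℤ) : Commute (τ ε j) (inZ (psiOp q h i) k) :=
  d.heisenberg.commute_exp_ann_of _ _ (d.commute ε j) k

lemma phi_psi (i j : ι) : prodZW (inZ (phiOp q h i)) (inZInv (psiOp q h j)) =
    mulZoverW (prodWZ (inZInv (psiOp q h j)) (inZ (phiOp q h i)))
      (PowerSeries.map (algebraMap ℂ (Module.End ℂ W))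
        (rescale q⁻¹ (G q (A i j)) * (rescale q (G q (A i j)))⁻¹)) :=
  (d.braid_phi_psi i j).prodZW_eq

lemma phi_phi (i j : ι) : commZW (inZ (phiOp q h i)) (inZ (phiOp q h j)) = 0 :=
  commZW_eq_zero (d.heisenberg.commute_exp_cre _ _ i j)

lemma psi_psi (i j : ι) : commZW (inZInv (psiOp q h i)) (inZInv (psiOp q h j)) = 0 :=
  commZW_eq_zero fun m n => d.heisenberg.commute_exp_ann _ _ i j (-m) (-n)

lemma phi_vertex (i j : ι) (ε : ℤˣ) : conjZ (phiOp q h i) (vertexOp q s h τ ε j) =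
    mulZoverW (inW (vertexOp q s h τ ε j)) (PowerSeries.map (algebraMap ℂ (Module.End ℂ W))
      (rescale (s ^ (-(ε : ℤ))) (Gpow q (A i j) ε))) := by
  refine conjZ_eq (d.isUnit_phi i) fun m n => ?_
  have hc : ∀ k l, Commute (inZ (phiOp q h i) k) (inZ (expMinus q s h ε j) l) :=
    d.heisenberg.commute_exp_cre _ _ i j
  rw [vertexOp, ← mul_assoc,
    mul_vert_of_commute_left (d.locNil ε j) hc (d.braid_phi_vertex i j ε), finsum_mul']
  · refine finsum_congr fun t => ?_
    rw [vertexOp, smul_mul_assoc, mul_assoc, mul_assoc, (d.commute_tau_phi ε j i _).eq]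
  · refine (Set.finite_Icc 0 m).subset fun t ht => ?_
    rw [Function.mem_support] at ht
    rw [Set.mem_Icc]
    refine ⟨?_, ?_⟩ <;> by_contra h <;> apply ht
    · rw [inZ_of_neg _ (by omega), zero_smul]
    · rw [inZ_of_neg (phiOp _ _ _) (by omega), mul_zero, smul_zero]

lemma psi_vertex (i j : ι) (ε : ℤˣ) : conjZInv (psiOp q h i) (vertexOp q s h τ ε j) =
    mulWoverZ (inW (vertexOp q s h τ ε j)) (PowerSeries.map (algebraMap ℂ (Module.End ℂ W))
      (rescale (s ^ (-(ε : ℤ))) (Gpow q (A i j) (-ε)))) := by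
  refine conjZInv_eq (d.isUnit_psi i) fun m n => ?_
  have hc : ∀ k l, Commute (inZ (psiOp q h i) k) (inZ (expPlus q s h ε j) l) :=
    d.heisenberg.commute_exp_ann _ _ i j
  rw [vertexOp, ← mul_assoc,
    mul_vert_of_commute_right (d.locNil ε j) hc (d.braid_psi_vertex i j ε), finsum_mul']
  · refine finsum_congr fun t => ?_
    rw [vertexOp, smul_mul_assoc, mul_assoc, mul_assoc, (d.commute_tau_psi ε j i _).eq]
  · refine (Set.finite_Icc 0 m).subset fun t ht => ?_
    rw [Function.mem_support] at ht
    rw [Set.mem_Icc]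
    refine ⟨?_, ?_⟩ <;> by_contra h <;> apply ht
    · rw [inZ_of_neg _ (by omega), zero_smul]
    · rw [inZ_of_neg (psiOp _ _ _) (by omega), mul_zero, smul_zero]

lemma vertex_comm_of_eq_zero {i j : ι} (hij : A i j = 0) (ε ε' : ℤˣ) :
    commZW (vertexOp q s h τ ε i) (vertexOp q s h τ ε' j) = 0 := by
  have hji : A j i = 0 := by rw [d.symm.apply i j, hij]
  rw [commZW, d.vertex_mul_vertex (d.braid_of_eq_zero hij),
    d.vertex_mul_vertex_swap (d.braid_of_eq_zero hji), hij, zpow_zero, one_smul]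
  have : (fun t : ℤ => inZ (1 : PowerSeries ℂ) (-t)) = inZ 1 := by
    funext t
    simp only [inZ_one, neg_eq_zero]
  rw [this, sub_self]

/-- The group sign -1 turns the commutator into the sum of the two expansions of the contraction.
Since (1 - x)/(1 + x) is odd under x ↦ x⁻¹, this sum is the delta function at its pole x = -1. -/
lemma vertex_comm_of_eq_neg_one {i j : ι} (hij : A i j = -1) :
    commZW (vertexOp q s h τ 1 i) (vertexOp q s h τ (-1) j) =
      (2 : ℂ) • mulDelta (fun k => (-1 : ℂ) ^ k)
        (diag 1 (-1) (normalOp q s h τ 1 i (-1) j)) := by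
  have hji : A j i = -1 := by rw [d.symm.apply i j, hij]
  have h1 := d.braid_of_eq_neg_one (ε := 1) (ε' := -1) hij
  have h2 := d.braid_of_eq_neg_one (ε := -1) (ε' := 1) hji
  have hF := d.normal_antidiagFinite 1 i (-1) j
  rw [show (((1 : ℤˣ) : ℤ) : ℂ) * (((-1 : ℤˣ) : ℤ) : ℂ) *
    s ^ (-(((1 : ℤˣ) : ℤ) + ((-1 : ℤˣ) : ℤ))) = -1 by simp] at h1
  rw [show (((-1 : ℤˣ) : ℤ) : ℂ) * (((1 : ℤˣ) : ℤ) : ℂ) *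
    s ^ (-(((-1 : ℤˣ) : ℤ) + ((1 : ℤˣ) : ℤ))) = -1 by simp] at h2
  rw [commZW, d.vertex_mul_vertex h1, d.vertex_mul_vertex_swap h2, hij, zpow_neg_one, inv_neg_one,
    neg_one_smul, sub_neg_eq_add, ← hF.conv_add]
  have h3 : (inZ (ell (-1)) + fun t => inZ (ell (-1)) (-t)) =
      (2 : ℂ) • fun t : ℤ => (-1 : ℂ) ^ t := funext inZ_ell_neg_one_add
  rw [h3, hF.conv_smul, hF.conv_zpow (neg_ne_zero.mpr one_ne_zero), inv_neg_one]

/-- The contraction is `ell q * ell q⁻¹`. Its delta functions restrict the normal ordered product to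
w = q⁻¹z, where creation cancels and Ψ is left, and to w = qz, where annihilation cancels and Φ is
left. -/
lemma vertex_comm_same {i : ι} (hi : A i i = 2) :
    commZW (vertexOp q s h τ 1 i) (vertexOp q s h τ (-1) i) =
      (2 * (q + q⁻¹) / (q - q⁻¹)) •
        (mulDelta (fun k => q ^ k) (scale (fun k => s ^ (-k)) (inZInv (psiOp q h i)))
          - mulDelta (fun k => q ^ (-k)) (scale (fun k => s ^ k) (inZ (phiOp q h i)))) := by
  have h1 := d.braid_of_eq_two (ε := 1) (ε' := -1) hi
  have h2 := d.braid_of_eq_two (ε := -1) (ε' := 1) hi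
  have hF := d.normal_antidiagFinite 1 i (-1) i
  rw [show -((((1 : ℤˣ) : ℤ) : ℂ) * (((-1 : ℤˣ) : ℤ) : ℂ) *
    s ^ (-(((1 : ℤˣ) : ℤ) + ((-1 : ℤˣ) : ℤ)))) = 1 by simp, one_mul, one_mul] at h1
  rw [show -((((-1 : ℤˣ) : ℤ) : ℂ) * (((1 : ℤˣ) : ℤ) : ℂ) *
    s ^ (-(((-1 : ℤˣ) : ℤ) + ((1 : ℤˣ) : ℤ)))) = 1 by simp, one_mul, one_mul] at h2
  rw [commZW, d.vertex_mul_vertex h1, d.vertex_mul_vertex_swap h2, hi,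
    show (-1 : ℂ) ^ (2 : ℤ) = 1 by norm_num, one_smul, ← hF.conv_sub]
  have h3 : (inZ (ell q * ell q⁻¹) - fun t => inZ (ell q * ell q⁻¹) (-t)) =
      (2 * (q + q⁻¹) / (q - q⁻¹)) • ((fun t : ℤ => q ^ t) - fun t : ℤ => q⁻¹ ^ t) :=
    funext (inZ_ell_mul_ell_inv_sub (sub_ne_zero.mp d.q_sub_inv_ne_zero))
  rw [h3, hF.conv_smul, hF.conv_sub, hF.conv_zpow d.ne_zero,
    hF.conv_zpow (inv_ne_zero d.ne_zero), inv_inv, d.diag_one_inv, d.diag_one_self]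
  simp only [inv_zpow, zpow_neg]

/-- With u = q^(-ε) both prefactors make the contraction polynomial; the group sign matches the
minus sign in `quadratic_inZ_ell`. -/
lemma vertex_exchange_of_eq_neg_one {i j : ι} (hij : A i j = -1) (ε : ℤˣ) :
    lin 1 (-q ^ (-(ε : ℤ))) (lin 1 (q ^ (ε : ℤ))
        (prodZW (vertexOp q s h τ ε i) (vertexOp q s h τ ε j))) =
      lin (q ^ (-(ε : ℤ))) (-1) (lin (q ^ (ε : ℤ)) 1
        (prodWZ (vertexOp q s h τ ε j) (vertexOp q s h τ ε i))) := by
  have hji : A j i = -1 := by rw [d.symm.apply i j, hij]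
  have h1 := d.braid_of_eq_neg_one (ε := ε) (ε' := ε) hij
  have h2 := d.braid_of_eq_neg_one (ε := ε) (ε' := ε) hji
  have hF := d.normal_antidiagFinite ε i ε j
  have hu : ((ε : ℤ) : ℂ) * ((ε : ℤ) : ℂ) * s ^ (-((ε : ℤ) + (ε : ℤ))) = q ^ (-(ε : ℤ)) := by
    have : ((ε : ℤ) : ℂ) * ((ε : ℤ) : ℂ) = 1 := by
      rw [← Int.cast_mul, ← Units.val_mul, Int.units_mul_self]; simp
    rw [this, one_mul, zpow_neg, zpow_neg, ← d.s_zpow_two, two_mul]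
  rw [hu] at h1 h2
  rw [d.vertex_mul_vertex h1, d.vertex_mul_vertex_swap h2, hij, zpow_neg_one, inv_neg_one,
    lin_smul, lin_smul]
  funext m n
  rw [hF.lin_lin_conv, Pi.smul_apply, Pi.smul_apply, hF.lin_lin_conv]
  have hu0 : q ^ (-(ε : ℤ)) ≠ 0 := zpow_ne_zero _ d.ne_zero
  have hinv : q ^ (ε : ℤ) = (q ^ (-(ε : ℤ)))⁻¹ := by rw [zpow_neg, inv_inv]
  rw [hinv]
  generalize q ^ (-(ε : ℤ)) = u at *
  rw [funext (quadratic_inZ_ell hu0), ← Pi.smul_apply, ← Pi.smul_apply, ← hF.conv_smul]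
  congr 1
  funext t
  rw [Pi.smul_apply, neg_one_smul]

lemma vertex_exchange_same {i : ι} (hi : A i i = 2) (ε : ℤˣ) :
    lin 1 (-q ^ (2 * (ε : ℤ))) (lin 1 (q ^ (-2 * (ε : ℤ)))
        (prodZW (vertexOp q s h τ ε i) (vertexOp q s h τ ε i))) =
      lin (q ^ (2 * (ε : ℤ))) (-1) (lin (q ^ (-2 * (ε : ℤ))) 1
          (prodWZ (vertexOp q s h τ ε i) (vertexOp q s h τ ε i)))
        + mulDelta (fun k => (-1 : ℂ) ^ k) (mono 2 ((2 * (q + q⁻¹) ^ 2) • (τ ε i * τ ε i))) := by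
  have h1 := d.braid_of_eq_two (ε := ε) (ε' := ε) hi
  have hF := d.normal_antidiagFinite ε i ε i
  have hεε : ((ε : ℤ) : ℂ) * ((ε : ℤ) : ℂ) = 1 := by
    rw [← Int.cast_mul, ← Units.val_mul, Int.units_mul_self]; simp
  have hu : ((ε : ℤ) : ℂ) * ((ε : ℤ) : ℂ) * s ^ (-((ε : ℤ) + (ε : ℤ))) = q ^ (-(ε : ℤ)) := by
    rw [hεε, one_mul, zpow_neg, zpow_neg, ← d.s_zpow_two, two_mul]
  have hq0 := d.ne_zero
  -- The two bases are -q^(1-ε) and -q^(-1-ε); one of them is -1, which one depending on ε.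
  have hell : ell (-(q ^ (-(ε : ℤ))) * q) * ell (-(q ^ (-(ε : ℤ))) * q⁻¹) =
      ell (-1) * ell (-q ^ (-2 * (ε : ℤ))) := by
    rcases Int.units_eq_one_or ε with rfl | rfl
    · congr 2
      · simp [hq0]
      · simp only [Units.val_one, mul_one, neg_mul, ← zpow_neg_one q, ← zpow_add₀ hq0]
        norm_num
    · rw [mul_comm]
      congr 2
      · simp [hq0]
      · simp only [Units.val_neg, Units.val_one, neg_mul, neg_neg, zpow_one, mul_neg, mul_one]
        rw [show (2 : ℤ) = 1 + 1 by norm_num, zpow_add₀ hq0, zpow_one]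
  have hU0 : q ^ (-2 * (ε : ℤ)) ≠ 0 := zpow_ne_zero _ hq0
  have hU1 : q ^ (-2 * (ε : ℤ)) ≠ 1 := by
    have h2 : q ^ (2 : ℤ) ≠ 1 := by exact_mod_cast d.generic 2 two_pos
    rcases Int.units_eq_one_or ε with rfl | rfl
    · simpa [zpow_neg] using h2
    · simpa using h2
  have hconst : 2 * (q ^ (-2 * (ε : ℤ)) + 2 + (q ^ (-2 * (ε : ℤ)))⁻¹) = 2 * (q + q⁻¹) ^ 2 := by
    rcases Int.units_eq_one_or ε with rfl | rfl
    · simp only [Units.val_one, mul_one]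
      rw [show (-2 : ℤ) = -1 + -1 by norm_num, zpow_add₀ hq0, zpow_neg_one]
      field_simp
      ring
    · simp only [Units.val_neg, Units.val_one, mul_neg, neg_neg, mul_one]
      rw [show (2 : ℤ) = 1 + 1 by norm_num, zpow_add₀ hq0, zpow_one]
      field_simp
      ring
  have hinv : q ^ (2 * (ε : ℤ)) = (q ^ (-2 * (ε : ℤ)))⁻¹ := by
    rw [neg_mul, zpow_neg, inv_inv]
  rw [hu, hell] at h1
  rw [d.vertex_mul_vertex h1, d.vertex_mul_vertex_swap h1, hi,
    show (-1 : ℂ) ^ (2 : ℤ) = 1 by norm_num, one_smul]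
  funext m n
  rw [Pi.add_apply, Pi.add_apply, hF.lin_lin_conv, hF.lin_lin_conv, hinv, ← hconst]
  generalize q ^ (-2 * (ε : ℤ)) = U at *
  rw [funext (quadratic_inZ_ell_mul_ell hU0 hU1)]
  have hadd : ∀ c c' : ℤ → ℂ, conv (fun t => c t + c' t) (normalOp q s h τ ε i ε i) =
      conv c (normalOp q s h τ ε i ε i) + conv c' (normalOp q s h τ ε i ε i) := hF.conv_add
  rw [hadd, Pi.add_apply, Pi.add_apply]
  congr 1
  have h4 : (fun t : ℤ => 2 * (U + 2 + U⁻¹) * (-1 : ℂ) ^ t) =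
      (2 * (U + 2 + U⁻¹)) • fun t : ℤ => (-1 : ℂ) ^ t := rfl
  rw [h4, hF.conv_smul, hF.conv_zpow (neg_ne_zero.mpr one_ne_zero), inv_neg_one, d.diag_eq_mono]
  -- The factor w² extracted from the quadratic prefactor becomes z², because w² δ(-w/z) = z²
  -- δ(-w/z).
  simp only [Pi.smul_apply, mulDelta, mono, show m + (n - 2) = 0 ↔ m + n = 2 by omega]
  rw [zpow_sub₀ (by norm_num), show (-1 : ℂ) ^ (2 : ℤ) = 1 by norm_num, div_one]
  split_ifs
  · rw [smul_comm]
  · simp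

end VertexData

end Relations

/-! ### Algebra homomorphisms applied to formal series -/

section Map

variable {B C : Type*} [Ring B] [Algebra ℂ B] [Ring C] [Algebra ℂ C] (φ : B →ₐ[ℂ] C)

open PowerSeries

lemma map_inZ (f : PowerSeries B) (m : ℤ) :
    φ (inZ f m) = inZ (PowerSeries.map (φ : B →+* C) f) m := by
  unfold inZ
  split_ifs
  · rw [coeff_map]; rfl
  · exact map_zero φ

lemma map_inZInv (f : PowerSeries B) (m : ℤ) :
    φ (inZInv f m) = inZInv (PowerSeries.map (φ : B →+* C) f) m := map_inZ φ f (-m)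

lemma map_commZW (a b : FD B) (m n : ℤ) :
    φ (commZW a b m n) = commZW (fun k => φ (a k)) (fun k => φ (b k)) m n := by
  change φ (a m * b n - b n * a m) = φ (a m) * φ (b n) - φ (b n) * φ (a m)
  rw [map_sub, map_mul, map_mul]

lemma map_lin (c d : ℂ) (F : FD₂ B) (m n : ℤ) :
    φ (lin c d F m n) = lin c d (fun k l => φ (F k l)) m n := by
  rw [lin, lin, map_add, map_smul, map_smul]

lemma map_prodZW (a b : FD B) (m n : ℤ) :
    φ (prodZW a b m n) = prodZW (fun k => φ (a k)) (fun k => φ (b k)) m n := map_mul φ _ _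

lemma map_prodWZ (a b : FD B) (m n : ℤ) :
    φ (prodWZ b a m n) = prodWZ (fun k => φ (b k)) (fun k => φ (a k)) m n := map_mul φ _ _

lemma map_inW (b : FD B) (m n : ℤ) : φ (inW b m n) = inW (fun k => φ (b k)) m n := by
  unfold inW
  split_ifs
  · rfl
  · exact map_zero φ

/-- The vanishing hypothesis guarantees finite support; without it the default value of the infinite
sum need not be respected by φ. -/
lemma map_mulZoverW {F : FD₂ B} {m n : ℤ} {N : ℕ} (hF : ∀ k : ℕ, N < k → F (m - k) (n + k) = 0)
    (g : PowerSeries B) :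
    φ (mulZoverW F g m n) =
      mulZoverW (fun k l => φ (F k l)) (PowerSeries.map (φ : B →+* C) g) m n := by
  rw [mulZoverW, map_finsum]
  · exact finsum_congr fun k => by rw [map_mul, coeff_map]; rfl
  · refine (Set.finite_Iic N).subset fun k hk => ?_
    by_contra h
    exact hk (by dsimp only; rw [hF k (not_le.mp h), zero_mul])

lemma map_mulWoverZ {F : FD₂ B} {m n : ℤ} {N : ℕ} (hF : ∀ k : ℕ, N < k → F (m + k) (n - k) = 0)
    (g : PowerSeries B) :
    φ (mulWoverZ F g m n) =
      mulWoverZ (fun k l => φ (F k l)) (PowerSeries.map (φ : B →+* C) g) m n := by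
  rw [mulWoverZ, map_finsum]
  · exact finsum_congr fun k => by rw [map_mul, coeff_map]; rfl
  · refine (Set.finite_Iic N).subset fun k hk => ?_
    by_contra h
    exact hk (by dsimp only; rw [hF k (not_le.mp h), zero_mul])

lemma map_expSeries (f : PowerSeries B) :
    PowerSeries.map (φ : B →+* C) (expSeries f) =
      expSeries (PowerSeries.map (φ : B →+* C) f) := by
  ext1 k
  rw [coeff_map, expSeries, expSeries, coeff_mk, coeff_mk, map_sum]
  refine Finset.sum_congr rfl fun j _ => ?_
  rw [← map_pow, coeff_map]
  exact map_smul φ _ _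

lemma map_oddSeries (b : {n : ℕ // Odd n} → B) :
    PowerSeries.map (φ : B →+* C) (oddSeries b) = oddSeries fun n => φ (b n) := by
  ext1 n
  rw [coeff_map, coeff_oddSeries, coeff_oddSeries]
  split_ifs
  · rfl
  · exact map_zero φ

/-- A homomorphism respects `Ring.inverse` at units, while at nonunits the default value 0 could be
mapped wrongly. -/
lemma map_conj {U : PowerSeries B} (hU : IsUnit U) (b : B) :
    PowerSeries.map (φ : B →+* C) (U * PowerSeries.C b * Ring.inverse U) =
      PowerSeries.map (φ : B →+* C) U * PowerSeries.C (φ b) *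
        Ring.inverse (PowerSeries.map (φ : B →+* C) U) := by
  obtain ⟨u, rfl⟩ := hU
  have h : Ring.inverse (PowerSeries.map (φ : B →+* C) u) =
      PowerSeries.map (φ : B →+* C) (u⁻¹ : (PowerSeries B)ˣ) :=
    Ring.inverse_unit (Units.map (PowerSeries.map (φ : B →+* C) : PowerSeries B →* PowerSeries C) u)
  rw [map_mul, map_mul, map_C, Ring.inverse_unit, h]
  rfl

lemma map_conjZ {U : PowerSeries B} (hU : IsUnit U) (b : FD B) (m n : ℤ) :
    φ (conjZ U b m n) = conjZ (PowerSeries.map (φ : B →+* C) U) (fun k => φ (b k)) m n := by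
  rw [conjZ, map_inZ, map_conj φ hU, conjZ]

lemma map_conjZInv {U : PowerSeries B} (hU : IsUnit U) (b : FD B) (m n : ℤ) :
    φ (conjZInv U b m n) = conjZInv (PowerSeries.map (φ : B →+* C) U) (fun k => φ (b k)) m n := by
  rw [conjZInv, map_inZInv, map_conj φ hU, conjZInv]

/-- The delta function is supported on w = -z, where z + w vanishes. -/
lemma lin_one_one_mulDelta (a : FD B) : lin 1 1 (mulDelta (fun k => (-1 : ℂ) ^ k) a) = 0 := by
  funext m n
  simp only [lin, mulDelta, one_smul]
  rw [show m + (n - 1) = m - 1 + n by ring, ← add_smul, zpow_sub_one₀ (by norm_num)]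
  simp

end Map

/-! ### The level-one representation -/

section Representation

variable {ι W : Type*} [AddCommGroup W] [Module ℂ W] {q s : ℂ} {A : Matrix ι ι ℤ}
  {h : ι → {m : ℤ // Odd m} → Module.End ℂ W} {τ : ℤˣ → ι → Module.End ℂ W}

open PowerSeries

/-- The images of the generators of `U_q(g̃)` at level one. -/
def genImage (q s : ℂ) (h : ι → {m : ℤ // Odd m} → Module.End ℂ W)
    (τ : ℤˣ → ι → Module.End ℂ W) : Gen ι → Module.End ℂ W
  | Gen.c => 1
  | Gen.gammaHalf => s • 1
  | Gen.gammaHalfInv => s⁻¹ • 1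
  | Gen.a i m => h i m
  | Gen.x ε i n => vertexOp q s h τ ε i (-n)

/-- The level-one action of the free algebra. -/
def freeAct (q s : ℂ) (h : ι → {m : ℤ // Odd m} → Module.End ℂ W)
    (τ : ℤˣ → ι → Module.End ℂ W) : Free ι →ₐ[ℂ] Module.End ℂ W :=
  FreeAlgebra.lift ℂ (genImage q s h τ)

lemma freeAct_gen (g : Gen ι) : freeAct q s h τ (gen g) = genImage q s h τ g :=
  FreeAlgebra.lift_ι_apply _ _

lemma freeAct_xSer (ε : ℤˣ) (i : ι) :
    (fun k => freeAct q s h τ (xSer ε i k)) = vertexOp q s h τ ε i := by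
  funext k
  rw [xSer, freeAct_gen, genImage, neg_neg]

lemma map_phiSer (i : ι) : PowerSeries.map (freeAct q s h τ : Free ι →+* Module.End ℂ W)
    (phiSer q i) = phiOp q h i := by
  rw [phiSer, map_expSeries, map_oddSeries]
  simp only [map_smul, freeAct_gen]
  rfl

lemma map_psiSer (i : ι) : PowerSeries.map (freeAct q s h τ : Free ι →+* Module.End ℂ W)
    (psiSer q i) = psiOp q h i := by
  rw [psiSer, map_expSeries, map_oddSeries]
  simp only [map_smul, freeAct_gen]
  rfl

lemma isUnit_phiSer (i : ι) : IsUnit (phiSer q i) :=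
  isUnit_of_coeff_zero (by simp [phiSer, expSeries])

lemma isUnit_psiSer (i : ι) : IsUnit (psiSer q i) :=
  isUnit_of_coeff_zero (by simp [psiSer, expSeries])

lemma freeAct_phiSer (i : ι) :
    (fun k => freeAct q s h τ (inZ (phiSer q i) k)) = inZ (phiOp q h i) := by
  funext k
  rw [map_inZ, map_phiSer]

lemma freeAct_psiSer (i : ι) :
    (fun k => freeAct q s h τ (inZInv (psiSer q i) k)) = inZInv (psiOp q h i) := by
  funext k
  rw [map_inZInv, map_psiSer]

lemma freeAct_gammaHalfPow (k : ℤ) : freeAct q s h τ (gammaHalfPow k) = s ^ k • 1 := by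
  unfold gammaHalfPow
  split_ifs with hk
  · rw [map_pow, freeAct_gen, genImage, smul_pow, one_pow, ← zpow_natCast, Int.toNat_of_nonneg hk]
  · rw [map_pow, freeAct_gen, genImage, smul_pow, one_pow, ← zpow_natCast,
      Int.toNat_of_nonneg (by omega), inv_zpow, zpow_neg, inv_inv]

lemma map_scaleGamma (g : PowerSeries ℂ) (k : ℤ) :
    PowerSeries.map (freeAct q s h τ : Free ι →+* Module.End ℂ W) (scaleGamma g k) =
      PowerSeries.map (algebraMap ℂ (Module.End ℂ W)) (rescale (s ^ k) g) := by
  ext1 n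
  rw [coeff_map, coeff_map, coeff_rescale, scaleGamma, coeff_mk, ← zpow_natCast, ← zpow_mul]
  change freeAct q s h τ _ = _
  rw [map_smul, freeAct_gammaHalfPow, smul_smul, mul_comm, Algebra.algebraMap_eq_smul_one]

variable (d : VertexData q s A h τ)

namespace VertexData

include d

lemma freeAct_rel (hA : ∀ i, A i i = 2) (hτ : ∀ ε i, τ ε i * τ ε i = 1) ⦃x y : Free ι⦄
    (hxy : Rel q A x y) :
    freeAct q s h τ x = freeAct q s h τ y := by
  have hs0 := d.s_ne_zero
  induction hxy with
  | c_central y => rw [map_mul, map_mul, freeAct_gen, genImage, one_mul, mul_one]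
  | gamma_central y =>
    rw [map_mul, map_mul, freeAct_gen, genImage, smul_mul_assoc, mul_smul_comm, one_mul, mul_one]
  | gamma_mul_inv =>
    rw [map_mul, map_one, freeAct_gen, freeAct_gen, genImage, genImage, smul_mul_smul_comm,
      mul_one, mul_inv_cancel₀ hs0, one_smul]
  | gamma_inv_mul =>
    rw [map_mul, map_one, freeAct_gen, freeAct_gen, genImage, genImage, smul_mul_smul_comm,
      mul_one, inv_mul_cancel₀ hs0, one_smul]
  | phi_phi i j m n =>
    rw [map_commZW, freeAct_phiSer, freeAct_phiSer, d.phi_phi, map_zero]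
    rfl
  | psi_psi i j m n =>
    rw [map_commZW, freeAct_psiSer, freeAct_psiSer, d.psi_psi, map_zero]
    rfl
  | phi_psi i j m n =>
    have hF : ∀ k : ℕ, m.toNat < k →
        prodWZ (inZInv (psiSer q j)) (inZ (phiSer q i)) (m - k) (n + k) = 0 := fun k hk => by
      rw [prodWZ, inZ_of_neg _ (by omega), mul_zero]
    -- The defining relation inverts G before substituting γ, the operator identity afterwards; both
    -- are the same product of series `ell`.
    have hG : rescale (s ^ (-2 : ℤ)) (G q (A i j)) * rescale (s ^ (2 : ℤ)) (G q (A i j))⁻¹ =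
        rescale q⁻¹ (G q (A i j)) * (rescale q (G q (A i j)))⁻¹ := by
      have h2 : s ^ (2 : ℤ) = q := by rw [← d.sq]; rfl
      rw [zpow_neg, h2, G_eq d.ne_zero, map_mul, map_mul, PowerSeries.mul_inv_rev,
        PowerSeries.mul_inv_rev]
      simp only [map_mul, rescale_ell, inv_ell, mul_neg]
    rw [map_prodZW, freeAct_phiSer, freeAct_psiSer, map_mulZoverW _ hF, map_mul, map_scaleGamma,
      map_scaleGamma, ← map_mul, hG, d.phi_psi]
    simp only [map_prodWZ, freeAct_phiSer, freeAct_psiSer]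
  | phi_x ε i j m n =>
    have hF : ∀ k : ℕ, m.toNat < k → inW (xSer ε j : FD (Free ι)) (m - k) (n + k) = 0 :=
      fun k hk => by rw [inW, if_neg (by omega)]
    rw [map_conjZ _ (isUnit_phiSer i), map_phiSer, freeAct_xSer, map_mulZoverW _ hF,
      map_scaleGamma, d.phi_vertex]
    simp only [map_inW, freeAct_xSer]
  | psi_x ε i j m n =>
    have hF : ∀ k : ℕ, (-m).toNat < k → inW (xSer ε j : FD (Free ι)) (m + k) (n - k) = 0 :=
      fun k hk => by rw [inW, if_neg (by omega)]
    rw [map_conjZInv _ (isUnit_psiSer i), map_psiSer, freeAct_xSer, map_mulWoverZ _ hF,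
      map_scaleGamma, d.psi_vertex]
    simp only [map_inW, freeAct_xSer]
  | x_x_zero ε i j hij m n =>
    rw [map_commZW, freeAct_xSer, freeAct_xSer, d.vertex_comm_of_eq_zero hij, map_zero]
    rfl
  | xp_xm_zero i j hij m n =>
    rw [map_commZW, freeAct_xSer, freeAct_xSer, d.vertex_comm_of_eq_zero hij, map_zero]
    rfl
  | xp_xm_neg i j hij m n =>
    rw [map_lin, map_zero]
    simp only [map_commZW, freeAct_xSer]
    rw [d.vertex_comm_of_eq_neg_one hij, lin_smul, lin_one_one_mulDelta, smul_zero]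
    rfl
  | xp_xm i m n =>
    have h2 : ∀ k : ℤ, s ^ (2 * k) = q ^ k := fun k => by
      rw [← d.sq, ← zpow_natCast, ← zpow_mul]; rfl
    rw [map_commZW, freeAct_xSer, freeAct_xSer, d.vertex_comm_same (hA i)]
    simp only [mulDelta, scale, map_smul, map_sub, smul_eq_mul, map_mul, freeAct_gammaHalfPow,
      Pi.smul_apply, Pi.sub_apply, smul_mul_assoc, one_mul, map_inZ, map_inZInv, map_phiSer,
      map_psiSer, h2, neg_mul, zpow_neg]
  | x_x_neg ε i j hij m n =>
    simp only [map_lin, map_prodZW, map_prodWZ, freeAct_xSer]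
    exact congrFun (congrFun (d.vertex_exchange_of_eq_neg_one hij ε) m) n
  | x_x_same ε i m n =>
    rw [map_add]
    simp only [map_lin, map_prodZW, map_prodWZ, freeAct_xSer]
    rw [d.vertex_exchange_same (hA i), hτ]
    refine congrArg (lin (q ^ (2 * (ε : ℤ))) (-1) (lin (q ^ (-2 * (ε : ℤ))) 1 (prodWZ
      (vertexOp q s h τ ε i) (vertexOp q s h τ ε i))) m n + ·) ?_
    rw [mulDelta, mulDelta, map_smul, mono, mono]
    split_ifs
    · rw [map_smul, freeAct_gen]; rfl
    · rw [map_zero]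

lemma exists_levelOne (hA : ∀ i, A i i = 2) (hτ : ∀ ε i, τ ε i * τ ε i = 1) :
    ∃ π : Uq q A →ₐ[ℂ] Module.End ℂ W, ∀ g, π (Uq.of q A g) = genImage q s h τ g :=
  ⟨RingQuot.liftAlgHom ℂ ⟨freeAct q s h τ, d.freeAct_rel hA hτ⟩, fun g => by
    rw [Uq.of, RingQuot.liftAlgHom_mkAlgHom_apply, freeAct_gen]⟩

end VertexData

end Representation

/-! ### The Fock space tensored with the module of the central extension -/

section FockSpace

variable {ι : Type*} {q : ℂ} {A : Matrix ι ι ℤ}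

lemma heisS_negOdd (i : ι) (n : {n : ℕ // Odd n}) :
    heisS q A i (negOdd n) = LinearMap.mulLeft ℂ (MvPolynomial.X (i, n)) := by
  have h : (negOdd n).1 < 0 := by
    have := n.2.pos
    change -(n.1 : ℤ) < 0
    omega
  rw [heisS, if_pos h]
  congr
  exact (Int.natAbs_neg _).trans (Int.natAbs_natCast _)

open Classical in
/-- The derivation `a_i(n)` of the Fock space. -/
def heisD (q : ℂ) (A : Matrix ι ι ℤ) (i : ι) (n : {n : ℕ // Odd n}) :
    Derivation ℂ (Fock ι) (Fock ι) :=
  MvPolynomial.mkDerivation ℂ fun p : ι × {n : ℕ // Odd n} =>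
    if n = p.2 then MvPolynomial.C (qint q (A i p.1 * n.1) / (2 * (n.1 : ℂ)) * qint q n.1) else 0

lemma heisD_X (i j : ι) (n m : {n : ℕ // Odd n}) :
    heisD q A i n (MvPolynomial.X (j, m)) = if n = m then
      MvPolynomial.C (qint q (A i j * n.1) / (2 * (n.1 : ℂ)) * qint q n.1) else 0 := by
  rw [heisD, MvPolynomial.mkDerivation_X]

lemma heisS_posOdd (i : ι) (n : {n : ℕ // Odd n}) :
    heisS q A i (posOdd n) = (heisD q A i n).toLinearMap := by
  have h : ¬ (posOdd n).1 < 0 := not_lt.mpr (Int.natCast_nonneg _)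
  rw [heisS, if_neg h, heisD]
  congr
  funext p
  simp only [posOdd, Nat.cast_inj, Subtype.ext_iff, Int.cast_natCast, eq_comm]

lemma heisS_neg_neg (i j : ι) (n m : {n : ℕ // Odd n}) :
    heisS q A i (negOdd n) * heisS q A j (negOdd m) =
      heisS q A j (negOdd m) * heisS q A i (negOdd n) := by
  rw [heisS_negOdd, heisS_negOdd]
  refine LinearMap.ext fun p => ?_
  exact mul_left_comm _ _ _

/-- A commutator of derivations is a derivation, and it vanishes on the variables because both
derivations send variables to constants. -/
lemma heisS_pos_pos (i j : ι) (n m : {n : ℕ // Odd n}) :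
    heisS q A i (posOdd n) * heisS q A j (posOdd m) =
      heisS q A j (posOdd m) * heisS q A i (posOdd n) := by
  have h : ⁅heisD q A i n, heisD q A j m⁆ = 0 := by
    refine MvPolynomial.derivation_ext fun p => ?_
    rw [Derivation.commutator_apply, heisD_X, heisD_X]
    split_ifs <;> simp [MvPolynomial.derivation_C]
  rw [heisS_posOdd, heisS_posOdd]
  refine LinearMap.ext fun p => ?_
  have h1 := congrArg (fun D : Derivation ℂ (Fock ι) (Fock ι) => D p) h
  rw [Derivation.commutator_apply] at h1
  exact sub_eq_zero.mp h1

lemma heisS_pos_neg (i j : ι) (n m : {n : ℕ // Odd n}) :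
    heisS q A i (posOdd n) * heisS q A j (negOdd m) -
        heisS q A j (negOdd m) * heisS q A i (posOdd n) =
      if n = m then (qint q (A i j * n.1) / (2 * (n.1 : ℂ)) * qint q n.1) • 1 else 0 := by
  rw [heisS_posOdd, heisS_negOdd]
  refine LinearMap.ext fun p => ?_
  have h : heisD q A i n (MvPolynomial.X (j, m) * p) -
      MvPolynomial.X (j, m) * heisD q A i n p = heisD q A i n (MvPolynomial.X (j, m)) * p := by
    rw [Derivation.leibniz, smul_eq_mul, smul_eq_mul]
    ring
  refine (h.trans ?_)
  rw [heisD_X]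
  split_ifs
  · exact (MvPolynomial.smul_eq_C_mul _ _).symm
  · exact zero_mul p

variable {T : Type*} [AddCommGroup T] [Module ℂ T]

lemma heis_mul (i j : ι) (m n : {m : ℤ // Odd m}) :
    heis q A T i m * heis q A T j n = LinearMap.rTensor T (heisS q A i m * heisS q A j n) :=
  (LinearMap.rTensor_mul T _ _).symm

lemma heis_pos_neg (i j : ι) (n m : {n : ℕ // Odd n}) :
    heis q A T i (posOdd n) * heis q A T j (negOdd m) -
        heis q A T j (negOdd m) * heis q A T i (posOdd n) =
      if n = m then (qint q (A i j * n.1) / (2 * (n.1 : ℂ)) * qint q n.1) • 1 else 0 := by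
  have h : heis q A T i (posOdd n) * heis q A T j (negOdd m) -
      heis q A T j (negOdd m) * heis q A T i (posOdd n) =
      LinearMap.rTensor T (heisS q A i (posOdd n) * heisS q A j (negOdd m) -
        heisS q A j (negOdd m) * heisS q A i (posOdd n)) := by
    rw [heis_mul, heis_mul]
    exact (LinearMap.rTensor_sub _ _).symm
  rw [h, heisS_pos_neg]
  split_ifs
  · rw [LinearMap.rTensor_smul]
    exact congrArg _ (LinearMap.rTensor_id T _)
  · exact LinearMap.rTensor_zero T

/-- For generation, constants tensored with T are vacuum vectors, and multiplication by variables
together with sums reaches every element of the tensor product. -/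
lemma isHeisenberg_heis : IsHeisenberg q A (heis q A T) where
  pos_pos i j n m := by
    change heis q A T i _ * heis q A T j _ = heis q A T j _ * heis q A T i _
    rw [heis_mul, heis_mul, heisS_pos_pos]
  neg_neg i j n m := by
    change heis q A T i _ * heis q A T j _ = heis q A T j _ * heis q A T i _
    rw [heis_mul, heis_mul, heisS_neg_neg]
  pos_neg := heis_pos_neg
  generated p hvac hadd hcre v := by
    induction v using TensorProduct.induction_on with
    | zero => exact hvac 0 fun i n => map_zero _
    | add x y hx hy => exact hadd x y hx hy
    | tmul f t =>
      induction f using MvPolynomial.induction_on with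
      | C a =>
        refine hvac _ fun i n => ?_
        rw [heis, LinearMap.rTensor_tmul, heisS_posOdd, Derivation.coeFn_coe,
          MvPolynomial.derivation_C, TensorProduct.zero_tmul]
      | add f g hf hg =>
        rw [TensorProduct.add_tmul]
        exact hadd _ _ hf hg
      | mul_X f x hf =>
        have h := hcre x.1 x.2 _ hf
        rwa [heis, LinearMap.rTensor_tmul, heisS_negOdd, LinearMap.mulLeft_apply, mul_comm] at h

variable {H : Type*} [Group H] (ρ : Representation ℂ H T)

lemma actT_mul (g g' : H) : actT ι ρ (g * g') = actT ι ρ g * actT ι ρ g' := by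
  rw [actT, map_mul]
  exact LinearMap.lTensor_mul _ _ _

lemma actT_eq_one {g : H} (hg : ρ g = 1) : actT ι ρ g = 1 := by
  rw [actT, hg]
  exact LinearMap.lTensor_id _ _

lemma commute_actT_heis (g : H) (i : ι) (m : {m : ℤ // Odd m}) :
    Commute (actT ι ρ g) (heis q A T i m) :=
  (LinearMap.lTensor_comp_rTensor _ _ _).trans (LinearMap.rTensor_comp_lTensor _ _ _).symm

variable {ρ}

lemma sign_symm {σ : ℂ} (hσ : σ * σ = 1) {g g' : H} (h : ρ g * ρ g' = σ • (ρ g' * ρ g)) :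
    ρ g' * ρ g = σ • (ρ g * ρ g') := by
  rw [h, smul_smul, hσ, one_smul]

lemma sign_inv_left {σ : ℂ} (hσ : σ * σ = 1) {g g' : H} (h : ρ g * ρ g' = σ • (ρ g' * ρ g)) :
    ρ g⁻¹ * ρ g' = σ • (ρ g' * ρ g⁻¹) := by
  have h1 : ρ g⁻¹ * ρ g' = ρ g⁻¹ * (ρ g' * ρ g) * ρ g⁻¹ := by
    simp only [← map_mul]
    congr 1
    group
  rw [h1, sign_symm hσ h, mul_smul_comm, smul_mul_assoc]
  simp only [← map_mul]
  congr 2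
  group

/-- As σ² = 1, inverting either group element leaves the sign unchanged, so the relation for a_i and
a_j extends to a_i^{±1} and a_j^{±1}. -/
lemma sign_zpow {σ : ℂ} (hσ : σ * σ = 1) {g g' : H} (h : ρ g * ρ g' = σ • (ρ g' * ρ g))
    (ε ε' : ℤˣ) : ρ (g ^ (ε : ℤ)) * ρ (g' ^ (ε' : ℤ)) =
      σ • (ρ (g' ^ (ε' : ℤ)) * ρ (g ^ (ε : ℤ))) := by
  have h1 : ρ (g ^ (ε : ℤ)) * ρ g' = σ • (ρ g' * ρ (g ^ (ε : ℤ))) := by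
    rcases Int.units_eq_one_or ε with rfl | rfl
    · simpa using h
    · simpa using sign_inv_left hσ h
  rcases Int.units_eq_one_or ε' with rfl | rfl
  · simpa using h1
  · have h2 := sign_symm hσ (sign_inv_left hσ (sign_symm hσ h1))
    simpa using h2

variable {s : ℂ} {e : ι → H}

lemma vertexData_heis (hA : A.IsSymm) (hq0 : q ≠ 0) (hq : ∀ n : ℕ, 0 < n → q ^ n ≠ 1)
    (hs : s ^ 2 = q) (hρ : ∀ i j, ρ (e i) * ρ (e j) = (-1 : ℂ) ^ (A i j) • (ρ (e j) * ρ (e i))) :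
    VertexData q s A (heis q A T) fun ε i => actT ι ρ (e i ^ (ε : ℤ)) where
  symm := hA
  ne_zero := hq0
  generic := hq
  sq := hs
  heisenberg := isHeisenberg_heis
  commute ε i j m := commute_actT_heis ρ _ j m
  sign ε i ε' j := by
    have hσ : (-1 : ℂ) ^ (A i j) * (-1 : ℂ) ^ (A i j) = 1 := by
      rw [← mul_zpow]; norm_num
    rw [← actT_mul, ← actT_mul, actT, map_mul, sign_zpow hσ (hρ i j), ← map_mul]
    exact LinearMap.lTensor_smul _ _ _
  mul_inv_one i := by
    rw [← actT_mul]
    exact actT_eq_one ρ (by simp)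

variable (d : VertexData q s A (heis q A T) fun ε i => actT ι ρ (e i ^ (ε : ℤ)))

include d

lemma vertex_eq : vertex q s A ρ e =
    vertexOp q s (heis q A T) fun ε i => actT ι ρ (e i ^ (ε : ℤ)) := by
  funext ε i m
  exact locSum_mul (vert_finite (d.locNil ε i) m) _

lemma normalOrd_eq : normalOrd q s A ρ e =
    normalOp q s (heis q A T) fun ε i => actT ι ρ (e i ^ (ε : ℤ)) := by
  funext ε i ε' j m n
  unfold normalOrd
  simp only [mul_assoc _ (actT ι ρ _) (actT ι ρ _)]
  exact locSum_mul (nord_finite (d.locNil ε i) (d.locNil ε' j) m n) _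

end FockSpace

end TwistedCurrent

end

/-! ### The theorem -/

open TwistedCurrent in
theorem theoremP {ι : Type*} [Fintype ι] [DecidableEq ι]
    -- the simply laced Cartan matrix
    (A : Matrix ι ι ℤ) (hA_symm : A.IsSymm) (hA_diag : ∀ i, A i i = 2)
    (hA_laced : A.IsSimplyLaced)
    -- a generic `q` and a square root `s` of it
    (q s : ℂ) (hq0 : q ≠ 0) (hq : ∀ n : ℕ, 0 < n → q ^ n ≠ 1) (hs : s ^ 2 = q)
    -- the central extension of the root lattice, and preimages `e i` of the simple roots
    {Qhat : Type*} [Group Qhat]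
    (S : GroupExtension (Multiplicative (ZMod 2)) Qhat (Multiplicative (ι → ℤ)))
    (hS_central : ∀ k, S.inl k ∈ Subgroup.center Qhat)
    (hS_comm : ∀ a b : Qhat, a * b * a⁻¹ * b⁻¹ =
      S.inl (Multiplicative.ofAdd
        ((form A (S.rightHom a).toAdd (S.rightHom b).toAdd : ℤ) : ZMod 2)))
    (e : ι → Qhat) (he : ∀ i, S.rightHom (e i) = Multiplicative.ofAdd (Pi.single i 1))
    -- the module `T`
    {T : Type*} [AddCommGroup T] [Module ℂ T] (ρ : Representation ℂ Qhat T)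
    (hρ : ∀ i j, ρ (e i) * ρ (e j) = (-1 : ℂ) ^ (A i j) • (ρ (e j) * ρ (e i))) :
    let X := vertex q s A ρ e
    let Φ := Phi q A T
    let Ψ := Psi q A T
    -- `V_Q` is a module of the Heisenberg algebra with `γ = q`
    (∀ i j m n, heis q A T i m * heis q A T j n - heis q A T j n * heis q A T i m =
      if m.1 = -n.1 then
        (qint q (A i j * m.1) / (2 * (m.1 : ℂ)) *
          ((q ^ m.1 - q ^ (-m.1)) / (q - q⁻¹))) • 1
      else 0) ∧
    -- `Φ_i(q^{-1/2} z) = :X_i^+(q⁻¹ z) X_i^-(z):` and `Ψ_i(q^{1/2} z) = :X_i^+(q z) X_i^-(z):`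
    (∀ i, scale (fun k => s ^ (-k)) (inZ (Φ i)) = diag q⁻¹ 1 (normalOrd q s A ρ e 1 i (-1) i)) ∧
    (∀ i, scale (fun k => s ^ k) (inZInv (Ψ i)) = diag q 1 (normalOrd q s A ρ e 1 i (-1) i)) ∧
    -- `Φ_i(z) Ψ_j(w) = Ψ_j(w) Φ_i(z) G_{ij}(q⁻¹ z/w) / G_{ij}(q z/w)`
    (∀ i j, prodZW (inZ (Φ i)) (inZInv (Ψ j)) =
      mulZoverW (prodWZ (inZInv (Ψ j)) (inZ (Φ i)))
        (scalarOp ι T (PowerSeries.rescale q⁻¹ (G q (A i j)) *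
          (PowerSeries.rescale q (G q (A i j)))⁻¹))) ∧
    -- `[Φ_i(z), Φ_j(w)] = [Ψ_i(z), Ψ_j(w)] = 0`
    (∀ i j, commZW (inZ (Φ i)) (inZ (Φ j)) = 0) ∧
    (∀ i j, commZW (inZInv (Ψ i)) (inZInv (Ψ j)) = 0) ∧
    -- `Φ_i(z) X_j^±(w) Φ_i(z)⁻¹ = X_j^±(w) G_{ij}(q^{∓1/2} z/w)^{±1}`
    (∀ (i j : ι) (ε : ℤˣ), IsUnit (Φ i) ∧ conjZ (Φ i) (X ε j) =
      mulZoverW (inW (X ε j))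
        (scalarOp ι T (PowerSeries.rescale (s ^ (-(ε : ℤ))) (Gpow q (A i j) ε)))) ∧
    -- `Ψ_i(z) X_j^±(w) Ψ_i(z)⁻¹ = X_j^±(w) G_{ij}(q^{∓1/2} w/z)^{∓1}`
    (∀ (i j : ι) (ε : ℤˣ), IsUnit (Ψ i) ∧ conjZInv (Ψ i) (X ε j) =
      mulWoverZ (inW (X ε j))
        (scalarOp ι T (PowerSeries.rescale (s ^ (-(ε : ℤ))) (Gpow q (A i j) (-ε))))) ∧
    -- the case `(α_i|α_j) = 0`
    (∀ i j, A i j = 0 →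
      (∀ ε, commZW (X ε i) (X ε j) = 0) ∧ commZW (X 1 i) (X (-1) j) = 0) ∧
    -- `[X_i^+(z), X_j^-(w)] = 2 :X_i^+(z) X_j^-(-z): δ(-w/z)` if `(α_i|α_j) = -1`
    (∀ i j, A i j = -1 →
      commZW (X 1 i) (X (-1) j) =
        (2 : ℂ) • mulDelta (fun k => (-1 : ℂ) ^ k)
          (diag 1 (-1) (normalOrd q s A ρ e 1 i (-1) j))) ∧
    -- `[X_i^+(z), X_i^-(w)]`
    -- `= 2(q+q⁻¹)/(q-q⁻¹) (Ψ_i(q^{-1/2} z) δ(q w/z) - Φ_i(q^{1/2} z) δ(q⁻¹ w/z))`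
    (∀ i, commZW (X 1 i) (X (-1) i) =
      (2 * (q + q⁻¹) / (q - q⁻¹)) •
        (mulDelta (fun k => q ^ k) (scale (fun k => s ^ (-k)) (inZInv (Ψ i)))
          - mulDelta (fun k => q ^ (-k)) (scale (fun k => s ^ k) (inZ (Φ i))))) ∧
    -- `(z - q^{∓1}w)(z + q^{±1}w) X_i^±(z) X_j^±(w)`
    -- `= (q^{∓1}z - w)(q^{±1}z + w) X_j^±(w) X_i^±(z)` if `(α_i|α_j) = -1`
    (∀ (i j : ι) (ε : ℤˣ), A i j = -1 →
      lin 1 (-q ^ (-(ε : ℤ))) (lin 1 (q ^ (ε : ℤ)) (prodZW (X ε i) (X ε j))) =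
        lin (q ^ (-(ε : ℤ))) (-1) (lin (q ^ (ε : ℤ)) 1 (prodWZ (X ε j) (X ε i)))) ∧
    -- `(z - q^{±2}w)(z + q^{∓2}w) X_i^±(z) X_i^±(w)`
    -- `= (q^{±2}z - w)(q^{∓2}z + w) X_i^±(w) X_i^±(z) + 2(q+q⁻¹)² z² δ(-w/z) a_i^{±2}`
    (∀ (i : ι) (ε : ℤˣ),
      lin 1 (-q ^ (2 * (ε : ℤ))) (lin 1 (q ^ (-2 * (ε : ℤ))) (prodZW (X ε i) (X ε i))) =
        lin (q ^ (2 * (ε : ℤ))) (-1) (lin (q ^ (-2 * (ε : ℤ))) 1 (prodWZ (X ε i) (X ε i)))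
          + mulDelta (fun k => (-1 : ℂ) ^ k)
              (mono 2 ((2 * (q + q⁻¹) ^ 2) • actT ι ρ (e i ^ (2 * (ε : ℤ)))))) ∧
    -- if every `a_i²` acts on `T` as `1`, then `V_Q` is a level-one representation of `U_q(g̃)`
    ((∀ i, ρ (e i ^ 2) = 1) →
      ∃ π : Uq q A →ₐ[ℂ] Module.End ℂ (Fock ι ⊗[ℂ] T),
        π (Uq.of q A Gen.c) = 1 ∧
        π (Uq.of q A Gen.gammaHalf) = s • 1 ∧
        π (Uq.of q A Gen.gammaHalfInv) = s⁻¹ • 1 ∧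
        (∀ i m, π (Uq.of q A (Gen.a i m)) = heis q A T i m) ∧
        ∀ ε i n, π (Uq.of q A (Gen.x ε i n)) = X ε i (-n)) := by
  have d := vertexData_heis hA_symm hq0 hq hs hρ
  intro X Φ Ψ
  -- `Phi` and `Psi` agree with `phiOp` and `psiOp` by unfolding. Vertex operators and normal
  -- ordered products need a rewriting, since there the group element sits inside the pointwise sum.
  have hX : X = _ := vertex_eq d
  rw [normalOrd_eq d]
  clear_value X
  subst hX
  refine ⟨d.heisenberg.commutator hA_symm, d.phi_eq_diag, d.psi_eq_diag, d.phi_psi, d.phi_phi,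
    d.psi_psi, fun i j ε => ⟨d.isUnit_phi i, d.phi_vertex i j ε⟩,
    fun i j ε => ⟨d.isUnit_psi i, d.psi_vertex i j ε⟩,
    fun i j hij => ⟨fun ε => d.vertex_comm_of_eq_zero hij ε ε, d.vertex_comm_of_eq_zero hij 1 (-1)⟩,
    fun i j hij => d.vertex_comm_of_eq_neg_one hij, fun i => d.vertex_comm_same (hA_diag i),
    fun i j ε hij => d.vertex_exchange_of_eq_neg_one hij ε, fun i ε => ?_, fun hsq => ?_⟩
  · have h2 : actT ι ρ (e i ^ (2 * (ε : ℤ))) =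
        actT ι ρ (e i ^ (ε : ℤ)) * actT ι ρ (e i ^ (ε : ℤ)) := by
      rw [two_mul, zpow_add, actT_mul]
    rw [h2]
    exact d.vertex_exchange_same (hA_diag i) ε
  · have hτ : ∀ (ε : ℤˣ) (i : ι), actT ι ρ (e i ^ (ε : ℤ)) * actT ι ρ (e i ^ (ε : ℤ)) = 1 := by
      intro ε i
      rw [← actT_mul]
      refine actT_eq_one ρ ?_
      rcases Int.units_eq_one_or ε with rfl | rfl
      · simpa [pow_two] using hsq i
      · have h1 : ρ (e i ^ 2) * ρ ((e i)⁻¹ * (e i)⁻¹) = 1 := by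
          rw [← map_mul, ← map_one ρ]
          congr 1
          group
        rw [hsq, one_mul] at h1
        simpa using h1
    obtain ⟨π, hπ⟩ := d.exists_levelOne hA_diag hτ
    exact ⟨π, hπ _, hπ _, hπ _, fun i m => hπ _, fun ε i n => hπ _⟩
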